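/- **Setting.** Let $N=N_p:\hat{\mathbb C}\to\hat{\mathbb C}$, $N(z)=z-p(z)/p'(z)$, be the Newton map of a complex polynomial $p$ with $d\ge 3$ distinct roots (so $\deg N=d$). Let $\zeta_1,\dots,\zeta_n\in\mathbb C$ ($n\ge1$) be distinct (marked) fixed points of $N$ with multiplier $N'(\zeta_j)=\tfrac12$, with immediate basins $\mathcal A^\circ_j$. Assume that $\mathcal A_j^\circ$ contains exactly one critical point $c_j$ of $N$, that it has maximal multiplicity $k_j-1$, where $k_j=\deg(N,c_j)$ (that is, $c_j$ is the only preimage of $N(c_j)$ in $\mathcal A_j^\circ$), and that every critical point of $N$ outside the basins of $\zeta_1,\dots,\zeta_n$ has a finite orbit; such an orbit may land at $\infty$, so $\infty$ may belong to the postcritical set. (These are the maps obtained from a postcritically finite Newton map by changing its marked superattracting fixed points into attracting ones of multiplier $\tfrac12$.) Let $\psi_j:\mathcal A_j^\circ\to\mathbb D$ be the Riemann map with $\psi_j(c_j)=0$ and $b_j:=\psi_j(N(c_j))>0$. Put $B_j(z)=\frac{z^{k_j}+b_j}{1+b_jz^{k_j}}$ and $P_{k}(z)=\frac{z^{k}+a}{1+az^{k}}$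 with $a=\frac{k-1}{k+1}$. **Disk surgery.** For each $j$ let $\phi_j:\mathbb D\to\mathbb D$ be an orientation preserving piecewise $C^1$ homeomorphism with locally bounded dilatation, and let $S_j\subset\mathbb D$ be a set (a sector with vertex $1$) such that $S_j\cup\{1\}$ is compact, $S_j$ is a neighbourhood of the fixed point of $B_j$ in $\mathbb D$, and 1. $\phi_j\circ B_j=P_{k_j}\circ\phi_j$ on $\mathbb D\setminus S_j$; 2. the intersection $S_j'$ of $S_j$ with some neighbourhood of $1$ is $\bigcup_{m\ge m_0}Q_m$, where $m_0\ge 1$ and, for some $0<\theta<\pi$, $Q_m$ corresponds to $\{w:\lambda^{-(m+1)}\le|w|\le\lambda^{-m},\ \theta\le\arg w\le2\pi-\theta\}$ in a coordinate $w$ at $1$ that conjugates $B_j$ to $w\mapsto\lambda w$, $\lambda=B_j'(1)$, and in which the positive real direction at $1$ corresponds to the positive real direction at $0$; 3. $\phi_j$ has dilatation bounded away from $1$ a.e. on $\mathbb D\setminus\bigcup_{i\ge0}B_j^{-i}(S_j')$; 4. the real dilatation $K_{\phi_j}$ satisfies $K_{\phi_j}\asymp m$ a.e. on $Q_m$, uniformly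 in $m\ge m_0$. **The form $\mu$.** Let $G=\psi_j^{-1}\circ\phi_j^{-1}\circ P_{k_j}\circ\phi_j\circ\psi_j$ on $\mathcal A_j^\circ$ and $G=N$ elsewhere. Let $\mu=\psi_j^*(\partial_{\bar z}\phi_j/\partial_z\phi_j)$ on $\mathcal A_j^\circ$, let $\mu=(N^{\circ m})^*\mu$ at points whose $N$-orbit first enters $\bigcup_j\mathcal A_j^\circ$ at time $m\ge1$, and $\mu=0$ elsewhere. **Claim.** The form $\mu$ is $G$-invariant, i.e. $G^*\mu=\mu$ almost everywhere, and it is a David--Beltrami differential on $\hat{\mathbb C}$: it is measurable, $\|\mu\|_\infty=1$, and there are constants $M,\alpha,\varepsilon_0>0$ such that $$\operatorname{Area}\{z\in\hat{\mathbb C}:|\mu(z)|>1-\varepsilon\}<M e^{-\alpha/\varepsilon}\qquad\text{for all }0<\varepsilon<\varepsilon_0,$$ where Area is the spherical area. -/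

import Mathlib

open Filter Topology MeasureTheory

/-! ## Wirtinger derivatives and Beltrami forms -/

/-- The Wirtinger derivative `∂f/∂z`. -/
noncomputable def dz (f : ℂ → ℂ) (z : ℂ) : ℂ :=
  (fderiv ℝ f z 1 - Complex.I * fderiv ℝ f z Complex.I) / 2

/-- The Wirtinger derivative `∂f/∂z̄`. -/
noncomputable def dzbar (f : ℂ → ℂ) (z : ℂ) : ℂ :=
  (fderiv ℝ f z 1 + Complex.I * fderiv ℝ f z Complex.I) / 2

/-- The pull-back `f^*μ` of a Beltrami form `μ(z) dz̄/dz` under `f`.  For `μ = 0` it is the complex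
dilatation `f_z̄ / f_z`; for holomorphic `f` it is `μ(f(z)) * conj (f'(z)) / f'(z)`. -/
noncomputable def beltramiPullback (f μ : ℂ → ℂ) (z : ℂ) : ℂ :=
  (dzbar f z + μ (f z) * (starRingEnd ℂ) (dz f z)) /
    (dz f z + μ (f z) * (starRingEnd ℂ) (dzbar f z))

/-- The complex dilatation of `f`, i.e. the pull-back of the standard structure `μ₀ = 0`. -/
noncomputable def complexDilatation (f : ℂ → ℂ) : ℂ → ℂ := beltramiPullback f 0

/-- The real dilatation `K_f = (1 + |μ_f|) / (1 - |μ_f|)`. -/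
noncomputable def realDilatation (f : ℂ → ℂ) (z : ℂ) : ℝ :=
  (1 + ‖complexDilatation f z‖) / (1 - ‖complexDilatation f z‖)

/-- Spherical area, written in the affine coordinate (the point `∞` has area zero). -/
noncomputable def sphericalArea : Measure ℂ :=
  volume.withDensity fun z => ENNReal.ofReal (4 / (1 + ‖z‖ ^ 2) ^ 2)

/-- David--Beltrami differentials on the Riemann sphere, written in the affine coordinate:
measurable, of essential supremum norm one, and satisfying the exponential area condition. -/
structure IsDavidBeltrami (μ : ℂ → ℂ) : Prop where
  measurable : Measurable μ
  norm_eq_one : eLpNorm μ ⊤ volume = 1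
  area : ∃ M α ε₀ : ℝ, 0 < M ∧ 0 < α ∧ 0 < ε₀ ∧ ∀ ε : ℝ, 0 < ε → ε < ε₀ →
    sphericalArea {z | 1 - ε < ‖μ z‖} < ENNReal.ofReal (M * Real.exp (-α / ε))

/-! ## Newton maps and their dynamics on the Riemann sphere -/

open Classical in
/-- The Newton map `z - p(z)/p'(z)` of a polynomial (of degree at least two), as a self-map of the
Riemann sphere.  A zero of `p'` that is not a zero of `p` is a pole; at a multiple zero `z` of `p`
the quotient `p/p'` has a removable singularity with value `0`, which is also the value of the
formula below. -/
noncomputable def newtonMap (p : Polynomial ℂ) : OnePoint ℂ → OnePoint ℂ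
  | OnePoint.infty => OnePoint.infty
  | OnePoint.some z =>
      if p.derivative.eval z = 0 ∧ p.eval z ≠ 0 then OnePoint.infty
      else ((z - p.eval z / p.derivative.eval z : ℂ) : OnePoint ℂ)

/-- The affine coordinate on the sphere (with the irrelevant value `0` at `∞`). -/
noncomputable def toPlane : OnePoint ℂ → ℂ
  | OnePoint.infty => 0
  | OnePoint.some z => z

/-- A self-map of the sphere in the affine coordinate; only used near points `z` with
`f z ≠ ∞`. -/
noncomputable def inPlane (f : OnePoint ℂ → OnePoint ℂ) (z : ℂ) : ℂ := toPlane (f z)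

/-- Critical points of a nonconstant rational map: points of local degree greater than one, i.e.
points near which the map is not injective.  (Multiple poles are included.) -/
def IsCriticalPoint (f : OnePoint ℂ → OnePoint ℂ) (x : OnePoint ℂ) : Prop :=
  ∀ U ∈ 𝓝 x, ¬ Set.InjOn f U

/-- The basin of attraction of `ξ`. -/
def basin (f : OnePoint ℂ → OnePoint ℂ) (ξ : OnePoint ℂ) : Set (OnePoint ℂ) :=
  interior {x | Tendsto (fun m : ℕ => f^[m] x) atTop (𝓝 ξ)}

/-- The immediate basin of an attracting fixed point `ξ`. -/
def immediateBasin (f : OnePoint ℂ → OnePoint ℂ) (ξ : OnePoint ℂ) : Set (OnePoint ℂ) :=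
  connectedComponentIn (basin f ξ) ξ

/-- `N` is the Newton map of `p`, has degree at least three (the degree is the number of distinct
roots), and `ζ j` are its marked fixed points: they are distinct, attracting with multiplier `1/2`,
the immediate basin of `ζ j` contains the single critical point `c j`, of maximal multiplicity
`k j - 1` (so that `c j` is the only preimage of its image in the immediate basin), and all
critical points of `N` outside the marked basins have finite orbits.  They may land at `∞`. -/
structure IsMarkedNewtonMap (p : Polynomial ℂ) {n : ℕ} (ζ c : Fin n → ℂ) (k : Fin n → ℕ) :
    Prop where
  degree : 3 ≤ p.roots.toFinset.card
  injective : Function.Injective ζ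
  fixed : ∀ j, newtonMap p (ζ j) = ζ j
  multiplier : ∀ j, deriv (inPlane (newtonMap p)) (ζ j) = 1 / 2
  center_mem : ∀ j, (c j : OnePoint ℂ) ∈ immediateBasin (newtonMap p) (ζ j)
  center_unique : ∀ j, ∀ x ∈ immediateBasin (newtonMap p) (ζ j),
    IsCriticalPoint (newtonMap p) x ↔ x = c j
  center_maximal : ∀ j, ∀ x ∈ immediateBasin (newtonMap p) (ζ j),
    newtonMap p x = newtonMap p (c j) → x = c j
  center_degree : ∀ j, analyticOrderAt
    (fun z => inPlane (newtonMap p) z - inPlane (newtonMap p) (c j)) (c j) = k j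
  finite_orbit : ∀ x, IsCriticalPoint (newtonMap p) x → (∀ j, x ∉ basin (newtonMap p) (ζ j)) →
    (Set.range fun m : ℕ => (newtonMap p)^[m] x).Finite

/-- `ψ` is a Riemann map of the immediate basin `A` of the Newton map `N` onto the unit disk,
normalized so that the critical point `c` goes to `0` and the critical value to `b > 0`. -/
structure IsNormalizedRiemannMap (N : OnePoint ℂ → OnePoint ℂ) (A : Set (OnePoint ℂ)) (c : ℂ)
    (b : ℝ) (ψ : OpenPartialHomeomorph ℂ ℂ) : Prop where
  source : ψ.source = {z : ℂ | (z : OnePoint ℂ) ∈ A}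
  target : ψ.target = Metric.ball 0 1
  holomorphic : DifferentiableOn ℂ ψ ψ.source
  center : ψ c = 0
  value_pos : 0 < b
  value : ψ (inPlane N c) = b

/-! ## The surgery in the unit disk -/

/-- The Blaschke product `(z^k + b) / (1 + b z^k)`. -/
noncomputable def blaschke (k : ℕ) (b : ℝ) (z : ℂ) : ℂ := (z ^ k + b) / (1 + b * z ^ k)

/-- The parabolic Blaschke product `P_k`. -/
noncomputable def parabolicBlaschke (k : ℕ) : ℂ → ℂ := blaschke k ((k - 1) / (k + 1))

/-- The multiplier of `blaschke k b` at its fixed point `1`. -/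
noncomputable def multiplierAtOne (k : ℕ) (b : ℝ) : ℝ := k * (1 - b) / (1 + b)

/-- `κ` is the inverse of a linearizing coordinate of `blaschke k b` at `1`, on the disk of radius
`r`.  As `κ'(0) > 0`, the unit disk corresponds to the left half-plane. -/
structure IsLinearizer (k : ℕ) (b : ℝ) (κ : ℂ → ℂ) (r : ℝ) : Prop where
  pos : 0 < r
  holomorphic : DifferentiableOn ℂ κ (Metric.ball 0 r)
  injOn : Set.InjOn κ (Metric.ball 0 r)
  map_zero : κ 0 = 1
  deriv_pos : ∃ a : ℝ, 0 < a ∧ deriv κ 0 = a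
  semiconj : ∀ w : ℂ, ‖w‖ < r → ‖(multiplierAtOne k b : ℂ) * w‖ < r →
    blaschke k b (κ w) = κ (multiplierAtOne k b * w)

/-- The quadrilateral `lam^{-(m+1)} ≤ |w| ≤ lam^{-m}`, `θ ≤ arg w ≤ 2π - θ` of the model map
`w ↦ lam * w`. -/
def modelQuad (lam θ : ℝ) (m : ℕ) : Set ℂ :=
  {w | (lam ^ (m + 1))⁻¹ ≤ ‖w‖ ∧ ‖w‖ ≤ (lam ^ m)⁻¹ ∧ |Complex.arg (-w)| ≤ Real.pi - θ}

/-- `φ` is an orientation preserving piecewise `C¹` homeomorphism on the unit disk: the disk is a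
locally finite union of relatively closed pieces with negligible boundaries, on each of which `φ`
coincides with a `C¹` map of positive Jacobian (up to the boundary of the piece, but possibly away
from a locally finite set `E` of points), and the dilatation is locally bounded. -/
def IsPiecewiseC1OnDisk (φ : ℂ → ℂ) : Prop :=
  (∃ (E : Set ℂ) (P : ℕ → Set ℂ) (f : ℕ → ℂ → ℂ),
    (∀ C : Set ℂ, IsCompact C → C ⊆ Metric.ball 0 1 →
      (E ∩ C).Finite ∧ {i | (P i ∩ C).Nonempty}.Finite) ∧
    (⋃ i, P i) = Metric.ball 0 1 ∧
    ∀ i, (∃ F : Set ℂ, IsClosed F ∧ P i = F ∩ Metric.ball 0 1) ∧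
      volume (frontier (P i)) = 0 ∧ Set.EqOn φ (f i) (P i) ∧
      ∀ z ∈ P i \ E, ContDiffAt ℝ 1 (f i) z ∧ 0 < (fderiv ℝ (f i) z).det) ∧
  ∀ C : Set ℂ, IsCompact C → C ⊆ Metric.ball 0 1 →
    ∃ q : ℝ, q < 1 ∧ ∀ᵐ z : ℂ, z ∈ C → ‖complexDilatation φ z‖ ≤ q

/-- `φ` is a surgery map between `B = blaschke k b` and `P_k`, with sector `S` and its end `S₁`.

* `φ` is a piecewise `C¹` homeomorphism of the unit disk onto itself;
* `S` is a sector in the disk with vertex `1` (its only boundary point on the circle), and a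
  neighbourhood of the fixed point of `B` in the disk;
* `S₁` is the intersection of `S` with a neighbourhood of `1`, and is the union of the
  quadrilaterals `Q_m` (`m ≥ m₀`) that correspond to those of the linear model of `B` at `1`;
* `φ ∘ B = P_k ∘ φ` off `S`;
* `φ` is quasiconformal off the iterated preimages of `S₁`;
* `K_φ ≍ m` on `Q_m`. -/
structure IsDiskSurgery (k : ℕ) (b : ℝ) (φ : OpenPartialHomeomorph ℂ ℂ) (S S₁ : Set ℂ) :
    Prop where
  source : φ.source = Metric.ball 0 1
  target : φ.target = Metric.ball 0 1
  piecewise : IsPiecewiseC1OnDisk φ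
  sector_subset : S ⊆ Metric.ball 0 1
  sector_compact : IsCompact (insert 1 S)
  sector_nhds : ∃ α ∈ Metric.ball (0 : ℂ) 1, blaschke k b α = α ∧ S ∈ 𝓝 α
  sector_end : ∃ W ∈ 𝓝 (1 : ℂ), S₁ = S ∩ W
  conj : ∀ z ∈ Metric.ball (0 : ℂ) 1 \ S, φ (blaschke k b z) = parabolicBlaschke k (φ z)
  quasiconformal : ∃ q : ℝ, q < 1 ∧ ∀ᵐ z : ℂ, z ∈ Metric.ball (0 : ℂ) 1 →
    (∀ i : ℕ, (blaschke k b)^[i] z ∉ S₁) → ‖complexDilatation φ z‖ ≤ q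
  quads : ∃ (κ : ℂ → ℂ) (r θ : ℝ) (m₀ : ℕ), IsLinearizer k b κ r ∧ 0 < θ ∧ θ < Real.pi ∧
    1 ≤ m₀ ∧ (multiplierAtOne k b ^ m₀)⁻¹ < r ∧
    S₁ = (⋃ m ∈ Set.Ici m₀, κ '' modelQuad (multiplierAtOne k b) θ m) ∧
    ∃ C : ℝ, 0 < C ∧ ∀ m : ℕ, m₀ ≤ m →
      ∀ᵐ z : ℂ, z ∈ κ '' modelQuad (multiplierAtOne k b) θ m →
        C⁻¹ * m ≤ realDilatation φ z ∧ realDilatation φ z ≤ C * m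

/-! ## The topological model and the invariant Beltrami form -/

open Classical in
/-- The topological model `G`: it is `ψ⁻¹ ∘ φ⁻¹ ∘ P_k ∘ φ ∘ ψ` on the marked immediate basins `A j`
and `N` elsewhere. -/
noncomputable def modelMap (N : OnePoint ℂ → OnePoint ℂ) {n : ℕ} (A : Fin n → Set (OnePoint ℂ))
    (k : Fin n → ℕ) (ψ φ : Fin n → OpenPartialHomeomorph ℂ ℂ) (x : OnePoint ℂ) : OnePoint ℂ :=
  if h : ∃ j, x ∈ A j then
    let j := h.choose
    (((ψ j).symm ((φ j).symm (parabolicBlaschke (k j) (φ j (ψ j (toPlane x))))) : ℂ) : OnePoint ℂ)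
  else N x

/-- The form `ψ^*(φ_z̄ / φ_z)` on the (disjoint) marked immediate basins `A j`. -/
noncomputable def coreForm {n : ℕ} (A : Fin n → Set (OnePoint ℂ))
    (ψ φ : Fin n → OpenPartialHomeomorph ℂ ℂ) (z : ℂ) : ℂ :=
  ∑ j, {z : ℂ | (z : OnePoint ℂ) ∈ A j}.indicator
    (beltramiPullback (ψ j) (complexDilatation (φ j))) z

open Classical in
/-- The form `μ`: the form `coreForm` on the marked immediate basins, its pull-back under `N^m` at
points whose orbit first enters the marked immediate basins at time `m`, and the standard structure
`0` elsewhere. -/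
noncomputable def surgeryForm (N : OnePoint ℂ → OnePoint ℂ) {n : ℕ}
    (A : Fin n → Set (OnePoint ℂ)) (ψ φ : Fin n → OpenPartialHomeomorph ℂ ℂ) (z : ℂ) : ℂ :=
  if h : ∃ m : ℕ, N^[m] z ∈ ⋃ j, A j then
    beltramiPullback (inPlane N^[Nat.find h]) (coreForm A ψ φ) z
  else 0

/-!
The proof has three parts: the Newton map on a marked immediate basin is understood through a
Blaschke product, the invariance is a matter of the chain rule for Beltrami forms, and the area
condition is an estimate for the iterated preimages of sets that shrink to `∞`.

On a marked immediate basin, the Riemann map `ψ` turns the Newton map `N` into a proper holomorphic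
self-map of the disc for which the critical point `0` is the only preimage of its image `b`. Such a
map is the Blaschke product `(z ^ k + b) / (1 + b z ^ k)` up to a unimodular factor
(`exists_unimodular_of_proper`), and the multiplier `1/2` of the fixed point forces this factor to
be `1` (`unimodular_eq_one`, `IsMarkedBasin.exists_conj`).

Invariance: on an immediate basin, the form is the pull-back of the standard structure under
`φ ∘ ψ`, and `φ ∘ ψ` conjugates the model map to the holomorphic map `P_k`. On the other points that
enter the immediate basins, the form is defined by pulling back under `N`, which is the model map
there. On the remaining set the form is `0`, and the model map agrees with `N`. The model map may
fail to be smooth at these points, but two maps that agree on a set have the same derivative at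
almost every point of the set where both are differentiable (`ae_fderiv_eq_of_eqOn`), so that the
pull-back of the form under the model map is `0` almost everywhere on the set.

Area: let `|μ| > 1 - ε` at a point `z`. Up to null sets, the orbit of `z` enters an immediate basin,
and there `|μ|` is the dilatation of `φ`, which does not change along the orbit as long as it stays
off the sector. Hence the orbit enters a quadrilateral `Q_m` with `m ≥ 1 / (C ε)`
(`IsMarkedBasin.ae_exists_iterate_mem_modelQuad`). In the plane, the quadrilaterals converge to `∞`:
a finite limit point would be a fixed point of `N` on the boundary of the immediate basin, but all
finite fixed points are roots of the polynomial, hence attracting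
(`IsMarkedBasin.exists_lt_norm_symm_linearizer`). As `∞` is a repelling fixed point, the convergence
is exponential in `m` (`IsMarkedBasin.exists_le_norm_of_mem_modelQuad`).

It remains to show that the set of points whose orbit enters `T m`, the union of the quadrilaterals
of index at least `m`, has an area that is exponentially small in `m` (`exists_area_entering_le`).
Choose a time `L` by which all critical points that land at `∞` have landed. Since `N` is injective
near `∞` and `T m` is backward invariant there, an orbit enters `T m` either within time `L`, or
`L + 1` steps after having passed near a point `y` that lands at `∞` at time `L + 1`
(`exists_cover_of_entering_set`). The first case is settled by a polynomial estimate for finitely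
many iterates (`powerDecay_iterate_preimage`). In the second case, a disc about `y` contains no
postcritical point, because critical points outside the marked basins have finite orbits and those
inside are attracted to roots. The inverse branches of all iterates over this disc have bounded
distortion in the spherical metric, as they omit a fixed point of `N`
(`exists_area_preimage_comparison`). So the total area of the iterated preimages of a small subset
of the disc is compared with that of the preimages of a closed disc in a basin, and the latter is
finite because an orbit visits this closed disc a bounded number of times
(`tsum_area_preimage_ne_top`).
-/

namespace NewtonSurgery

/-! ### Distortion of injective holomorphic functions -/

/-- If the derivative vanished, the function would be the `n`-th power of a local coordinate up to
constants, with `n ≥ 2`, and would identify points that differ by a root of unity. -/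
theorem deriv_ne_zero_of_injOn {f : ℂ → ℂ} {z₀ : ℂ} (hf : AnalyticAt ℂ f z₀) {U : Set ℂ}
    (hU : U ∈ 𝓝 z₀) (hinj : Set.InjOn f U) : deriv f z₀ ≠ 0 := by
  have hF : AnalyticAt ℂ (fun z => f z - f z₀) z₀ := hf.sub analyticAt_const
  have htop : analyticOrderAt (fun z => f z - f z₀) z₀ ≠ ⊤ := by
    intro h
    rw [analyticOrderAt_eq_top] at h
    have h2 : ∀ᶠ z in 𝓝[≠] z₀, z ∈ U ∧ f z - f z₀ = 0 :=
      (Filter.Eventually.and hU h).filter_mono nhdsWithin_le_nhds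
    obtain ⟨z, ⟨hz1, hz2⟩, hz3⟩ := (h2.and self_mem_nhdsWithin).exists
    exact hz3 (hinj hz1 (mem_of_mem_nhds hU) (sub_eq_zero.1 hz2))
  obtain ⟨n, hn⟩ := ENat.ne_top_iff_exists.1 htop
  obtain ⟨g, hg, hg0, hfg⟩ := (hF.analyticOrderAt_eq_natCast (n := n)).1 hn.symm
  have hn0 : n ≠ 0 := by
    rintro rfl
    have := hfg.self_of_nhds
    simp at this
    exact hg0 this.symm
  have hquot : AnalyticAt ℂ (fun z => g z / g z₀) z₀ := hg.div analyticAt_const hg0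
  have hval : g z₀ / g z₀ = 1 := div_self hg0
  set h : ℂ → ℂ := fun z => (z - z₀) * (g z / g z₀) ^ (1 / n : ℂ) with hh
  have hrootan : AnalyticAt ℂ (fun z => (g z / g z₀) ^ (1 / n : ℂ)) z₀ := by
    apply hquot.cpow analyticAt_const
    simp [hval]
  have hderiv : HasStrictDerivAt h 1 z₀ := by
    have h1 : HasDerivAt h (1 * (g z₀ / g z₀) ^ (1 / n : ℂ) +
        (z₀ - z₀) * deriv (fun z => (g z / g z₀) ^ (1 / n : ℂ)) z₀) z₀ :=
      ((hasDerivAt_id z₀).sub_const z₀).mul hrootan.differentiableAt.hasDerivAt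
    have h2 : AnalyticAt ℂ h z₀ := (analyticAt_id.sub analyticAt_const).mul hrootan
    have h3 := h2.hasStrictDerivAt
    rw [h1.deriv] at h3
    simpa [hval] using h3
  have hpow : ∀ᶠ z in 𝓝 z₀, f z - f z₀ = g z₀ * h z ^ n := by
    filter_upwards [hfg] with z hz
    rw [hz, hh]
    simp only [smul_eq_mul, mul_pow]
    rw [← Complex.cpow_nat_mul, mul_one_div_cancel (by exact_mod_cast hn0), Complex.cpow_one]
    field_simp
  rcases eq_or_ne n 1 with rfl | hn1
  · have h4 : HasDerivAt (fun z => f z - f z₀) (g z₀ * 1) z₀ := by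
      refine (hderiv.hasDerivAt.const_mul (g z₀)).congr_of_eventuallyEq ?_
      filter_upwards [hpow] with z hz
      simpa using hz
    have h5 : HasDerivAt f (g z₀ * 1) z₀ := by simpa using h4.add_const (f z₀)
    rw [h5.deriv, mul_one]
    exact hg0
  · exfalso
    have hopen : h '' (U ∩ {z | f z - f z₀ = g z₀ * h z ^ n}) ∈ 𝓝 (h z₀) := by
      rw [← hderiv.map_nhds_eq one_ne_zero]
      exact Filter.image_mem_map (Filter.inter_mem hU hpow)
    have h0 : h z₀ = 0 := by simp [hh]
    rw [h0] at hopen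
    obtain ⟨ε, hε, hball⟩ := Metric.mem_nhds_iff.1 hopen
    set ω : ℂ := Complex.exp (2 * Real.pi * Complex.I / n) with hω
    have hprim : IsPrimitiveRoot ω n := Complex.isPrimitiveRoot_exp n hn0
    have hω1 : ω ≠ 1 := hprim.ne_one (by omega)
    have hx : ((ε / 2 : ℝ) : ℂ) ∈ Metric.ball (0 : ℂ) ε := by
      simp [abs_of_pos hε]; linarith
    have hy : ω * ((ε / 2 : ℝ) : ℂ) ∈ Metric.ball (0 : ℂ) ε := by
      rw [mem_ball_zero_iff, norm_mul, hprim.norm'_eq_one hn0, one_mul]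
      simpa using hx
    obtain ⟨x, ⟨hxU, hx1⟩, hx2⟩ := hball hx
    obtain ⟨y, ⟨hyU, hy1⟩, hy2⟩ := hball hy
    have : f x = f y := by
      have e1 : f x - f z₀ = g z₀ * h x ^ n := hx1
      have e2 : f y - f z₀ = g z₀ * h y ^ n := hy1
      rw [hy2, mul_pow, hprim.pow_eq_one, one_mul] at e2
      rw [hx2] at e1
      exact sub_left_inj.1 (e1.trans e2.symm)
    have hxy := hinj hxU hyU this
    rw [hxy, hy2] at hx2
    have hne : ((ε / 2 : ℝ) : ℂ) ≠ 0 := by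
      exact_mod_cast (by positivity : (ε / 2 : ℝ) ≠ 0)
    exact hω1 (mul_right_cancel₀ hne (hx2.trans (one_mul _).symm))

theorem exists_holomorphic_inverse {f : ℂ → ℂ} {U : Set ℂ} (hU : IsOpen U)
    (hf : DifferentiableOn ℂ f U) (hinj : Set.InjOn f U) :
    ∃ g : ℂ → ℂ, IsOpen (f '' U) ∧ (∀ z ∈ U, g (f z) = z) ∧
      ∀ z ∈ U, deriv f z ≠ 0 ∧ HasDerivAt g (deriv f z)⁻¹ (f z) := by
  have han : ∀ z ∈ U, AnalyticAt ℂ f z := fun z hz => hf.analyticAt (hU.mem_nhds hz)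
  have hd : ∀ z ∈ U, deriv f z ≠ 0 := fun z hz =>
    deriv_ne_zero_of_injOn (han z hz) (hU.mem_nhds hz) hinj
  have hmap : ∀ z ∈ U, Filter.map f (𝓝 z) = 𝓝 (f z) := fun z hz =>
    (han z hz).hasStrictDerivAt.map_nhds_eq (hd z hz)
  have hleft : ∀ z ∈ U, Function.invFunOn f U (f z) = z := fun z hz => hinj.leftInvOn_invFunOn hz
  refine ⟨Function.invFunOn f U, ?_, hleft, fun z hz => ⟨hd z hz, ?_⟩⟩
  · rw [isOpen_iff_mem_nhds]
    rintro _ ⟨z, hz, rfl⟩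
    rw [← hmap z hz]
    exact Filter.image_mem_map (hU.mem_nhds hz)
  · have hev : ∀ᶠ w in 𝓝 (f z), f (Function.invFunOn f U w) = w := by
      rw [← hmap z hz, Filter.eventually_map]
      filter_upwards [hU.mem_nhds hz] with w hw
      rw [hleft w hw]
    refine HasDerivAt.of_local_left_inverse ?_ ?_ (hd z hz) hev
    · rw [ContinuousAt, hleft z hz, ← hmap z hz, Filter.tendsto_map'_iff]
      refine tendsto_id.congr' ?_
      filter_upwards [hU.mem_nhds hz] with w hw
      exact (hleft w hw).symm
    · rw [hleft z hz]
      exact (han z hz).differentiableAt.hasDerivAt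

/-- A square root on a disc of an injective function `u` with `u w = 1` whose image contains the
disc of radius `1/2` about `1`, normalized by `s w = 1`, stays away from `-1`, because its image
does not meet the opposite of its image. -/
theorem exists_sqrt_away_from_neg_one {u : ℂ → ℂ} {w : ℂ} {R : ℝ} (hR : 0 < R)
    (hu : DifferentiableOn ℂ u (Metric.ball w R)) (hinj : Set.InjOn u (Metric.ball w R))
    (h0 : ∀ z ∈ Metric.ball w R, u z ≠ 0) (h1 : u w = 1)
    (himg : Metric.ball 1 (1 / 2) ⊆ u '' Metric.ball w R) :
    ∃ s : ℂ → ℂ, DifferentiableOn ℂ s (Metric.ball w R) ∧ s w = 1 ∧ (∀ z, s z ^ 2 = u z) ∧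
      ∀ z ∈ Metric.ball w R, 1 / 5 ≤ ‖s z + 1‖ := by
  have hw : w ∈ Metric.ball w R := Metric.mem_ball_self hR
  have hsc : IsSimplyConnected (Metric.ball w R) := by
    have := Metric.contractibleSpace_ball (x := w) hR
    exact (inferInstance : SimplyConnectedSpace (Metric.ball w R))
  obtain ⟨s, hsc, hs2, hs1⟩ : ∃ s : ℂ → ℂ, ContinuousOn s (Metric.ball w R) ∧
      (∀ z, s z ^ 2 = u z) ∧ s w = 1 := by
    obtain ⟨s, hs, hs2⟩ := Complex.exists_continuousOn_pow_eq hsc Metric.isOpen_ball hu.continuousOn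
      (by rintro ⟨z, hz, hz0⟩; exact h0 z hz hz0) two_ne_zero
    have h := hs2 w
    rw [h1] at h
    rcases sq_eq_one_iff.1 h with h | h
    · exact ⟨s, hs, hs2, h⟩
    · exact ⟨fun z => - s z, hs.neg, fun z => by rw [neg_sq, hs2], by simp [h]⟩
  have hs0 : ∀ z ∈ Metric.ball w R, s z ≠ 0 := fun z hz hz0 => h0 z hz (by rw [← hs2, hz0]; simp)
  refine ⟨s, fun z hz => ?_, hs1, hs2, fun z hz => ?_⟩
  · have h2 : HasDerivAt (fun x : ℂ => x ^ 2) (2 * s z) (s z) := by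
      simpa using hasDerivAt_pow 2 (s z)
    have h3 := HasDerivAt.of_comp_left (hsc.continuousAt (Metric.isOpen_ball.mem_nhds hz)) h2
      (hu.differentiableAt (Metric.isOpen_ball.mem_nhds hz)).hasDerivAt
      (mul_ne_zero two_ne_zero (hs0 z hz)) (Filter.Eventually.of_forall hs2)
    exact h3.differentiableAt.differentiableWithinAt
  · by_contra hlt
    rw [not_le] at hlt
    obtain ⟨g, -, hg, hg'⟩ := exists_holomorphic_inverse Metric.isOpen_ball hu hinj
    have hgm : ∀ q ∈ Metric.ball (1 : ℂ) (1 / 2), g q ∈ Metric.ball w R ∧ u (g q) = q := by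
      intro q hq
      obtain ⟨x, hx, rfl⟩ := himg hq
      rw [hg x hx]
      exact ⟨hx, rfl⟩
    have hgc : ContinuousOn g (Metric.ball (1 : ℂ) (1 / 2)) := by
      intro q hq
      obtain ⟨x, hx, rfl⟩ := himg hq
      exact (hg' x hx).2.continuousAt.continuousWithinAt
    have hrc : ContinuousOn (fun q => (s (g q)).re) (Metric.ball (1 : ℂ) (1 / 2)) :=
      Complex.continuous_re.comp_continuousOn
        (hsc.comp hgc fun q hq => (hgm q hq).1)
    -- the square root over the small disc has no purely imaginary value, as the disc lies in the
    -- right half-plane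
    have hne : ∀ q ∈ Metric.ball (1 : ℂ) (1 / 2), (s (g q)).re ≠ 0 := by
      intro q hq h
      have h4 := hs2 (g q)
      rw [(hgm q hq).2] at h4
      have h5 : q.re = (s (g q)).re ^ 2 - (s (g q)).im ^ 2 := by
        conv_lhs => rw [← h4, pow_two, Complex.mul_re]
        ring
      have h6 : |(q - 1).re| < 1 / 2 :=
        (Complex.abs_re_le_norm _).trans_lt (by simpa [dist_eq_norm] using hq)
      rw [h] at h5
      simp only [Complex.sub_re, Complex.one_re, abs_lt] at h6
      nlinarith [sq_nonneg (s (g q)).im]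
    have hmem1 : (1 : ℂ) ∈ Metric.ball (1 : ℂ) (1 / 2) := Metric.mem_ball_self (by norm_num)
    have hmemz : u z ∈ Metric.ball (1 : ℂ) (1 / 2) := by
      rw [mem_ball_iff_norm, ← hs2 z, show s z ^ 2 - 1 = (s z + 1) * ((s z + 1) - 2) by ring,
        norm_mul]
      have : ‖s z + 1 - 2‖ ≤ ‖s z + 1‖ + ‖(2 : ℂ)‖ := norm_sub_le _ _
      rw [Complex.norm_two] at this
      nlinarith [norm_nonneg (s z + 1), norm_nonneg (s z + 1 - 2)]
    have hpos1 : 0 < (s (g 1)).re := by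
      rw [← h1, hg w hw, hs1]; simp
    have hneg : (s (g (u z))).re < 0 := by
      rw [hg z hz]
      have := (Complex.abs_re_le_norm _).trans_lt hlt
      simp only [Complex.add_re, Complex.one_re, abs_lt] at this
      linarith
    obtain ⟨q, hq, hq0⟩ := (convex_ball (1 : ℂ) (1 / 2)).isPreconnected.intermediate_value
      hmemz hmem1 hrc ⟨hneg.le, hpos1.le⟩
    exact hne q hq hq0

/-- A quantitative form of the Koebe distortion theorem: near the centre of the disc, an injective
holomorphic function moves less than a fixed multiple of the distance to any omitted value. -/
theorem norm_sub_le_of_injOn_of_omitted {f : ℂ → ℂ} {w v : ℂ} {R : ℝ} (hR : 0 < R)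
    (hf : DifferentiableOn ℂ f (Metric.ball w R)) (hinj : Set.InjOn f (Metric.ball w R))
    (hv : v ∉ f '' Metric.ball w R) {z : ℂ} (hz : ‖z - w‖ ≤ R / 32) :
    ‖f z - f w‖ ≤ 20 * ‖v - f w‖ ∧ ‖f z - f w‖ ≤ 20 * R * ‖deriv f w‖ := by
  have hw : w ∈ Metric.ball w R := Metric.mem_ball_self hR
  obtain ⟨g, hopen, hg, hg'⟩ := exists_holomorphic_inverse Metric.isOpen_ball hf hinj
  set d := Metric.infDist (f w) (f '' Metric.ball w R)ᶜ with hd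
  have hne : (f '' Metric.ball w R)ᶜ.Nonempty := ⟨v, hv⟩
  have hdpos : 0 < d := (hopen.isClosed_compl.notMem_iff_infDist_pos hne).1
    (fun h => h ⟨w, hw, rfl⟩)
  have hdball : Metric.ball (f w) d ⊆ f '' Metric.ball w R := by
    have := Metric.disjoint_ball_infDist (x := f w) (s := (f '' Metric.ball w R)ᶜ)
    simpa [Set.disjoint_compl_right_iff_subset] using this
  obtain ⟨a, ha, had⟩ := (Metric.infDist_lt_iff hne (x := f w) (r := 2 * d)).1 (by linarith)
  have hane : ∀ x ∈ Metric.ball w R, a - f x ≠ 0 :=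
    fun x hx h => ha ⟨x, hx, (sub_eq_zero.1 h).symm⟩
  have haw := hane w hw
  rw [dist_comm, dist_eq_norm] at had
  have hdv : d ≤ ‖v - f w‖ := by
    rw [← dist_eq_norm, dist_comm]
    exact Metric.infDist_le_dist_of_mem hv
  have hdR : d ≤ R * ‖deriv f w‖ := by
    have h := Complex.norm_deriv_le_div_of_mapsTo_ball (f := g) (c := f w) (R₁ := d) (R₂ := R)
      (fun q hq => by
        obtain ⟨x, hx, rfl⟩ := hdball hq
        exact (hg' x hx).2.differentiableAt.differentiableWithinAt)
      (fun q hq => by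
        obtain ⟨x, hx, rfl⟩ := hdball hq
        rw [hg x hx, hg w hw]
        exact Metric.ball_subset_closedBall hx) hdpos
    rw [(hg' w hw).2.deriv, norm_inv, le_div_iff₀ hdpos, inv_mul_le_iff₀
      (norm_pos_iff.2 (hg' w hw).1)] at h
    linarith
  -- take a value `a` omitted by `f` that almost realizes the distance `d` to the complement of the
  -- image, and a square root of `(a - f) / (a - f w)`
  suffices h : ‖f z - f w‖ ≤ 20 * d from ⟨by linarith, by nlinarith⟩
  obtain ⟨s, hsd, hs1, hs2, hs5⟩ := exists_sqrt_away_from_neg_one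
    (u := fun x => (a - f x) / (a - f w)) hR ((hf.const_sub a).div_const _)
    (fun x hx y hy hxy => hinj hx hy (by
      simpa [div_left_inj' haw] using hxy)) (fun x hx => div_ne_zero (hane x hx) haw)
    (div_self haw) (fun q hq => by
      have : a - q * (a - f w) ∈ Metric.ball (f w) d := by
        rw [mem_ball_iff_norm, show a - q * (a - f w) - f w = -((q - 1) * (a - f w)) by ring,
          norm_neg, norm_mul]
        have h1 : ‖q - 1‖ < 1 / 2 := mem_ball_iff_norm.1 hq
        nlinarith [norm_nonneg (q - 1), norm_pos_iff.2 haw]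
      obtain ⟨x, hx, hxq⟩ := hdball this
      refine ⟨x, hx, ?_⟩
      simp only
      rw [hxq]
      field_simp
      ring)
  have hs1ne : ∀ x ∈ Metric.ball w R, s x + 1 ≠ 0 := fun x hx =>
    norm_pos_iff.1 (lt_of_lt_of_le (by norm_num) (hs5 x hx))
  -- the Möbius image `t` of the square root is bounded and vanishes at the centre
  set t : ℂ → ℂ := fun x => 1 - 2 / (s x + 1) with ht
  have htd : DifferentiableOn ℂ t (Metric.ball w R) :=
    ((differentiableOn_const (2 : ℂ)).div (hsd.add_const 1) hs1ne).const_sub 1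
  have htw : t w = 0 := by simp only [ht, hs1]; norm_num
  have hzb : z ∈ Metric.ball w R := by
    rw [mem_ball_iff_norm]; linarith
  have hschwarz := Complex.dist_le_div_mul_dist_of_mapsTo_ball (R₂ := 11) htd (fun x hx => by
    rw [htw, mem_closedBall_zero_iff]
    calc ‖t x‖ ≤ ‖(1 : ℂ)‖ + ‖2 / (s x + 1)‖ := norm_sub_le _ _
      _ ≤ 1 + 2 / (1 / 5) := by
        rw [norm_one, norm_div, Complex.norm_two]
        gcongr
        exact hs5 x hx
      _ = 11 := by norm_num) hzb
  rw [htw, dist_zero_right, dist_eq_norm] at hschwarz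
  have htz : ‖t z‖ ≤ 11 / 32 := by
    refine hschwarz.trans ?_
    rw [div_mul_eq_mul_div, div_le_iff₀ hR]
    linarith
  have h1t : (1 - t z) * (s z + 1) = 2 := by
    simp only [ht]
    field_simp [hs1ne z hzb]
    ring
  have h1tn : 21 / 32 ≤ ‖1 - t z‖ := by
    have := norm_sub_norm_le (1 : ℂ) (t z)
    rw [norm_one] at this
    linarith
  have hsn : ‖s z + 1‖ ≤ 64 / 21 := by
    have h := congrArg norm h1t
    rw [norm_mul, Complex.norm_two] at h
    nlinarith [norm_nonneg (s z + 1)]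
  have hsm : ‖s z - 1‖ ≤ 22 / 21 := by
    have : s z - 1 = t z * (s z + 1) := by linear_combination h1t
    rw [this, norm_mul]
    calc ‖t z‖ * ‖s z + 1‖ ≤ 11 / 32 * (64 / 21) := by gcongr
      _ = 22 / 21 := by norm_num
  have hfz : f z - f w = -((s z - 1) * (s z + 1) * (a - f w)) := by
    have h := hs2 z
    rw [eq_div_iff haw] at h
    linear_combination h
  rw [hfz, norm_neg, norm_mul, norm_mul]
  calc ‖s z - 1‖ * ‖s z + 1‖ * ‖a - f w‖ ≤ 22 / 21 * (64 / 21) * (2 * d) := by gcongr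
    _ ≤ 20 * d := by linarith

/-- Cauchy's estimate turns the distortion bound for `f` into one for its derivative. -/
theorem norm_deriv_le_of_injOn_of_omitted {f : ℂ → ℂ} {w v : ℂ} {R : ℝ} (hR : 0 < R)
    (hf : DifferentiableOn ℂ f (Metric.ball w R)) (hinj : Set.InjOn f (Metric.ball w R))
    (hv : v ∉ f '' Metric.ball w R) {z : ℂ} (hz : ‖z - w‖ ≤ R / 64) :
    ‖deriv f z‖ ≤ 1280 * ‖deriv f w‖ := by
  have hsub : Metric.closedBall z (R / 64) ⊆ Metric.ball w R := fun x hx => by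
    rw [mem_closedBall_iff_norm] at hx
    rw [mem_ball_iff_norm]
    have := norm_sub_le_norm_sub_add_norm_sub x z w
    linarith
  have hd : DiffContOnCl ℂ (fun x => f x - f w) (Metric.ball z (R / 64)) := by
    have h1 : DifferentiableOn ℂ (fun x => f x - f w) (Metric.closedBall z (R / 64)) :=
      (hf.mono hsub).sub_const _
    rw [← closure_ball z (by positivity)] at h1
    exact h1.diffContOnCl
  have h := Complex.norm_deriv_le_of_forall_mem_sphere_norm_le (C := 20 * R * ‖deriv f w‖)
    (by positivity) hd (fun x hx => by
      rw [mem_sphere_iff_norm] at hx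
      have := norm_sub_le_norm_sub_add_norm_sub x z w
      exact (norm_sub_le_of_injOn_of_omitted hR hf hinj hv (by linarith)).2)
  rw [deriv_sub_const] at h
  refine h.trans (le_of_eq ?_)
  field_simp
  ring

/-- The spherical derivative `|f'| / (1 + |f|²)` of an injective holomorphic function omitting `v`
is comparable at any two points near the centre of the disc, with a constant depending on `v`
alone. -/
theorem exists_sphericalDeriv_comparison (v : ℂ) : ∃ K : ℝ, 0 < K ∧ ∀ (f : ℂ → ℂ) (w : ℂ) (R : ℝ),
    0 < R → DifferentiableOn ℂ f (Metric.ball w R) → Set.InjOn f (Metric.ball w R) →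
    v ∉ f '' Metric.ball w R → ∀ z ∈ Metric.ball w (R / 256), ∀ z' ∈ Metric.ball w (R / 256),
    ‖deriv f z‖ / (1 + ‖f z‖ ^ 2) ≤ K * (‖deriv f z'‖ / (1 + ‖f z'‖ ^ 2)) := by
  -- `1 + |f|²` changes by a bounded factor as `|f z' - f z| ≤ 20 |v - f z|`
  refine ⟨1280 * (2 * 41 ^ 2 * (1 + ‖v‖ ^ 2)), by positivity, ?_⟩
  intro f w R hR hf hinj hv z hz z' hz'
  rw [mem_ball_iff_norm] at hz hz'
  have hzz : ‖z - z'‖ ≤ R / 2 / 64 := by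
    have := norm_sub_le_norm_sub_add_norm_sub z w z'
    rw [norm_sub_rev w z'] at this
    linarith
  have main : ∀ x y : ℂ, ‖x - w‖ < R / 256 → ‖y - x‖ ≤ R / 2 / 64 →
      ‖f y - f x‖ ≤ 20 * ‖v - f x‖ ∧ ‖deriv f y‖ ≤ 1280 * ‖deriv f x‖ := by
    intro x y hx hxy
    have hsub : Metric.ball x (R / 2) ⊆ Metric.ball w R := fun q hq => by
      rw [mem_ball_iff_norm] at hq ⊢
      have := norm_sub_le_norm_sub_add_norm_sub q x w
      linarith
    have hv' : v ∉ f '' Metric.ball x (R / 2) := fun h => hv (Set.image_mono hsub h)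
    have hR2 : 0 < R / 2 := by positivity
    exact ⟨(norm_sub_le_of_injOn_of_omitted hR2 (hf.mono hsub) (hinj.mono hsub) hv'
      (by linarith)).1, norm_deriv_le_of_injOn_of_omitted hR2 (hf.mono hsub) (hinj.mono hsub) hv'
      hxy⟩
  have h1 := (main z' z hz' hzz).2
  have h2 := (main z z' hz (by rwa [norm_sub_rev])).1
  have h3 : ‖f z'‖ ≤ 41 * (‖v‖ + ‖f z‖) := by
    have e1 := norm_sub_le_norm_sub_add_norm_sub (f z') (f z) 0
    have e2 := norm_sub_le v (f z)
    simp only [sub_zero] at e1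
    linarith [norm_nonneg v, norm_nonneg (f z)]
  have h4 : 1 + ‖f z'‖ ^ 2 ≤ 2 * 41 ^ 2 * (1 + ‖v‖ ^ 2) * (1 + ‖f z‖ ^ 2) := by
    have e1 : ‖f z'‖ ^ 2 ≤ (41 * (‖v‖ + ‖f z‖)) ^ 2 := by gcongr
    nlinarith [sq_nonneg (‖v‖ - ‖f z‖), mul_nonneg (sq_nonneg ‖v‖) (sq_nonneg ‖f z‖)]
  rw [mul_div_assoc', div_le_div_iff₀ (by positivity) (by positivity)]
  calc ‖deriv f z‖ * (1 + ‖f z'‖ ^ 2)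
      ≤ (1280 * ‖deriv f z'‖) * (2 * 41 ^ 2 * (1 + ‖v‖ ^ 2) * (1 + ‖f z‖ ^ 2)) := by gcongr
    _ = _ := by ring

/-! ### Local structure of the Newton map -/

theorem newtonMap_infty (p : Polynomial ℂ) : newtonMap p OnePoint.infty = OnePoint.infty := rfl

theorem newtonMap_coe_of_pole {p : Polynomial ℂ} {z : ℂ}
    (h : p.derivative.eval z = 0 ∧ p.eval z ≠ 0) : newtonMap p z = OnePoint.infty := by
  change (if _ then _ else _) = _
  rw [if_pos h]

theorem newtonMap_coe_of_not_pole {p : Polynomial ℂ} {z : ℂ}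
    (h : ¬ (p.derivative.eval z = 0 ∧ p.eval z ≠ 0)) :
    newtonMap p z = ((z - p.eval z / p.derivative.eval z : ℂ) : OnePoint ℂ) := by
  change (if _ then _ else _) = _
  rw [if_neg h]

theorem newtonMap_coe_eq_infty_iff {p : Polynomial ℂ} {z : ℂ} :
    newtonMap p z = OnePoint.infty ↔ p.derivative.eval z = 0 ∧ p.eval z ≠ 0 := by
  constructor
  · intro h
    by_contra h2
    rw [newtonMap_coe_of_not_pole h2] at h
    exact OnePoint.coe_ne_infty _ h
  · exact newtonMap_coe_of_pole

/-- The equation `N(z) = w` cleared of denominators. It also holds at multiple roots of `p`, where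
both `p` and `p'` vanish. -/
theorem derivative_eval_mul_of_newtonMap_eq {p : Polynomial ℂ} {z w : ℂ}
    (h : newtonMap p z = w) :
    p.derivative.eval z * w = z * p.derivative.eval z - p.eval z := by
  have hn : ¬ (p.derivative.eval z = 0 ∧ p.eval z ≠ 0) := fun h2 => by
    rw [newtonMap_coe_of_pole h2] at h
    exact OnePoint.infty_ne_coe _ h
  rw [newtonMap_coe_of_not_pole hn, OnePoint.coe_eq_coe] at h
  rw [← h]
  by_cases h0 : p.derivative.eval z = 0
  · have : p.eval z = 0 := by
      by_contra h1
      exact hn ⟨h0, h1⟩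
    simp [h0, this]
  · field_simp

theorem toPlane_coe (z : ℂ) : toPlane (z : OnePoint ℂ) = z := rfl

theorem coe_toPlane {x : OnePoint ℂ} (h : x ≠ OnePoint.infty) : (toPlane x : OnePoint ℂ) = x := by
  obtain ⟨z, rfl⟩ := OnePoint.ne_infty_iff_exists.1 h
  rfl

theorem coe_inPlane {f : OnePoint ℂ → OnePoint ℂ} {z : ℂ} (h : f z ≠ OnePoint.infty) :
    (inPlane f z : OnePoint ℂ) = f z := coe_toPlane h

theorem newtonMap_root {p : Polynomial ℂ} {v : ℂ} (h : p.eval v = 0) : newtonMap p v = v := by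
  rw [newtonMap_coe_of_not_pole (fun h2 => h2.2 h)]
  simp [h]

theorem eval_eq_zero_of_newtonMap_eq_self {p : Polynomial ℂ} {v : ℂ} (h : newtonMap p v = v) :
    p.eval v = 0 := by
  have := derivative_eval_mul_of_newtonMap_eq h
  linear_combination this

/-- Near a root of `p` of multiplicity `m`, the Newton map is analytic with multiplier `1 - 1/m`. -/
theorem exists_local_form_at_root {p : Polynomial ℂ} (hp : p ≠ 0) {v : ℂ} (hv : p.eval v = 0) :
    ∃ (g : ℂ → ℂ) (m : ℕ), 1 ≤ m ∧ AnalyticAt ℂ g v ∧ g v = v ∧ HasDerivAt g (1 - 1 / m) v ∧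
      ∀ᶠ z : ℂ in 𝓝 v, newtonMap p z = g z := by
  obtain ⟨q, hq, hndvd⟩ := p.exists_eq_pow_rootMultiplicity_mul_and_not_dvd hp v
  set m := p.rootMultiplicity v with hm
  have hm1 : 1 ≤ m := (Polynomial.rootMultiplicity_pos hp).2 hv
  have hqv : q.eval v ≠ 0 := fun h => hndvd (Polynomial.dvd_iff_isRoot.2 h)
  have hmC : (m : ℂ) ≠ 0 := by exact_mod_cast (by omega : m ≠ 0)
  set r : ℂ → ℂ := fun z => m * q.eval z + (z - v) * q.derivative.eval z with hr
  have hrv : r v ≠ 0 := by simp [hr, hqv, hmC]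
  have hra : AnalyticAt ℂ r v := by
    refine AnalyticAt.add (analyticAt_const.mul ?_) ((analyticAt_id.sub analyticAt_const).mul ?_)
    · exact AnalyticAt.aeval_polynomial analyticAt_id q
    · exact AnalyticAt.aeval_polynomial analyticAt_id _
  have hqa : AnalyticAt ℂ (fun z => q.eval z) v := AnalyticAt.aeval_polynomial analyticAt_id q
  have hquot : AnalyticAt ℂ (fun z => q.eval z / r z) v := hqa.div hra hrv
  have hpz : ∀ z, p.eval z = (z - v) ^ m * q.eval z := fun z => by
    conv_lhs => rw [hq]
    simp
  have hdz : ∀ z, p.derivative.eval z = (z - v) ^ (m - 1) * r z := fun z => by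
    conv_lhs => rw [hq]
    obtain ⟨l, hl⟩ : ∃ l, m = l + 1 := ⟨m - 1, by omega⟩
    rw [hl] at hr ⊢
    simp [Polynomial.derivative_mul, Polynomial.derivative_pow, hr]
    ring
  refine ⟨fun z => z - (z - v) * (q.eval z / r z), m, hm1,
    analyticAt_id.sub ((analyticAt_id.sub analyticAt_const).mul hquot), by simp, ?_, ?_⟩
  · have h1 := (hasDerivAt_id v).sub
      (((hasDerivAt_id v).sub_const v).mul hquot.differentiableAt.hasDerivAt)
    have h2 : q.eval v / r v = 1 / m := by
      simp only [hr]
      field_simp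
      simp
    have : (1 : ℂ) - 1 / m = 1 - (1 * (q.eval v / r v) +
        (id v - v) * deriv (fun z => q.eval z / r z) v) := by
      rw [h2]; simp
    rw [this]
    exact h1
  · filter_upwards [hra.continuousAt.eventually_ne hrv] with z hz
    rcases eq_or_ne z v with rfl | hzv
    · rw [newtonMap_root hv]; simp
    · have hz' : z - v ≠ 0 := sub_ne_zero.2 hzv
      have hd : p.derivative.eval z ≠ 0 := by
        rw [hdz]
        exact mul_ne_zero (pow_ne_zero _ hz') hz
      rw [newtonMap_coe_of_not_pole (fun h => hd h.1), OnePoint.coe_eq_coe, hpz, hdz]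
      have : (z - v) ^ m = (z - v) ^ (m - 1) * (z - v) := by
        rw [← pow_succ]; congr 1; omega
      rw [this]
      field_simp

theorem analyticAt_eval (q : Polynomial ℂ) (z : ℂ) : AnalyticAt ℂ (fun w => q.eval w) z :=
  AnalyticAt.aeval_polynomial analyticAt_id q

/-- Away from its poles the Newton map is holomorphic, also at the multiple roots of `p`. -/
theorem exists_local_form {p : Polynomial ℂ} (hp : p ≠ 0) {z : ℂ}
    (hz : newtonMap p z ≠ OnePoint.infty) :
    ∃ g : ℂ → ℂ, AnalyticAt ℂ g z ∧ ∀ᶠ w : ℂ in 𝓝 z, newtonMap p w = g w := by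
  by_cases h0 : p.eval z = 0
  · obtain ⟨g, -, -, hg, -, -, h⟩ := exists_local_form_at_root hp h0
    exact ⟨g, hg, h⟩
  · have hd : p.derivative.eval z ≠ 0 := fun h => hz (newtonMap_coe_of_pole ⟨h, h0⟩)
    refine ⟨fun w => w - p.eval w / p.derivative.eval w,
      analyticAt_id.sub ((analyticAt_eval p z).div (analyticAt_eval _ z) hd), ?_⟩
    filter_upwards [(analyticAt_eval p.derivative z).continuousAt.eventually_ne hd] with w hw
    exact newtonMap_coe_of_not_pole fun h => hw h.1

theorem analyticAt_inPlane_newtonMap {p : Polynomial ℂ} (hp : p ≠ 0) {z : ℂ}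
    (hz : newtonMap p z ≠ OnePoint.infty) : AnalyticAt ℂ (inPlane (newtonMap p)) z := by
  obtain ⟨g, hg, h⟩ := exists_local_form hp hz
  refine hg.congr ?_
  filter_upwards [h] with w hw
  rw [inPlane, hw]
  rfl

theorem eventually_norm_sub_le_of_hasDerivAt {g : ℂ → ℂ} {v a : ℂ} (h : HasDerivAt g a v) {ρ : ℝ}
    (hρ : ‖a‖ < ρ) : ∀ᶠ z in 𝓝 v, ‖g z - g v‖ ≤ ρ * ‖z - v‖ := by
  filter_upwards [h.isLittleO.def (sub_pos.2 hρ)] with z hz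
  have h1 := norm_sub_norm_le (g z - g v) ((z - v) • a)
  rw [norm_smul] at h1
  linarith

theorem eventually_le_norm_sub_of_hasDerivAt {g : ℂ → ℂ} {v a : ℂ} (h : HasDerivAt g a v) {ρ : ℝ}
    (hρ : ρ < ‖a‖) : ∀ᶠ z in 𝓝 v, ρ * ‖z - v‖ ≤ ‖g z - g v‖ := by
  filter_upwards [h.isLittleO.def (sub_pos.2 hρ)] with z hz
  have h1 := norm_sub_norm_le ((z - v) • a) (g z - g v)
  rw [norm_smul, norm_sub_rev ((z - v) • a)] at h1
  linarith

theorem norm_one_sub_inv_lt_one {m : ℕ} (hm : 1 ≤ m) : ‖(1 - 1 / m : ℂ)‖ < 1 := by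
  have : (1 - 1 / m : ℂ) = ((1 - 1 / m : ℝ) : ℂ) := by push_cast; rfl
  rw [this, Complex.norm_real, Real.norm_eq_abs, abs_lt]
  have h1 : (0 : ℝ) < 1 / m := by positivity
  have h2 : (1 : ℝ) / m ≤ 1 := by
    rw [div_le_one (by positivity)]
    exact_mod_cast hm
  constructor <;> linarith

/-- All finite fixed points of a Newton map are attracting. -/
theorem eventually_tendsto_of_root {p : Polynomial ℂ} (hp : p ≠ 0) {v : ℂ} (hv : p.eval v = 0) :
    ∀ᶠ x in 𝓝 (v : OnePoint ℂ),
      Tendsto (fun m : ℕ => (newtonMap p)^[m] x) atTop (𝓝 (v : OnePoint ℂ)) := by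
  obtain ⟨g, m, hm, hg, hgv, hgd, hN⟩ := exists_local_form_at_root hp hv
  have hmult : ‖(1 - 1 / m : ℂ)‖ < 1 := norm_one_sub_inv_lt_one hm
  obtain ⟨ρ, hρ1, hρ2⟩ := exists_between hmult
  have hρ0 : 0 < ρ := (norm_nonneg _).trans_lt hρ1
  have hcontr := eventually_norm_sub_le_of_hasDerivAt hgd hρ1
  obtain ⟨ε, hε, hball⟩ := Metric.eventually_nhds_iff.1 (hcontr.and hN)
  rw [OnePoint.nhds_coe_eq, Filter.eventually_map]
  filter_upwards [Metric.ball_mem_nhds v hε] with z hz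
  have key : ∀ m : ℕ, ∃ w : ℂ, (newtonMap p)^[m] z = w ∧ ‖w - v‖ ≤ ρ ^ m * ‖z - v‖ := by
    intro m
    induction m with
    | zero => exact ⟨z, rfl, by simp⟩
    | succ m ih =>
      obtain ⟨w, hw, hwn⟩ := ih
      have hwε : dist w v < ε := by
        rw [dist_eq_norm]
        refine lt_of_le_of_lt (hwn.trans ?_) (mem_ball_iff_norm.1 hz)
        exact mul_le_of_le_one_left (norm_nonneg _) (pow_le_one₀ hρ0.le hρ2.le)
      obtain ⟨h1, h2⟩ := hball hwε
      rw [hgv] at h1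
      refine ⟨g w, by rw [Function.iterate_succ_apply', hw, h2], h1.trans ?_⟩
      rw [pow_succ, mul_comm (ρ ^ m) ρ, mul_assoc]
      gcongr
  choose w hw hwn using key
  have : Tendsto w atTop (𝓝 v) := by
    rw [tendsto_iff_norm_sub_tendsto_zero]
    refine squeeze_zero (fun _ => norm_nonneg _) hwn ?_
    simpa using (tendsto_pow_atTop_nhds_zero_of_lt_one hρ0.le hρ2).mul_const ‖z - v‖
  simp only [hw]
  exact tendsto_map.comp this

/-! ### The Newton map near infinity -/

/-- The inverse function theorem: a holomorphic function is locally injective off its critical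
points. -/
theorem exists_injOn_nhds {f : ℂ → ℂ} {z : ℂ} (hf : AnalyticAt ℂ f z) (hd : deriv f z ≠ 0) :
    ∃ U ∈ 𝓝 z, Set.InjOn f U := by
  have h := hf.hasStrictDerivAt.hasStrictFDerivAt_equiv hd
  exact ⟨_, (h.toOpenPartialHomeomorph f).open_source.mem_nhds
    h.mem_toOpenPartialHomeomorph_source,
    (h.toOpenPartialHomeomorph f).injOn⟩

theorem reverse_eval_mul_pow (q : Polynomial ℂ) {w : ℂ} (hw : w ≠ 0) :
    q.reverse.eval w * (w⁻¹) ^ q.natDegree = q.eval w⁻¹ := by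
  have := invertibleOfNonzero (inv_ne_zero hw)
  have h := Polynomial.eval₂_reverse_mul_pow (RingHom.id ℂ) w⁻¹ q
  simpa [Polynomial.eval₂_id] using h

/-- In the coordinate `w = 1 / z`, the Newton map of a polynomial of degree `d ≥ 2` has the
repelling fixed point `0` of multiplier `d / (d - 1)`. -/
theorem exists_local_form_at_infty {p : Polynomial ℂ} (hp : 2 ≤ p.natDegree) :
    ∃ (M : ℂ → ℂ) (a : ℂ), AnalyticAt ℂ M 0 ∧ M 0 = 0 ∧ HasDerivAt M a 0 ∧ 1 < ‖a‖ ∧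
      ∀ᶠ w in 𝓝 (0 : ℂ), w ≠ 0 → M w ≠ 0 ∧ newtonMap p (w⁻¹ : ℂ) = ((M w)⁻¹ : ℂ) := by
  obtain ⟨d, hd⟩ : ∃ d, p.natDegree = d + 2 := ⟨p.natDegree - 2, by omega⟩
  set P := p.reverse
  set Q := p.derivative.reverse
  have hp0 : p ≠ 0 := by rintro rfl; simp at hp
  have hlc : p.leadingCoeff ≠ 0 := Polynomial.leadingCoeff_ne_zero.2 hp0
  have hP0 : P.eval 0 = p.leadingCoeff := by
    rw [← Polynomial.coeff_zero_eq_eval_zero, Polynomial.coeff_zero_reverse]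
  have hQ0 : Q.eval 0 = p.leadingCoeff * (d + 2) := by
    rw [← Polynomial.coeff_zero_eq_eval_zero, Polynomial.coeff_zero_reverse,
      Polynomial.leadingCoeff_derivative, hd]
    push_cast; ring
  have hd1 : (d : ℂ) + 1 ≠ 0 := by exact_mod_cast Nat.succ_ne_zero d
  have hd2 : (d : ℂ) + 2 ≠ 0 := by exact_mod_cast (by omega : d + 2 ≠ 0)
  have hden0 : Q.eval 0 - P.eval 0 ≠ 0 := by
    rw [hP0, hQ0, show p.leadingCoeff * ((d : ℂ) + 2) - p.leadingCoeff = p.leadingCoeff * (d + 1) by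
      ring]
    exact mul_ne_zero hlc hd1
  have hQ0' : Q.eval 0 ≠ 0 := by
    rw [hQ0]; exact mul_ne_zero hlc hd2
  have hquot : AnalyticAt ℂ (fun w => Q.eval w / (Q.eval w - P.eval w)) 0 :=
    (analyticAt_eval Q 0).div ((analyticAt_eval Q 0).sub (analyticAt_eval P 0)) hden0
  have hratio : Q.eval 0 / (Q.eval 0 - P.eval 0) = (d + 2) / (d + 1) := by
    rw [div_eq_div_iff hden0 hd1, hP0, hQ0]; ring
  refine ⟨fun w => w * (Q.eval w / (Q.eval w - P.eval w)), (d + 2) / (d + 1),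
    analyticAt_id.mul hquot, by simp, ?_, ?_, ?_⟩
  · have h := (hasDerivAt_id (0 : ℂ)).mul hquot.differentiableAt.hasDerivAt
    simp only [hratio, one_mul, id, zero_mul, add_zero] at h
    exact h
  · have : ((d : ℂ) + 2) / (d + 1) = ((((d : ℝ) + 2) / (d + 1) : ℝ) : ℂ) := by push_cast; rfl
    rw [this, Complex.norm_real, Real.norm_of_nonneg (by positivity), one_lt_div (by positivity)]
    linarith
  · filter_upwards
      [((analyticAt_eval Q 0).sub (analyticAt_eval P 0)).continuousAt.eventually_ne hden0,
      (analyticAt_eval Q 0).continuousAt.eventually_ne hQ0'] with w hw1 hw2 hw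
    have hw1' : Q.eval w - P.eval w ≠ 0 := hw1
    refine ⟨mul_ne_zero hw (div_ne_zero hw2 hw1'), ?_⟩
    have hQw := reverse_eval_mul_pow p.derivative hw
    have hPw := reverse_eval_mul_pow p hw
    rw [Polynomial.natDegree_derivative, hd] at hQw
    rw [hd] at hPw
    have hne : p.derivative.eval w⁻¹ ≠ 0 := by
      rw [← hQw]
      exact mul_ne_zero hw2 (pow_ne_zero _ (inv_ne_zero hw))
    rw [newtonMap_coe_of_not_pole fun h => hne h.1, OnePoint.coe_eq_coe, ← hQw, ← hPw]
    have e1 : d + 2 - 1 = d + 1 := rfl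
    rw [e1]
    change w⁻¹ - P.eval w * w⁻¹ ^ (d + 2) / (Q.eval w * w⁻¹ ^ (d + 1)) =
      (w * (Q.eval w / (Q.eval w - P.eval w)))⁻¹
    rw [pow_succ w⁻¹ (d + 1)]
    field_simp

/-- Outside a large disc, the Newton map is finite, injective, and decreases the modulus by a
definite factor. -/
theorem exists_expansion_at_infty {p : Polynomial ℂ} (hp : 2 ≤ p.natDegree) :
    ∃ R ρ : ℝ, 1 ≤ R ∧ 0 < ρ ∧ ρ < 1 ∧
      (∀ z : ℂ, R < ‖z‖ → ∃ w : ℂ, newtonMap p z = w ∧ ‖w‖ ≤ ρ * ‖z‖) ∧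
      (∀ z z' : ℂ, R < ‖z‖ → R < ‖z'‖ → newtonMap p z = newtonMap p z' → z = z') ∧
      Tendsto (fun z : ℂ => newtonMap p z) (cocompact ℂ) (𝓝 OnePoint.infty) := by
  obtain ⟨M, a, hM, hM0, hMa, ha, hN⟩ := exists_local_form_at_infty hp
  obtain ⟨ρ, hρ1, hρ2⟩ := exists_between ha
  have hρ0 : 0 < ρ := one_pos.trans hρ1
  obtain ⟨U, hU, hinj⟩ := exists_injOn_nhds hM (by
    rw [hMa.deriv]; exact norm_pos_iff.1 (one_pos.trans ha))
  obtain ⟨ε, hε, hball⟩ := Metric.eventually_nhds_iff.1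
    (((eventually_le_norm_sub_of_hasDerivAt hMa hρ2).and hN).and hU)
  simp only [dist_zero_right, hM0, sub_zero] at hball
  have hinv : ∀ z : ℂ, max 1 ε⁻¹ < ‖z‖ → z ≠ 0 ∧ ‖z⁻¹‖ < ε := by
    intro z hz
    have h1 : 0 < ‖z‖ := one_pos.trans_le ((le_max_left _ _).trans hz.le)
    refine ⟨norm_pos_iff.1 h1, ?_⟩
    rw [norm_inv, inv_lt_comm₀ h1 hε]
    exact (le_max_right _ _).trans_lt hz
  have hform : ∀ z : ℂ, max 1 ε⁻¹ < ‖z‖ → M z⁻¹ ≠ 0 ∧ newtonMap p z = ((M z⁻¹)⁻¹ : ℂ) := by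
    intro z hz
    obtain ⟨h0, h1⟩ := hinv z hz
    have h2 := (hball h1).1.2 (inv_ne_zero h0)
    rwa [inv_inv] at h2
  refine ⟨max 1 ε⁻¹, ρ⁻¹, le_max_left _ _, inv_pos.2 hρ0, inv_lt_one_of_one_lt₀ hρ1, ?_, ?_, ?_⟩
  · intro z hz
    obtain ⟨h0, h1⟩ := hinv z hz
    obtain ⟨h2, h3⟩ := hform z hz
    refine ⟨_, h3, ?_⟩
    have h4 := (hball h1).1.1
    rw [norm_inv] at h4 ⊢
    rw [inv_le_comm₀ (norm_pos_iff.2 h2) (by have := norm_pos_iff.2 h0; positivity), mul_inv,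
      inv_inv]
    exact h4
  · intro z z' hz hz' heq
    obtain ⟨h0, h1⟩ := hinv z hz
    obtain ⟨h0', h1'⟩ := hinv z' hz'
    rw [(hform z hz).2, (hform z' hz').2, OnePoint.coe_eq_coe, inv_inj] at heq
    exact inv_injective (hinj (hball h1).2 (hball h1').2 heq)
  · have hlarge : ∀ᶠ z : ℂ in cocompact ℂ, max 1 ε⁻¹ < ‖z‖ :=
      (tendsto_norm_cocompact_atTop (E := ℂ)).eventually_gt_atTop _
    have h1 : Tendsto (fun z : ℂ => M z⁻¹) (cocompact ℂ) (𝓝[≠] 0) := by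
      refine tendsto_nhdsWithin_iff.2 ⟨?_, ?_⟩
      · have : Tendsto (fun z : ℂ => z⁻¹) (cocompact ℂ) (𝓝 0) := by
          rw [← Metric.cobounded_eq_cocompact]
          exact tendsto_inv₀_cobounded
        have h := hM.continuousAt.tendsto
        rw [hM0] at h
        exact h.comp this
      · filter_upwards [hlarge] with z hz
        exact (hform z hz).1
    have h2 : Tendsto (fun z : ℂ => (M z⁻¹)⁻¹) (cocompact ℂ) (coclosedCompact ℂ) := by
      rw [coclosedCompact_eq_cocompact, ← Metric.cobounded_eq_cocompact]
      exact tendsto_inv₀_nhdsNE_zero.comp (by rwa [← Metric.cobounded_eq_cocompact] at h1)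
    refine (OnePoint.tendsto_coe_infty.comp h2).congr' ?_
    filter_upwards [hlarge] with z hz
    exact (hform z hz).2.symm

theorem tendsto_nhds_infty_iff_norm {α : Type*} {f : α → OnePoint ℂ} {l : Filter α} :
    Tendsto f l (𝓝 OnePoint.infty) ↔ ∀ R : ℝ, ∀ᶠ x in l, ∀ u : ℂ, f x = u → R < ‖u‖ := by
  rw [OnePoint.hasBasis_nhds_infty.tendsto_right_iff]
  constructor
  · intro h R
    filter_upwards
      [h _ ⟨Metric.isClosed_closedBall (x := (0 : ℂ)) (ε := R), isCompact_closedBall _ _⟩]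
      with x hx u hu
    rw [hu] at hx
    rcases hx with ⟨y, hy, hyu⟩ | hx
    · rw [OnePoint.coe_eq_coe] at hyu
      subst hyu
      simpa using hy
    · exact absurd hx (OnePoint.coe_ne_infty u)
  · rintro h s ⟨-, hs⟩
    obtain ⟨R, hR⟩ := hs.isBounded.subset_closedBall 0
    filter_upwards [h R] with x hx
    by_cases hi : f x = OnePoint.infty
    · exact Or.inr hi
    · refine Or.inl ⟨toPlane (f x), fun hmem => ?_, coe_toPlane hi⟩
      have := hx _ (coe_toPlane hi).symm
      have h2 := hR hmem
      rw [mem_closedBall_zero_iff] at h2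
      linarith

theorem continuous_newtonMap {p : Polynomial ℂ} (hp : 2 ≤ p.natDegree) :
    Continuous (newtonMap p) := by
  have hp0 : p ≠ 0 := by rintro rfl; simp at hp
  rw [continuous_iff_continuousAt]
  intro x
  induction x using OnePoint.rec with
  | infty =>
    rw [OnePoint.continuousAt_infty', coclosedCompact_eq_cocompact]
    obtain ⟨-, -, -, -, -, -, -, h⟩ := exists_expansion_at_infty hp
    exact h
  | coe z =>
    rw [OnePoint.continuousAt_coe]
    by_cases hz : newtonMap p z = OnePoint.infty
    · rw [ContinuousAt, Function.comp_apply, hz, tendsto_nhds_infty_iff_norm]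
      intro R
      obtain ⟨hd, he⟩ := newtonMap_coe_eq_infty_iff.1 hz
      have hc : ContinuousAt (fun w : ℂ => ‖p.eval w‖ - ‖p.derivative.eval w‖ * (‖w‖ + R)) z := by
        fun_prop
      have hpos : 0 < ‖p.eval z‖ - ‖p.derivative.eval z‖ * (‖z‖ + R) := by
        rw [hd]; simpa using he
      filter_upwards [hc.eventually_const_lt hpos] with w hw u hu
      have h1 := derivative_eval_mul_of_newtonMap_eq hu
      have h2 : p.eval w = p.derivative.eval w * (w - u) := by linear_combination h1
      have h3 : ‖w - u‖ ≤ ‖w‖ + ‖u‖ := norm_sub_le _ _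
      rw [h2, norm_mul] at hw
      by_contra hle
      rw [not_lt] at hle
      nlinarith [norm_nonneg (p.derivative.eval w)]
    · obtain ⟨g, hg, h⟩ := exists_local_form hp0 hz
      have : ContinuousAt (fun w : ℂ => (g w : OnePoint ℂ)) z :=
        OnePoint.continuous_coe.continuousAt.comp hg.continuousAt
      exact this.congr (by filter_upwards [h] with w hw using hw.symm)

/-- A Newton map has finitely many critical points in the plane that are not poles. -/
theorem finite_setOf_deriv_eq_zero {p : Polynomial ℂ} (hp : 2 ≤ p.natDegree) :
    {z : ℂ | newtonMap p z ≠ OnePoint.infty ∧ deriv (inPlane (newtonMap p)) z = 0}.Finite := by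
  have hp0 : p ≠ 0 := by rintro rfl; simp at hp
  have hp2 : p.derivative.derivative ≠ 0 := by
    rw [Polynomial.derivative_ne_zero, Polynomial.natDegree_derivative]
    omega
  refine ((p * p.derivative.derivative).rootSet_finite ℂ).subset ?_
  rintro z ⟨hz, hdz⟩
  rw [Polynomial.mem_rootSet]
  refine ⟨mul_ne_zero hp0 hp2, ?_⟩
  rw [Polynomial.coe_aeval_eq_eval, Polynomial.eval_mul]
  by_cases h0 : p.eval z = 0
  · rw [h0, zero_mul]
  · have hd : p.derivative.eval z ≠ 0 := fun h => hz (newtonMap_coe_of_pole ⟨h, h0⟩)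
    have h1 := (hasDerivAt_id z).sub ((p.hasDerivAt z).div (p.derivative.hasDerivAt z) hd)
    have h2 : inPlane (newtonMap p) =ᶠ[𝓝 z] fun w => w - p.eval w / p.derivative.eval w := by
      filter_upwards [(analyticAt_eval p.derivative z).continuousAt.eventually_ne hd] with w hw
      rw [inPlane, newtonMap_coe_of_not_pole fun h => hw h.1]
      rfl
    have h3 : HasDerivAt (inPlane (newtonMap p)) _ z := h1.congr_of_eventuallyEq h2
    rw [h3.deriv] at hdz
    field_simp at hdz
    linear_combination hdz

/-! ### Iterates in the affine coordinate -/

theorem iterate_newtonMap_infty (p : Polynomial ℂ) (m : ℕ) :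
    (newtonMap p)^[m] OnePoint.infty = OnePoint.infty :=
  Function.iterate_fixed (newtonMap_infty p) m

theorem iterate_ne_infty_of_le {p : Polynomial ℂ} {x : OnePoint ℂ} {i m : ℕ} (him : i ≤ m)
    (h : (newtonMap p)^[m] x ≠ OnePoint.infty) : (newtonMap p)^[i] x ≠ OnePoint.infty := by
  intro hi
  obtain ⟨l, rfl⟩ := Nat.exists_eq_add_of_le him
  rw [add_comm, Function.iterate_add_apply, hi, iterate_newtonMap_infty] at h
  exact h rfl

theorem eventually_iterate_ne_infty {p : Polynomial ℂ} (hp : 2 ≤ p.natDegree) {m : ℕ} {z : ℂ}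
    (h : (newtonMap p)^[m] z ≠ OnePoint.infty) :
    ∀ᶠ w : ℂ in 𝓝 z, (newtonMap p)^[m] w ≠ OnePoint.infty :=
  (((continuous_newtonMap hp).iterate m).comp OnePoint.continuous_coe).continuousAt.eventually_ne h

theorem inPlane_iterate_succ {p : Polynomial ℂ} {m : ℕ} {z : ℂ}
    (h : (newtonMap p)^[m] z ≠ OnePoint.infty) :
    inPlane (newtonMap p)^[m + 1] z = inPlane (newtonMap p) (inPlane (newtonMap p)^[m] z) := by
  rw [inPlane, inPlane, coe_inPlane h, Function.iterate_succ_apply']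

theorem inPlane_iterate_succ' {p : Polynomial ℂ} {m : ℕ} {z : ℂ}
    (h : newtonMap p z ≠ OnePoint.infty) :
    inPlane (newtonMap p)^[m + 1] z = inPlane (newtonMap p)^[m] (inPlane (newtonMap p) z) := by
  rw [inPlane, inPlane, coe_inPlane h, Function.iterate_succ_apply]

theorem analyticAt_inPlane_iterate {p : Polynomial ℂ} (hp : 2 ≤ p.natDegree) {m : ℕ} {z : ℂ}
    (h : (newtonMap p)^[m] z ≠ OnePoint.infty) :
    AnalyticAt ℂ (inPlane (newtonMap p)^[m]) z := by
  have hp0 : p ≠ 0 := by rintro rfl; simp at hp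
  induction m with
  | zero => exact analyticAt_id
  | succ m ih =>
    have hm := iterate_ne_infty_of_le (Nat.le_succ m) h
    have h1 : AnalyticAt ℂ (inPlane (newtonMap p)) (inPlane (newtonMap p)^[m] z) := by
      apply analyticAt_inPlane_newtonMap hp0
      rwa [coe_inPlane hm, ← Function.iterate_succ_apply' (newtonMap p)]
    refine (h1.comp (ih hm)).congr ?_
    filter_upwards [eventually_iterate_ne_infty hp hm] with w hw
    exact (inPlane_iterate_succ hw).symm

theorem deriv_inPlane_iterate_succ {p : Polynomial ℂ} (hp : 2 ≤ p.natDegree) {m : ℕ} {z : ℂ}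
    (h : (newtonMap p)^[m + 1] z ≠ OnePoint.infty) :
    deriv (inPlane (newtonMap p)^[m + 1]) z =
      deriv (inPlane (newtonMap p)) (inPlane (newtonMap p)^[m] z) *
        deriv (inPlane (newtonMap p)^[m]) z := by
  have hp0 : p ≠ 0 := by rintro rfl; simp at hp
  have hm := iterate_ne_infty_of_le (Nat.le_succ m) h
  have h1 : AnalyticAt ℂ (inPlane (newtonMap p)) (inPlane (newtonMap p)^[m] z) := by
    apply analyticAt_inPlane_newtonMap hp0
    rwa [coe_inPlane hm, ← Function.iterate_succ_apply' (newtonMap p)]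
  have h2 : inPlane (newtonMap p)^[m + 1] =ᶠ[𝓝 z]
      inPlane (newtonMap p) ∘ inPlane (newtonMap p)^[m] := by
    filter_upwards [eventually_iterate_ne_infty hp hm] with w hw
    exact inPlane_iterate_succ hw
  rw [h2.deriv_eq]
  exact deriv_comp z h1.differentiableAt (analyticAt_inPlane_iterate hp hm).differentiableAt

theorem deriv_inPlane_iterate_ne_zero {p : Polynomial ℂ} (hp : 2 ≤ p.natDegree) {m : ℕ} {z : ℂ}
    (h : (newtonMap p)^[m] z ≠ OnePoint.infty)
    (hd : ∀ i < m, deriv (inPlane (newtonMap p)) (inPlane (newtonMap p)^[i] z) ≠ 0) :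
    deriv (inPlane (newtonMap p)^[m]) z ≠ 0 := by
  induction m with
  | zero =>
    have : inPlane (newtonMap p)^[0] = id := rfl
    rw [this]; simp
  | succ m ih =>
    rw [deriv_inPlane_iterate_succ hp h]
    exact mul_ne_zero (hd m m.lt_succ_self)
      (ih (iterate_ne_infty_of_le (Nat.le_succ m) h) fun i hi => hd i (hi.trans m.lt_succ_self))

theorem continuousOn_inPlane {f : OnePoint ℂ → OnePoint ℂ} (hf : Continuous f) :
    ContinuousOn (inPlane f) {z : ℂ | f z ≠ OnePoint.infty} := by
  intro z hz
  apply ContinuousAt.continuousWithinAt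
  obtain ⟨w, hw⟩ := OnePoint.ne_infty_iff_exists.1 hz
  have h1 : Tendsto (fun x : ℂ => f x) (𝓝 z) (𝓝 (w : OnePoint ℂ)) := by
    rw [hw]
    exact (hf.comp OnePoint.continuous_coe).continuousAt
  have h2 : ContinuousAt toPlane (w : OnePoint ℂ) := by
    rw [OnePoint.continuousAt_coe]
    exact continuousAt_id
  have h3 := h2.tendsto.comp h1
  rw [ContinuousAt]
  have : inPlane f z = toPlane w := by rw [inPlane, hw]
  rw [this]
  exact h3

/-! ### Basins of attraction -/

/-- The set of points attracted to a root is already open, so that the interior in the definition of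
the basin is not needed. -/
theorem basin_eq {p : Polynomial ℂ} (hp : 2 ≤ p.natDegree) {v : ℂ} (hv : p.eval v = 0) :
    basin (newtonMap p) v =
      {x | Tendsto (fun m : ℕ => (newtonMap p)^[m] x) atTop (𝓝 (v : OnePoint ℂ))} := by
  have hp0 : p ≠ 0 := by rintro rfl; simp at hp
  refine interior_eq_iff_isOpen.2 ?_
  rw [isOpen_iff_mem_nhds]
  intro x hx
  obtain ⟨U, hU, hUo, hvU⟩ := eventually_nhds_iff.1 (eventually_tendsto_of_root hp0 hv)
  obtain ⟨m, hm⟩ := (hx.eventually (hUo.mem_nhds hvU)).exists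
  have hpre := (((continuous_newtonMap hp).iterate m).continuousAt (x := x)).preimage_mem_nhds
    (hUo.mem_nhds hm)
  filter_upwards [hpre] with y hy
  have h := hU _ hy
  simp only [← Function.iterate_add_apply] at h
  exact (tendsto_add_atTop_iff_nat m).1 h

theorem isOpen_basin (f : OnePoint ℂ → OnePoint ℂ) (v : OnePoint ℂ) : IsOpen (basin f v) :=
  isOpen_interior

theorem mem_basin_self {p : Polynomial ℂ} (hp : 2 ≤ p.natDegree) {v : ℂ} (hv : p.eval v = 0) :
    (v : OnePoint ℂ) ∈ basin (newtonMap p) v := by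
  rw [basin_eq hp hv]
  have : ∀ m : ℕ, (newtonMap p)^[m] (v : OnePoint ℂ) = v := fun m =>
    Function.iterate_fixed (newtonMap_root hv) m
  simp only [Set.mem_ofPred_eq, this]
  exact tendsto_const_nhds

theorem iterate_mem_basin_iff {p : Polynomial ℂ} (hp : 2 ≤ p.natDegree) {v : ℂ}
    (hv : p.eval v = 0) (m : ℕ) (x : OnePoint ℂ) :
    (newtonMap p)^[m] x ∈ basin (newtonMap p) v ↔ x ∈ basin (newtonMap p) v := by
  simp only [basin_eq hp hv, Set.mem_ofPred_eq, ← Function.iterate_add_apply]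
  exact tendsto_add_atTop_iff_nat (f := fun i => (newtonMap p)^[i] x) m

theorem newtonMap_mem_basin_iff {p : Polynomial ℂ} (hp : 2 ≤ p.natDegree) {v : ℂ}
    (hv : p.eval v = 0) (x : OnePoint ℂ) :
    newtonMap p x ∈ basin (newtonMap p) v ↔ x ∈ basin (newtonMap p) v :=
  iterate_mem_basin_iff hp hv 1 x

theorem infty_notMem_basin {p : Polynomial ℂ} (hp : 2 ≤ p.natDegree) {v : ℂ}
    (hv : p.eval v = 0) : OnePoint.infty ∉ basin (newtonMap p) v := by
  rw [basin_eq hp hv]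
  simp only [Set.mem_ofPred_eq, iterate_newtonMap_infty]
  intro h
  exact OnePoint.infty_ne_coe _ (tendsto_nhds_unique tendsto_const_nhds h)

theorem eq_of_mem_basin {p : Polynomial ℂ} (hp : 2 ≤ p.natDegree) {v v' : ℂ}
    (hv : p.eval v = 0) (hv' : p.eval v' = 0) {x : OnePoint ℂ} (h : x ∈ basin (newtonMap p) v)
    (h' : x ∈ basin (newtonMap p) v') : v = v' := by
  rw [basin_eq hp hv] at h
  rw [basin_eq hp hv'] at h'
  exact OnePoint.coe_injective (tendsto_nhds_unique h h')

theorem immediateBasin_subset (f : OnePoint ℂ → OnePoint ℂ) (v : OnePoint ℂ) :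
    immediateBasin f v ⊆ basin f v :=
  connectedComponentIn_subset _ _

theorem mem_immediateBasin_self {p : Polynomial ℂ} (hp : 2 ≤ p.natDegree) {v : ℂ}
    (hv : p.eval v = 0) : (v : OnePoint ℂ) ∈ immediateBasin (newtonMap p) v :=
  mem_connectedComponentIn (mem_basin_self hp hv)

theorem newtonMap_mem_immediateBasin {p : Polynomial ℂ} (hp : 2 ≤ p.natDegree) {v : ℂ}
    (hv : p.eval v = 0) {x : OnePoint ℂ} (hx : x ∈ immediateBasin (newtonMap p) v) :
    newtonMap p x ∈ immediateBasin (newtonMap p) v := by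
  have h1 : IsPreconnected (newtonMap p '' immediateBasin (newtonMap p) v) :=
    isPreconnected_connectedComponentIn.image _ (continuous_newtonMap hp).continuousOn
  refine h1.subset_connectedComponentIn ⟨v, mem_immediateBasin_self hp hv, newtonMap_root hv⟩ ?_
    ⟨x, hx, rfl⟩
  rintro _ ⟨y, hy, rfl⟩
  exact (newtonMap_mem_basin_iff hp hv y).2 (immediateBasin_subset _ _ hy)

/-- An immediate basin is relatively closed in its basin. -/
theorem mem_immediateBasin_of_mem_closure {p : Polynomial ℂ} (hp : 2 ≤ p.natDegree) {v : ℂ}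
    (hv : p.eval v = 0) {x : OnePoint ℂ} (hx : x ∈ closure (immediateBasin (newtonMap p) v))
    (hxb : x ∈ basin (newtonMap p) v) : x ∈ immediateBasin (newtonMap p) v := by
  have h1 : IsPreconnected (insert x (immediateBasin (newtonMap p) v)) :=
    isPreconnected_connectedComponentIn.subset_closure (Set.subset_insert _ _)
      (Set.insert_subset hx subset_closure)
  exact h1.subset_connectedComponentIn (Set.mem_insert_of_mem _ (mem_immediateBasin_self hp hv))
    (Set.insert_subset hxb (immediateBasin_subset _ _)) (Set.mem_insert _ _)

/-- The closure of an immediate basin meets no other basin, because basins are open and disjoint. -/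
theorem eq_of_mem_closure_of_mem_basin {p : Polynomial ℂ} (hp : 2 ≤ p.natDegree) {v v' : ℂ}
    (hv : p.eval v = 0) (hv' : p.eval v' = 0) {x : OnePoint ℂ}
    (hx : x ∈ closure (immediateBasin (newtonMap p) v)) (hxb : x ∈ basin (newtonMap p) v') :
    v = v' := by
  obtain ⟨y, hy, hyA⟩ := mem_closure_iff.1 hx _ (isOpen_basin _ _) hxb
  exact eq_of_mem_basin hp hv hv' (immediateBasin_subset _ _ hyA) hy

/-- Openness in the sphere follows from openness in the plane, as `∞` is in no basin. In the
applications the planar set is the source of a Riemann map. -/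
theorem isOpen_immediateBasin {p : Polynomial ℂ} (hp : 2 ≤ p.natDegree) {v : ℂ}
    (hv : p.eval v = 0)
    (h : IsOpen {z : ℂ | (z : OnePoint ℂ) ∈ immediateBasin (newtonMap p) v}) :
    IsOpen (immediateBasin (newtonMap p) v) :=
  (OnePoint.isOpen_iff_of_notMem fun hi =>
    infty_notMem_basin hp hv (immediateBasin_subset _ _ hi)).2 h

theorem ne_infty_of_mem_immediateBasin {p : Polynomial ℂ} (hp : 2 ≤ p.natDegree) {v : ℂ}
    (hv : p.eval v = 0) {x : OnePoint ℂ} (hx : x ∈ immediateBasin (newtonMap p) v) :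
    x ≠ OnePoint.infty := fun h => infty_notMem_basin hp hv (immediateBasin_subset _ _ (h ▸ hx))

/-- No finite point of the boundary of an immediate basin is fixed. -/
theorem newtonMap_ne_self_of_mem_closure {p : Polynomial ℂ} (hp : 2 ≤ p.natDegree) {v : ℂ}
    (hv : p.eval v = 0) {x : ℂ} (hx : (x : OnePoint ℂ) ∈ closure (immediateBasin (newtonMap p) v))
    (hxA : (x : OnePoint ℂ) ∉ immediateBasin (newtonMap p) v) : newtonMap p x ≠ x := by
  intro h
  have hroot := eval_eq_zero_of_newtonMap_eq_self h
  obtain rfl := eq_of_mem_closure_of_mem_basin hp hv hroot hx (mem_basin_self hp hroot)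
  exact hxA (mem_immediateBasin_self hp hv)

/-- The inverse image of a null set under a holomorphic map is null away from the critical
points. -/
theorem volume_inter_preimage_eq_zero {f : ℂ → ℂ} {Z E : Set ℂ} (hE : volume E = 0)
    (hZ : ∀ z ∈ Z, AnalyticAt ℂ f z ∧ deriv f z ≠ 0) : volume (Z ∩ f ⁻¹' E) = 0 := by
  refine measure_null_of_locally_null _ fun z hz => ?_
  obtain ⟨ha, hd⟩ := hZ z hz.1
  have hst := ha.hasStrictDerivAt.hasStrictFDerivAt_equiv hd
  obtain ⟨U, hU, hinj⟩ := exists_injOn_nhds ha hd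
  obtain ⟨r, hr, hball⟩ := Metric.mem_nhds_iff.1 (Filter.inter_mem hU ha.eventually_analyticAt)
  have hdiff : DifferentiableOn ℂ f (Metric.ball z r) := fun w hw =>
    (hball hw).2.differentiableAt.differentiableWithinAt
  obtain ⟨g, -, hg, hg'⟩ := exists_holomorphic_inverse Metric.isOpen_ball hdiff
    (hinj.mono fun w hw => (hball hw).1)
  refine ⟨Metric.ball z r ∩ (Z ∩ f ⁻¹' E), inter_mem
    (mem_nhdsWithin_of_mem_nhds (Metric.ball_mem_nhds z hr)) self_mem_nhdsWithin, ?_⟩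
  have hnull : volume (g '' (E ∩ f '' Metric.ball z r)) = 0 := by
    apply addHaar_image_eq_zero_of_differentiableOn_of_addHaar_eq_zero
    · rintro _ ⟨-, w, hw, rfl⟩
      exact ((hg' w hw).2.differentiableAt.restrictScalars ℝ).differentiableWithinAt
    · exact measure_mono_null Set.inter_subset_left hE
  refine measure_mono_null ?_ hnull
  rintro w ⟨hw, -, hwE⟩
  exact ⟨f w, ⟨hwE, w, hw, rfl⟩, hg w hw⟩

/-- The inverse image of a null set under an iterate of a Newton map is null. -/
theorem volume_iterate_preimage_eq_zero {p : Polynomial ℂ} (hp : 2 ≤ p.natDegree) {E : Set ℂ}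
    (hE : volume E = 0) (m : ℕ) :
    volume {z : ℂ | ∃ w ∈ E, (newtonMap p)^[m] z = w} = 0 := by
  have hp0 : p ≠ 0 := by rintro rfl; simp at hp
  induction m with
  | zero =>
    refine measure_mono_null ?_ hE
    rintro z ⟨w, hw, h⟩
    rw [Function.iterate_zero_apply, OnePoint.coe_eq_coe] at h
    rwa [h]
  | succ m ih =>
    have hcrit := (finite_setOf_deriv_eq_zero hp).measure_zero volume
    have h1 := volume_inter_preimage_eq_zero (f := inPlane (newtonMap p)) ih
      (Z := {z : ℂ | newtonMap p z ≠ OnePoint.infty ∧ deriv (inPlane (newtonMap p)) z ≠ 0})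
      fun z hz => ⟨analyticAt_inPlane_newtonMap hp0 hz.1, hz.2⟩
    refine measure_mono_null ?_ (measure_union_null hcrit h1)
    rintro z ⟨w, hw, h⟩
    have hz : newtonMap p z ≠ OnePoint.infty :=
      iterate_ne_infty_of_le (p := p) (x := z) (i := 1) (m := m + 1) (by omega) (by
        rw [h]; exact OnePoint.coe_ne_infty w)
    by_cases hd : deriv (inPlane (newtonMap p)) z = 0
    · exact Or.inl ⟨hz, hd⟩
    · refine Or.inr ⟨⟨hz, hd⟩, w, hw, ?_⟩
      rw [coe_inPlane hz, ← Function.iterate_succ_apply, h]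

/-! ### Area of preimages of small discs -/

/-- The spherical disc neighbourhoods used for the area estimates: the Euclidean disc of radius `s`
about a finite point, and the exterior of the closed disc of radius `1 / s` for `∞`. -/
def nearSet (r : OnePoint ℂ) (s : ℝ) : Set (OnePoint ℂ) :=
  {x | (∀ u : ℂ, r = OnePoint.infty → x = u → s⁻¹ < ‖u‖) ∧
    ∀ v : ℂ, r = v → ∃ u : ℂ, x = u ∧ ‖u - v‖ < s}

theorem mem_nearSet_infty {x : OnePoint ℂ} {s : ℝ} :
    x ∈ nearSet OnePoint.infty s ↔ ∀ u : ℂ, x = u → s⁻¹ < ‖u‖ := by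
  simp [nearSet]

theorem mem_nearSet_coe {x : OnePoint ℂ} {v : ℂ} {s : ℝ} :
    x ∈ nearSet v s ↔ ∃ u : ℂ, x = u ∧ ‖u - v‖ < s := by
  simp [nearSet]

/-- A function of a small parameter `s` that is bounded by a positive power of `s`. -/
def PowerDecay (f : ℝ → ENNReal) : Prop :=
  ∃ C a : ℝ, 0 < C ∧ 0 < a ∧ ∀ s : ℝ, 0 < s → s < 1 → f s ≤ ENNReal.ofReal (C * s ^ a)

theorem PowerDecay.mono {f g : ℝ → ENNReal} (hg : PowerDecay g)
    (h : ∀ s : ℝ, 0 < s → s < 1 → f s ≤ g s) : PowerDecay f := by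
  obtain ⟨C, a, hC, ha, hs⟩ := hg
  exact ⟨C, a, hC, ha, fun s h0 h1 => (h s h0 h1).trans (hs s h0 h1)⟩

theorem PowerDecay.add {f g : ℝ → ENNReal} (hf : PowerDecay f) (hg : PowerDecay g) :
    PowerDecay (fun s => f s + g s) := by
  obtain ⟨C, a, hC, ha, hf⟩ := hf
  obtain ⟨C', a', hC', ha', hg⟩ := hg
  refine ⟨C + C', min a a', by positivity, lt_min ha ha', fun s h0 h1 => ?_⟩
  refine (add_le_add (hf s h0 h1) (hg s h0 h1)).trans ?_
  rw [← ENNReal.ofReal_add (by positivity) (by positivity)]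
  apply ENNReal.ofReal_le_ofReal
  rw [add_mul]
  exact add_le_add
    (mul_le_mul_of_nonneg_left
      (Real.rpow_le_rpow_of_exponent_ge h0 h1.le (min_le_left _ _)) hC.le)
    (mul_le_mul_of_nonneg_left
      (Real.rpow_le_rpow_of_exponent_ge h0 h1.le (min_le_right _ _)) hC'.le)

theorem PowerDecay.zero : PowerDecay 0 := ⟨1, 1, one_pos, one_pos, fun s _ _ => by simp⟩

theorem PowerDecay.sum {ι : Type*} (F : Finset ι) {f : ι → ℝ → ENNReal}
    (h : ∀ i ∈ F, PowerDecay (f i)) : PowerDecay (fun s => ∑ i ∈ F, f i s) := by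
  classical
  induction F using Finset.induction_on with
  | empty => simpa only [Finset.sum_empty] using! PowerDecay.zero
  | insert i F hi ih =>
    simp only [Finset.sum_insert hi]
    exact (h i (Finset.mem_insert_self _ _)).add
      (ih fun j hj => h j (Finset.mem_insert_of_mem hj))

theorem PowerDecay.const_mul {f : ℝ → ENNReal} (hf : PowerDecay f) {K : ENNReal} (hK : K ≠ ⊤) :
    PowerDecay (fun s => K * f s) := by
  obtain ⟨C, a, hC, ha, hf⟩ := hf
  refine ⟨(K.toReal + 1) * C, a, by positivity, ha, fun s h0 h1 => ?_⟩
  rw [mul_assoc, ENNReal.ofReal_mul (by positivity)]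
  refine mul_le_mul' ?_ (hf s h0 h1)
  rw [ENNReal.le_ofReal_iff_toReal_le hK (by positivity)]
  linarith

/-- Power decay is stable under the substitution of `K * s ^ γ`. Where this exceeds `1`, nothing is
known of `f` but the bound `B`, which is then at most a multiple of `K * s ^ γ`. -/
theorem PowerDecay.comp_rpow {f : ℝ → ENNReal} (hf : PowerDecay f) {B : ENNReal} (hB : B ≠ ⊤)
    (hfB : ∀ s, f s ≤ B) {K γ : ℝ} (hK : 0 < K) (hγ : 0 < γ) :
    PowerDecay (fun s => f (K * s ^ γ)) := by
  obtain ⟨C, a, hC, ha, hf⟩ := hf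
  have hp : PowerDecay (fun s => ENNReal.ofReal (C * (K * s ^ γ) ^ a) +
      ENNReal.ofReal ((B.toReal + 1) * (K * s ^ γ))) := by
    refine PowerDecay.add ⟨C * K ^ a, γ * a, by positivity, by positivity, fun s h0 h1 => ?_⟩
      ⟨(B.toReal + 1) * K, γ, by positivity, hγ, fun s h0 h1 => by rw [mul_assoc]⟩
    have : (K * s ^ γ) ^ a = K ^ a * s ^ (γ * a) := by
      rw [Real.mul_rpow hK.le (by positivity), ← Real.rpow_mul h0.le]
    simp only [this, mul_assoc, le_refl]
  refine hp.mono fun s h0 h1 => ?_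
  by_cases h : K * s ^ γ < 1
  · exact (hf _ (by positivity) h).trans le_self_add
  · refine (hfB _).trans (le_trans ?_ le_add_self)
    rw [ENNReal.le_ofReal_iff_toReal_le hB (by rw [not_lt] at h; positivity)]
    rw [not_lt] at h
    nlinarith [ENNReal.toReal_nonneg (a := B)]

theorem pow_card_le_norm_prod {z : ℂ} {t : ℝ} (ht : 0 ≤ t) (m : Multiset ℂ)
    (h : ∀ r ∈ m, t ≤ ‖z - r‖) : t ^ Multiset.card m ≤ ‖(m.map fun r => z - r).prod‖ := by
  induction m using Multiset.induction_on with
  | empty => simp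
  | cons a m ih =>
    rw [Multiset.card_cons, Multiset.map_cons, Multiset.prod_cons, norm_mul, pow_succ']
    have h1 := h a (Multiset.mem_cons_self a m)
    have h2 := ih fun r hr => h r (Multiset.mem_cons_of_mem hr)
    gcongr

theorem exists_norm_eval_le (b : Polynomial ℂ) :
    ∃ K : ℝ, 0 < K ∧ ∀ z : ℂ, ‖b.eval z‖ ≤ K * (1 + ‖z‖) ^ b.natDegree := by
  refine ⟨(∑ i ∈ Finset.range (b.natDegree + 1), ‖b.coeff i‖) + 1, by positivity, fun z => ?_⟩
  rw [Polynomial.eval_eq_sum_range]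
  refine (norm_sum_le _ _).trans ?_
  rw [add_mul, Finset.sum_mul]
  refine le_trans ?_ (le_add_of_nonneg_right (by positivity))
  refine Finset.sum_le_sum fun i hi => ?_
  rw [norm_mul, norm_pow]
  have h1 : ‖z‖ ^ i ≤ (1 + ‖z‖) ^ i := by gcongr; linarith
  have h2 : (1 + ‖z‖) ^ i ≤ (1 + ‖z‖) ^ b.natDegree :=
    pow_le_pow_right₀ (by linarith [norm_nonneg z]) (by simpa [Nat.lt_succ_iff] using hi)
  gcongr
  exact h1.trans h2

/-- If `|a(z)| ≤ s |b(z)|` for polynomials `a` (nonconstant) and `b`, then `z` is close to a root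
of `a` or to `∞`, quantitatively in `s`. -/
theorem exists_near_root {a : Polynomial ℂ} (ha : 1 ≤ a.natDegree) (b : Polynomial ℂ) :
    ∃ C γ : ℝ, 0 < C ∧ 0 < γ ∧ ∀ s : ℝ, 0 < s → s < 1 → ∀ z : ℂ,
      ‖a.eval z‖ ≤ s * ‖b.eval z‖ →
        (C * s ^ γ)⁻¹ < ‖z‖ ∨ ∃ r ∈ a.roots.toFinset, ‖z - r‖ < C * s ^ γ := by
  obtain ⟨K, hK, hb⟩ := exists_norm_eval_le b
  have ha0 : a ≠ 0 := by rintro rfl; simp at ha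
  have hlc : 0 < ‖a.leadingCoeff‖ := norm_pos_iff.2 (Polynomial.leadingCoeff_ne_zero.2 ha0)
  set n := b.natDegree
  set d := a.natDegree with hd
  -- the exponent is chosen so that `|z| ≤ s^(-γ)` and `|z - r| ≥ s^γ` are compatible with
  -- `|a(z)| ≤ s |b(z)|` only up to constants, and `C` beats these constants
  set C : ℝ := 1 + K * 2 ^ n / ‖a.leadingCoeff‖ with hC
  have hC1 : 1 ≤ C := by rw [hC]; have : 0 ≤ K * 2 ^ n / ‖a.leadingCoeff‖ := by positivity
                         linarith
  set γ : ℝ := 1 / (n + d + 1) with hγ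
  have hγ0 : 0 < γ := by positivity
  have hγ1 : γ * d ≤ 1 - γ * n := by
    have : γ * (n + d + 1) = 1 := by rw [hγ]; field_simp
    nlinarith
  refine ⟨C, γ, by positivity, hγ0, fun s h0 h1 z hz => ?_⟩
  by_contra hcon
  push Not at hcon
  obtain ⟨hz1, hz2⟩ := hcon
  have hsγ : 0 < s ^ γ := by positivity
  have hsγ1 : s ^ γ ≤ 1 := Real.rpow_le_one h0.le h1.le hγ0.le
  have hz3 : 1 + ‖z‖ ≤ 2 * (s ^ γ)⁻¹ := by
    have e1 : (C * s ^ γ)⁻¹ ≤ (s ^ γ)⁻¹ := by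
      apply inv_anti₀ hsγ
      nlinarith
    have e2 : 1 ≤ (s ^ γ)⁻¹ := (one_le_inv₀ hsγ).2 hsγ1
    linarith
  have hbz : ‖b.eval z‖ ≤ K * 2 ^ n * ((s ^ γ)⁻¹) ^ n := by
    refine (hb z).trans ?_
    rw [mul_assoc, ← mul_pow]
    gcongr
  have hroots : Multiset.card a.roots = d :=
    (IsAlgClosed.splits a).natDegree_eq_card_roots.symm
  have haz : ‖a.leadingCoeff‖ * (C * s ^ γ) ^ d ≤ ‖a.eval z‖ := by
    rw [(IsAlgClosed.splits a).eval_eq_prod_roots, norm_mul, ← hroots]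
    gcongr
    exact pow_card_le_norm_prod (by positivity) _ fun r hr => hz2 r (Multiset.mem_toFinset.2 hr)
  have hmain : ‖a.leadingCoeff‖ * C * s ^ (γ * d) ≤ K * 2 ^ n * s ^ (1 - γ * n) := by
    calc ‖a.leadingCoeff‖ * C * s ^ (γ * d) ≤ ‖a.leadingCoeff‖ * C ^ d * s ^ (γ * d) := by
          gcongr
          exact le_self_pow₀ hC1 (by omega)
      _ = ‖a.leadingCoeff‖ * (C * s ^ γ) ^ d := by
          rw [mul_pow, ← Real.rpow_natCast (s ^ γ) d, ← Real.rpow_mul h0.le, mul_assoc]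
      _ ≤ s * (K * 2 ^ n * ((s ^ γ)⁻¹) ^ n) := haz.trans (hz.trans (by gcongr))
      _ = K * 2 ^ n * s ^ (1 - γ * n) := by
          rw [Real.rpow_sub h0, Real.rpow_one, inv_pow, ← Real.rpow_natCast (s ^ γ) n,
            ← Real.rpow_mul h0.le]
          field_simp
  have h5 : s ^ (1 - γ * n) ≤ s ^ (γ * d) := Real.rpow_le_rpow_of_exponent_ge h0 h1.le hγ1
  have h6 : ‖a.leadingCoeff‖ * C * s ^ (γ * d) ≤ K * 2 ^ n * s ^ (γ * d) :=
    hmain.trans (by gcongr)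
  have h7 : ‖a.leadingCoeff‖ * C ≤ K * 2 ^ n := le_of_mul_le_mul_right h6 (by positivity)
  have h8 : ‖a.leadingCoeff‖ * C = ‖a.leadingCoeff‖ + K * 2 ^ n := by
    rw [hC]; field_simp
  linarith

/-- The polynomial whose zeros are the solutions of `N(z) = r` is not constant: its leading
coefficient is `d - 1` times that of `p`. -/
theorem one_le_natDegree_fixed {p : Polynomial ℂ} (hp : 2 ≤ p.natDegree) (r : ℂ) :
    1 ≤ ((Polynomial.X - Polynomial.C r) * p.derivative - p).natDegree := by
  obtain ⟨d, hd⟩ : ∃ d, p.natDegree = d + 2 := ⟨p.natDegree - 2, by omega⟩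
  have hp0 : p ≠ 0 := by rintro rfl; simp at hp
  have h1 : p.coeff (d + 2) ≠ 0 := by
    rw [← hd]; exact Polynomial.leadingCoeff_ne_zero.2 hp0
  have h2 : p.coeff (d + 2 + 1) = 0 := Polynomial.coeff_eq_zero_of_natDegree_lt (by omega)
  refine le_trans (by omega : 1 ≤ d + 2) (Polynomial.le_natDegree_of_ne_zero ?_)
  rw [Polynomial.coeff_sub, sub_mul, Polynomial.coeff_sub, Polynomial.coeff_X_mul,
    Polynomial.coeff_C_mul, Polynomial.coeff_derivative, Polynomial.coeff_derivative, h2]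
  have h3 : (d : ℂ) + 1 ≠ 0 := by exact_mod_cast Nat.succ_ne_zero d
  have : p.coeff (d + 1 + 1) * (((d + 1 : ℕ) : ℂ) + 1) - r * (0 * (((d + 2 : ℕ) : ℂ) + 1)) -
      p.coeff (d + 2) = p.coeff (d + 2) * (d + 1) := by push_cast; ring
  rw [this]
  exact mul_ne_zero h1 h3

/-- A point whose image is close to `r` is close to a preimage of `r` or to `∞`, at a distance
bounded by a power of the distance of the image. -/
theorem exists_near_preimage {p : Polynomial ℂ} (hp : 2 ≤ p.natDegree) (r : OnePoint ℂ) :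
    ∃ (F : Finset (OnePoint ℂ)) (C γ : ℝ), 0 < C ∧ 0 < γ ∧ ∀ s : ℝ, 0 < s → s < 1 →
      ∀ x, newtonMap p x ∈ nearSet r s → ∃ r' ∈ F, x ∈ nearSet r' (C * s ^ γ) := by
  classical
  obtain ⟨a, b, ha, hab⟩ : ∃ a b : Polynomial ℂ, 1 ≤ a.natDegree ∧ ∀ s : ℝ, 0 < s → s < 1 →
      ∀ z : ℂ, newtonMap p z ∈ nearSet r s → ‖a.eval z‖ ≤ s * ‖b.eval z‖ := by
    induction r using OnePoint.rec with
    | infty =>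
      refine ⟨p.derivative, Polynomial.X * p.derivative - p, by
        rw [Polynomial.natDegree_derivative]; omega, fun s h0 h1 z hz => ?_⟩
      rw [mem_nearSet_infty] at hz
      by_cases hN : newtonMap p z = OnePoint.infty
      · rw [(newtonMap_coe_eq_infty_iff.1 hN).1, norm_zero]
        positivity
      · have h2 := hz _ (coe_toPlane hN).symm
        have h3 := derivative_eval_mul_of_newtonMap_eq (coe_toPlane hN).symm
        rw [Polynomial.eval_sub, Polynomial.eval_mul, Polynomial.eval_X, ← h3, norm_mul]
        rw [inv_lt_iff_one_lt_mul₀ h0] at h2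
        nlinarith [norm_nonneg (p.derivative.eval z)]
    | coe v =>
      refine ⟨(Polynomial.X - Polynomial.C v) * p.derivative - p, p.derivative,
        one_le_natDegree_fixed hp v, fun s h0 h1 z hz => ?_⟩
      obtain ⟨u, hu, huv⟩ := mem_nearSet_coe.1 hz
      have h3 := derivative_eval_mul_of_newtonMap_eq hu
      have h4 : ((Polynomial.X - Polynomial.C v) * p.derivative - p).eval z =
          (u - v) * p.derivative.eval z := by
        simp only [Polynomial.eval_sub, Polynomial.eval_mul, Polynomial.eval_X, Polynomial.eval_C]
        linear_combination -h3
      rw [h4, norm_mul]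
      gcongr
  obtain ⟨C, γ, hC, hγ, h⟩ := exists_near_root ha b
  refine ⟨insert OnePoint.infty (a.roots.toFinset.image fun z : ℂ => (z : OnePoint ℂ)), C, γ,
    hC, hγ, fun s h0 h1 x hx => ?_⟩
  induction x using OnePoint.rec with
  | infty =>
    exact ⟨OnePoint.infty, Finset.mem_insert_self _ _, mem_nearSet_infty.2 fun u hu =>
      absurd hu (OnePoint.infty_ne_coe u)⟩
  | coe z =>
    rcases h s h0 h1 z (hab s h0 h1 z hx) with h2 | ⟨r', hr', h2⟩
    · refine ⟨OnePoint.infty, Finset.mem_insert_self _ _, mem_nearSet_infty.2 fun u hu => ?_⟩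
      rwa [← OnePoint.coe_injective hu]
    · exact ⟨r', Finset.mem_insert_of_mem (Finset.mem_image_of_mem _ hr'),
        mem_nearSet_coe.2 ⟨z, rfl, h2⟩⟩

/-- The density `4 / (1 + |z|²)²` is split into the integrable factor `4 (1 + |z|²)^(-3/2)` and
`(1 + |z|²)^(-1/2)`, which is small near `∞`. -/
theorem sphericalArea_le_integral (E : Set ℂ) (hE : MeasurableSet E) {c : ℝ} (hc : 0 ≤ c)
    (h : ∀ z ∈ E, (1 + ‖z‖ ^ 2) ^ (-(1 / 2) : ℝ) ≤ c) :
    sphericalArea E ≤ ENNReal.ofReal c *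
      ∫⁻ z : ℂ, ENNReal.ofReal (4 * (1 + ‖z‖ ^ 2) ^ (-(3 : ℝ) / 2)) := by
  rw [sphericalArea, withDensity_apply _ hE, ← lintegral_const_mul' _ _ ENNReal.ofReal_ne_top]
  refine (setLIntegral_mono' hE (g := fun z => ENNReal.ofReal c *
    ENNReal.ofReal (4 * (1 + ‖z‖ ^ 2) ^ (-(3 : ℝ) / 2))) fun z hz => ?_).trans
    (setLIntegral_le_lintegral _ _)
  rw [← ENNReal.ofReal_mul hc]
  apply ENNReal.ofReal_le_ofReal
  have h0 : (0 : ℝ) < 1 + ‖z‖ ^ 2 := by positivity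
  have h1 : 4 / (1 + ‖z‖ ^ 2) ^ 2 =
      (1 + ‖z‖ ^ 2) ^ (-(1 / 2) : ℝ) * (4 * (1 + ‖z‖ ^ 2) ^ (-(3 : ℝ) / 2)) := by
    rw [mul_left_comm, ← Real.rpow_add h0]
    have : (-(1 / 2) : ℝ) + -(3 : ℝ) / 2 = -((2 : ℕ) : ℝ) := by norm_num
    rw [this, Real.rpow_neg h0.le, div_eq_mul_inv, Real.rpow_natCast]
  rw [h1]
  gcongr
  exact h z hz

theorem lintegral_three_halves_ne_top :
    ∫⁻ z : ℂ, ENNReal.ofReal (4 * (1 + ‖z‖ ^ 2) ^ (-(3 : ℝ) / 2)) ≠ ⊤ := by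
  have h : Integrable (fun z : ℂ => 4 * (1 + ‖z‖ ^ 2) ^ (-(3 : ℝ) / 2)) :=
    (integrable_rpow_neg_one_add_norm_sq (E := ℂ) (by simp; norm_num)).const_mul 4
  have := h.lintegral_lt_top
  exact this.ne

theorem sphericalArea_univ_ne_top : sphericalArea Set.univ ≠ ⊤ := by
  have h := sphericalArea_le_integral Set.univ MeasurableSet.univ zero_le_one fun z _ =>
    Real.rpow_le_one_of_one_le_of_nonpos (by have := sq_nonneg ‖z‖; linarith) (by norm_num)
  refine ne_top_of_le_ne_top ?_ h
  simpa using lintegral_three_halves_ne_top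

theorem sphericalArea_le_volume (E : Set ℂ) : sphericalArea E ≤ 4 * volume E := by
  rw [sphericalArea]
  refine (withDensity_mono (g := fun _ => 4) (Filter.Eventually.of_forall fun z => ?_) E).trans ?_
  · rw [← ENNReal.ofReal_ofNat]
    apply ENNReal.ofReal_le_ofReal
    rw [div_le_iff₀ (by positivity)]
    have : (1 : ℝ) ≤ (1 + ‖z‖ ^ 2) ^ 2 := one_le_pow₀ (by have := sq_nonneg ‖z‖; linarith)
    linarith
  · rw [withDensity_const]; rfl

/-- The spherical area of the preimage of a disc of radius `s` under an iterate of the Newton map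
is bounded by a power of `s`. -/
theorem powerDecay_iterate_preimage {p : Polynomial ℂ} (hp : 2 ≤ p.natDegree) (m : ℕ)
    (r : OnePoint ℂ) :
    PowerDecay (fun s => sphericalArea {z : ℂ | (newtonMap p)^[m] z ∈ nearSet r s}) := by
  induction m generalizing r with
  | zero =>
    induction r using OnePoint.rec with
    | infty =>
      refine PowerDecay.mono (g := fun s => (∫⁻ z : ℂ, ENNReal.ofReal
        (4 * (1 + ‖z‖ ^ 2) ^ (-(3 : ℝ) / 2))) * ENNReal.ofReal s) (PowerDecay.const_mul
        ⟨1, 1, one_pos, one_pos, fun s _ _ => by simp⟩ lintegral_three_halves_ne_top)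
        fun s h0 h1 => ?_
      rw [mul_comm]
      have hset : {z : ℂ | (newtonMap p)^[0] z ∈ nearSet OnePoint.infty s} =
          {z : ℂ | s⁻¹ < ‖z‖} := by
        ext z
        simp only [Set.mem_ofPred_eq, Function.iterate_zero_apply, mem_nearSet_infty]
        exact ⟨fun h => h z rfl, fun h u hu => OnePoint.coe_injective hu ▸ h⟩
      rw [hset]
      refine sphericalArea_le_integral _ (measurableSet_lt measurable_const measurable_norm) h0.le
        fun z hz => ?_
      have hz' : s⁻¹ < ‖z‖ := hz
      have h2 : 0 < s⁻¹ := inv_pos.2 h0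
      rw [show (-(1 / 2) : ℝ) = -(1 / 2 : ℝ) from rfl, Real.rpow_neg (by positivity),
        ← Real.sqrt_eq_rpow]
      apply inv_le_of_inv_le₀ h0
      apply Real.le_sqrt_of_sq_le
      nlinarith
    | coe v =>
      refine PowerDecay.mono (g := fun s => ENNReal.ofReal (4 * Real.pi * s ^ (2 : ℝ)))
        ⟨4 * Real.pi, 2, by positivity, two_pos, fun s _ _ => le_rfl⟩ fun s h0 h1 => ?_
      have hset : {z : ℂ | (newtonMap p)^[0] z ∈ nearSet v s} ⊆ Metric.ball v s := by
        intro z hz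
        obtain ⟨u, hu, huv⟩ := mem_nearSet_coe.1 hz
        rw [Function.iterate_zero_apply] at hu
        rw [OnePoint.coe_injective hu, mem_ball_iff_norm]
        exact huv
      refine (measure_mono hset).trans ((sphericalArea_le_volume _).trans ?_)
      rw [Complex.volume_ball, mul_assoc 4 Real.pi, ENNReal.ofReal_mul (by norm_num),
        ENNReal.ofReal_mul Real.pi_nonneg, ENNReal.ofReal_ofNat, mul_comm (ENNReal.ofReal s ^ 2)]
      norm_num
      rw [ENNReal.ofReal_pow h0.le]
      have : ENNReal.ofReal Real.pi = (NNReal.pi : ENNReal) := by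
        rw [ENNReal.ofReal, ← NNReal.coe_real_pi, Real.toNNReal_coe]
      rw [this]
  | succ m ih =>
    obtain ⟨F, C, γ, hC, hγ, h⟩ := exists_near_preimage hp r
    refine PowerDecay.mono (PowerDecay.sum F (f := fun r' s => sphericalArea
      {z : ℂ | (newtonMap p)^[m] z ∈ nearSet r' (C * s ^ γ)}) fun r' _ =>
      (ih r').comp_rpow sphericalArea_univ_ne_top (fun s => measure_mono (Set.subset_univ _)) hC hγ)
      fun s h0 h1 => ?_
    refine le_trans (measure_mono ?_) (measure_biUnion_finset_le F _)
    intro z hz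
    rw [Set.mem_ofPred_eq, Function.iterate_succ_apply'] at hz
    obtain ⟨r', hr', hr⟩ := h s h0 h1 _ hz
    exact Set.mem_biUnion hr' hr

/-! ### Inverse branches and bounded distortion -/

/-- Over a disc without critical values, all inverse branches of an iterate of the Newton map
exist, their images are disjoint, and they exhaust the preimage of the disc. -/
theorem exists_inverse_branches {p : Polynomial ℂ} (hp : 2 ≤ p.natDegree) (l : ℕ) {y : ℂ} {ρ : ℝ}
    (hρ : 0 < ρ) (hreg : ∀ z w : ℂ, w ∈ Metric.ball y ρ → (newtonMap p)^[l] z = w →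
      deriv (inPlane (newtonMap p)^[l]) z ≠ 0) :
    ∃ G : ℂ → ℂ → ℂ,
      (∀ z₀ : ℂ, (newtonMap p)^[l] z₀ = y → DifferentiableOn ℂ (G z₀) (Metric.ball y ρ) ∧
        ∀ w ∈ Metric.ball y ρ, (newtonMap p)^[l] (G z₀ w) = w) ∧
      (∀ z w : ℂ, w ∈ Metric.ball y ρ → (newtonMap p)^[l] z = w →
        ∃ z₀ : ℂ, (newtonMap p)^[l] z₀ = y ∧ G z₀ w = z) ∧
      (∀ z₀ z₁ w : ℂ, (newtonMap p)^[l] z₀ = y → (newtonMap p)^[l] z₁ = y →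
        w ∈ Metric.ball y ρ → G z₀ w = G z₁ w → z₀ = z₁) := by
  classical
  set f : OnePoint ℂ → OnePoint ℂ := (newtonMap p)^[l] with hf
  have hfc : Continuous f := (continuous_newtonMap hp).iterate l
  set s : Set (OnePoint ℂ) := (fun w : ℂ => (w : OnePoint ℂ)) '' Metric.ball y ρ with hs
  have hfinf : f OnePoint.infty = OnePoint.infty := iterate_newtonMap_infty p l
  have hloc : IsLocalHomeomorphOn f (f ⁻¹' s) := by
    rw [isLocalHomeomorphOn_iff_isOpenEmbedding_restrict]
    rintro x ⟨w, hw, hwx⟩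
    have hxi : x ≠ OnePoint.infty := by
      rintro rfl
      rw [hfinf] at hwx
      exact OnePoint.coe_ne_infty _ hwx
    obtain ⟨z, rfl⟩ := OnePoint.ne_infty_iff_exists.1 hxi
    have hne : f z ≠ OnePoint.infty := by rw [← hwx]; exact OnePoint.coe_ne_infty w
    have han : AnalyticAt ℂ (inPlane f) z := analyticAt_inPlane_iterate hp hne
    have hst := han.hasStrictDerivAt.hasStrictFDerivAt_equiv (hreg z w hw hwx.symm)
    set e := hst.toOpenPartialHomeomorph (inPlane f)
    have hze : z ∈ e.source := hst.mem_toOpenPartialHomeomorph_source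
    obtain ⟨r, hr, hball⟩ := Metric.mem_nhds_iff.1 (Filter.inter_mem (e.open_source.mem_nhds hze)
      (eventually_iterate_ne_infty hp hne))
    refine ⟨(fun w : ℂ => (w : OnePoint ℂ)) '' Metric.ball z r,
      OnePoint.isOpenMap_coe.image_mem_nhds (Metric.ball_mem_nhds z hr), ?_⟩
    refine Topology.IsOpenEmbedding.of_continuous_injective_isOpenMap
      (hfc.comp continuous_subtype_val) ?_ ?_
    · rintro ⟨_, a, ha, rfl⟩ ⟨_, b, hb, rfl⟩ hab
      have h1 : inPlane f a = inPlane f b := congrArg toPlane hab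
      have h2 : a = b := e.injOn (hball ha).1 (hball hb).1 h1
      simp [h2]
    · intro V hV
      obtain ⟨V', hV', rfl⟩ := isOpen_induced_iff.1 hV
      have h1 : IsOpen (inPlane f '' (Metric.ball z r ∩ (fun w : ℂ => (w : OnePoint ℂ)) ⁻¹' V')) :=
        e.isOpen_image_of_subset_source (Metric.isOpen_ball.inter
          (hV'.preimage OnePoint.continuous_coe)) fun a ha => (hball ha.1).1
      have h2 := OnePoint.isOpenMap_coe _ h1
      convert h2 using 1
      ext q
      constructor
      · rintro ⟨⟨_, a, ha, rfl⟩, haV, rfl⟩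
        exact ⟨_, ⟨a, ⟨ha, haV⟩, rfl⟩, coe_inPlane (hball ha).2⟩
      · rintro ⟨_, ⟨a, ⟨ha, haV⟩, rfl⟩, rfl⟩
        exact ⟨⟨_, a, ha, rfl⟩, haV, (coe_inPlane (hball ha).2).symm⟩
  -- over the disc, the iterate is a local homeomorphism of a compact space, hence a covering, and
  -- the inclusion of the disc lifts as the disc is simply connected
  have hcov : IsCoveringMapOn f s := IsCoveringMapOn.of_isLocalHomeomorphOn hfc hloc
  have := Metric.contractibleSpace_ball (x := y) hρ
  have := (Metric.isOpen_ball (x := y) (ε := ρ)).locallyPathConnectedSpace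
  let ι : C(Metric.ball y ρ, OnePoint ℂ) :=
    ⟨fun w => ((w : ℂ) : OnePoint ℂ), OnePoint.continuous_coe.comp continuous_subtype_val⟩
  have hlift : ∀ (w : Metric.ball y ρ) (x : OnePoint ℂ), f x = ((w : ℂ) : OnePoint ℂ) →
      ∃! F : C(Metric.ball y ρ, OnePoint ℂ), F w = x ∧ f ∘ F = ι := fun w x hx =>
    hcov.existsUnique_continuousMap_lifts ι hx fun a => ⟨a, a.2, rfl⟩
  let y' : Metric.ball y ρ := ⟨y, Metric.mem_ball_self hρ⟩
  have hF : ∀ z₀ : ℂ, ∃ F : C(Metric.ball y ρ, OnePoint ℂ), f z₀ = y → F y' = z₀ ∧ f ∘ F = ι := by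
    intro z₀
    by_cases h : f z₀ = y
    · obtain ⟨F, hF, -⟩ := hlift y' z₀ h
      exact ⟨F, fun _ => hF⟩
    · exact ⟨ι, fun h' => absurd h' h⟩
  choose F hF using hF
  have hFi : ∀ z₀ : ℂ, f z₀ = y → ∀ w, F z₀ w ≠ OnePoint.infty := by
    intro z₀ hz₀ w hi
    have h := congrFun (hF z₀ hz₀).2 w
    rw [Function.comp_apply, hi, hfinf] at h
    exact OnePoint.infty_ne_coe _ h
  let G : ℂ → ℂ → ℂ := fun z₀ w => if h : w ∈ Metric.ball y ρ then toPlane (F z₀ ⟨w, h⟩) else 0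
  have hG : ∀ z₀ : ℂ, f z₀ = y → ∀ w (h : w ∈ Metric.ball y ρ),
      (G z₀ w : OnePoint ℂ) = F z₀ ⟨w, h⟩ := by
    intro z₀ hz₀ w h
    simp only [G, dif_pos h]
    exact coe_toPlane (hFi z₀ hz₀ _)
  have hfG : ∀ z₀ : ℂ, f z₀ = y → ∀ w ∈ Metric.ball y ρ, f (G z₀ w) = w := by
    intro z₀ hz₀ w hw
    rw [hG z₀ hz₀ w hw]
    exact congrFun (hF z₀ hz₀).2 ⟨w, hw⟩
  refine ⟨G, fun z₀ hz₀ => ⟨fun w hw => ?_, hfG z₀ hz₀⟩, fun z w hw hzw => ?_,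
    fun z₀ z₁ w hz₀ hz₁ hw h => ?_⟩
  · have hcont : ContinuousAt (G z₀) w := by
      have h1 : ContinuousOn (G z₀) (Metric.ball y ρ) := by
        rw [continuousOn_iff_continuous_domRestrict,
          OnePoint.isOpenEmbedding_coe.isInducing.continuous_iff]
        have : ((fun w : ℂ => (w : OnePoint ℂ)) ∘ (Metric.ball y ρ).domRestrict (G z₀)) = F z₀ := by
          ext a
          exact hG z₀ hz₀ a a.2
        rw [this]
        exact (F z₀).continuous
      exact h1.continuousAt (Metric.isOpen_ball.mem_nhds hw)
    have hne : f (G z₀ w) ≠ OnePoint.infty := by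
      rw [hfG z₀ hz₀ w hw]; exact OnePoint.coe_ne_infty w
    have h2 := HasDerivAt.of_local_left_inverse hcont
      (analyticAt_inPlane_iterate hp hne).differentiableAt.hasDerivAt
      (hreg _ w hw (hfG z₀ hz₀ w hw)) (by
        filter_upwards [Metric.isOpen_ball.mem_nhds hw] with a ha
        exact congrArg toPlane (hfG z₀ hz₀ a ha))
    exact h2.differentiableAt.differentiableWithinAt
  · obtain ⟨F', ⟨hF1, hF2⟩, -⟩ := hlift ⟨w, hw⟩ z hzw
    have hi : F' y' ≠ OnePoint.infty := by
      intro hi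
      have h := congrFun hF2 y'
      rw [Function.comp_apply, hi, hfinf] at h
      exact OnePoint.infty_ne_coe _ h
    obtain ⟨z₀, hz₀⟩ := OnePoint.ne_infty_iff_exists.1 hi
    have hfz₀ : f z₀ = y := by
      rw [hz₀]
      exact congrFun hF2 y'
    refine ⟨z₀, hfz₀, ?_⟩
    have : F z₀ = F' := (hlift y' z₀ hfz₀).unique (hF z₀ hfz₀) ⟨hz₀.symm, hF2⟩
    apply OnePoint.coe_injective
    rw [hG z₀ hfz₀ w hw, this, hF1]
  · have h1 : F z₀ ⟨w, hw⟩ = F z₁ ⟨w, hw⟩ := by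
      rw [← hG z₀ hz₀ w hw, ← hG z₁ hz₁ w hw, h]
    have h2 : F z₀ = F z₁ := (hlift ⟨w, hw⟩ (F z₁ ⟨w, hw⟩)
      (congrFun (hF z₁ hz₁).2 ⟨w, hw⟩)).unique ⟨h1, (hF z₀ hz₀).2⟩ ⟨rfl, (hF z₁ hz₁).2⟩
    apply OnePoint.coe_injective
    rw [← (hF z₀ hz₀).1, ← (hF z₁ hz₁).1, h2]

/-- The real Jacobian determinant of a holomorphic function is `|g'|²`. -/
theorem det_fderiv_of_hasDerivAt {g : ℂ → ℂ} {w a : ℂ} (h : HasDerivAt g a w) :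
    HasFDerivAt g (a • (1 : ℂ →L[ℝ] ℂ)) w ∧ (a • (1 : ℂ →L[ℝ] ℂ)).det = ‖a‖ ^ 2 := by
  have hdet : (a • (1 : ℂ →L[ℝ] ℂ)).det = ‖a‖ ^ 2 := by
    have : ((a • (1 : ℂ →L[ℝ] ℂ) : ℂ →L[ℝ] ℂ) : ℂ →ₗ[ℝ] ℂ) = Algebra.lmul ℝ ℂ a := by
      ext; simp
    rw [ContinuousLinearMap.det, this, ← Complex.normSq_eq_norm_sq, ← Algebra.norm_complex_apply,
      Algebra.norm_apply]
  exact ⟨by simpa using h.complexToReal_fderiv, hdet⟩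

/-- Change of variables: the area of the image is the integral of the square of the spherical
derivative. -/
theorem sphericalArea_image {g : ℂ → ℂ} {X : Set ℂ} (hX : MeasurableSet X)
    (hg : ∀ w ∈ X, DifferentiableAt ℂ g w) (hinj : Set.InjOn g X) :
    sphericalArea (g '' X) =
      ∫⁻ w in X, ENNReal.ofReal (4 * (‖deriv g w‖ / (1 + ‖g w‖ ^ 2)) ^ 2) := by
  have hd : ∀ w ∈ X, HasFDerivWithinAt g (deriv g w • (1 : ℂ →L[ℝ] ℂ)) X w := fun w hw =>
    (det_fderiv_of_hasDerivAt (hg w hw).hasDerivAt).1.hasFDerivWithinAt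
  have hmeas : MeasurableSet (g '' X) := measurable_image_of_fderivWithin hX hd hinj
  rw [sphericalArea, withDensity_apply _ hmeas,
    lintegral_image_eq_lintegral_abs_det_fderiv_mul _ hX hd hinj]
  refine setLIntegral_congr_fun hX fun w hw => ?_
  change ENNReal.ofReal |(deriv g w • (1 : ℂ →L[ℝ] ℂ)).det| * _ = _
  rw [(det_fderiv_of_hasDerivAt (hg w hw).hasDerivAt).2, ← ENNReal.ofReal_mul (abs_nonneg _),
    abs_of_nonneg (sq_nonneg _)]
  congr 1
  rw [div_pow]
  ring

/-- Bounded distortion of all inverse branches together: the area of the preimage of `X` under an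
iterate is controlled by the area of the preimage of any other set `b` near the centre of a disc
without critical values. -/
theorem exists_area_preimage_comparison (v : ℂ) : ∃ K : ENNReal, K ≠ ⊤ ∧
    ∀ {p : Polynomial ℂ}, 2 ≤ p.natDegree → p.eval v = 0 → ∀ (l : ℕ) {y : ℂ} {ρ : ℝ}, 0 < ρ →
    v ∉ Metric.ball y ρ → (∀ z w : ℂ, w ∈ Metric.ball y ρ → (newtonMap p)^[l] z = w →
      deriv (inPlane (newtonMap p)^[l]) z ≠ 0) →
    ∀ X b : Set ℂ, MeasurableSet X → MeasurableSet b → X ⊆ Metric.ball y (ρ / 256) →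
    b ⊆ Metric.ball y (ρ / 256) →
    volume b * sphericalArea {z : ℂ | ∃ w ∈ X, (newtonMap p)^[l] z = w} ≤
      K * volume X * sphericalArea {z : ℂ | ∃ w ∈ b, (newtonMap p)^[l] z = w} := by
  obtain ⟨K, hK, hcomp⟩ := exists_sphericalDeriv_comparison v
  refine ⟨ENNReal.ofReal (K ^ 2), ENNReal.ofReal_ne_top, ?_⟩
  intro p hp hv l y ρ hρ hvW hreg X b hX hb hXs hbs
  obtain ⟨G, hG1, hG2, hG3⟩ := exists_inverse_branches hp l hρ hreg
  set Y : Set ℂ := {z₀ : ℂ | (newtonMap p)^[l] z₀ = y} with hY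
  have hsub : Metric.ball y (ρ / 256) ⊆ Metric.ball y ρ := Metric.ball_subset_ball (by linarith)
  have hinj : ∀ z₀ ∈ Y, Set.InjOn (G z₀) (Metric.ball y ρ) := by
    intro z₀ hz₀ a ha c hc hac
    have h1 := (hG1 z₀ hz₀).2 a ha
    rw [hac, (hG1 z₀ hz₀).2 c hc] at h1
    exact (OnePoint.coe_injective h1).symm
  -- a branch cannot take the value `v`, which is fixed by `N` and outside the disc
  have homit : ∀ z₀ ∈ Y, v ∉ G z₀ '' Metric.ball y ρ := by
    rintro z₀ hz₀ ⟨w, hw, hwv⟩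
    have h1 := (hG1 z₀ hz₀).2 w hw
    have h2 : (newtonMap p)^[l] (v : OnePoint ℂ) = v := Function.iterate_fixed (newtonMap_root hv) l
    rw [hwv, h2] at h1
    rw [OnePoint.coe_injective h1] at hvW
    exact hvW hw
  -- the branches have disjoint open images
  have hcount : Y.Countable := by
    refine Set.PairwiseDisjoint.countable_of_isOpen (s := fun z₀ => G z₀ '' Metric.ball y ρ) ?_
      (fun z₀ hz₀ => ?_) (fun z₀ _ => ⟨_, y, Metric.mem_ball_self hρ, rfl⟩)
    · intro z₀ hz₀ z₁ hz₁ hne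
      rw [Function.onFun, Set.disjoint_left]
      rintro _ ⟨a, ha, rfl⟩ ⟨c, hc, hac⟩
      have h1 := (hG1 z₀ hz₀).2 a ha
      have h2 := (hG1 z₁ hz₁).2 c hc
      rw [hac, h1] at h2
      obtain rfl := OnePoint.coe_injective h2
      exact hne (hG3 z₀ z₁ a hz₀ hz₁ ha hac.symm)
    · exact (exists_holomorphic_inverse Metric.isOpen_ball (hG1 z₀ hz₀).1
        (hinj z₀ hz₀)).choose_spec.1
  have hpre : ∀ X' ⊆ Metric.ball y (ρ / 256),
      {z : ℂ | ∃ w ∈ X', (newtonMap p)^[l] z = w} = ⋃ z₀ ∈ Y, G z₀ '' X' := by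
    intro X' hX'
    ext z
    simp only [Set.mem_ofPred_eq, Set.mem_iUnion, Set.mem_image, exists_prop]
    constructor
    · rintro ⟨w, hw, hzw⟩
      obtain ⟨z₀, hz₀, h⟩ := hG2 z w (hsub (hX' hw)) hzw
      exact ⟨z₀, hz₀, w, hw, h⟩
    · rintro ⟨z₀, hz₀, w, hw, rfl⟩
      exact ⟨w, hw, (hG1 z₀ hz₀).2 w (hsub (hX' hw))⟩
  have harea : ∀ z₀ ∈ Y, ∀ X' ⊆ Metric.ball y (ρ / 256), MeasurableSet X' →
      sphericalArea (G z₀ '' X') = ∫⁻ w in X',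
        ENNReal.ofReal (4 * (‖deriv (G z₀) w‖ / (1 + ‖G z₀ w‖ ^ 2)) ^ 2) := by
    intro z₀ hz₀ X' hX' hm
    exact sphericalArea_image hm (fun w hw => (hG1 z₀ hz₀).1.differentiableAt
      (Metric.isOpen_ball.mem_nhds (hsub (hX' hw)))) ((hinj z₀ hz₀).mono (hX'.trans hsub))
  have hsingle : ∀ z₀ ∈ Y, volume b * sphericalArea (G z₀ '' X) ≤
      ENNReal.ofReal (K ^ 2) * volume X * sphericalArea (G z₀ '' b) := by
    intro z₀ hz₀
    rw [harea z₀ hz₀ X hXs hX, harea z₀ hz₀ b hbs hb]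
    set D : ℂ → ENNReal := fun w =>
      ENNReal.ofReal (4 * (‖deriv (G z₀) w‖ / (1 + ‖G z₀ w‖ ^ 2)) ^ 2)
    have hDD : ∀ w ∈ X, ∀ w' ∈ b, D w ≤ ENNReal.ofReal (K ^ 2) * D w' := by
      intro w hw w' hw'
      have h := hcomp (G z₀) y ρ hρ (hG1 z₀ hz₀).1 (hinj z₀ hz₀) (homit z₀ hz₀) w (hXs hw) w'
        (hbs hw')
      simp only [D]
      rw [← ENNReal.ofReal_mul (by positivity)]
      apply ENNReal.ofReal_le_ofReal
      have h2 := pow_le_pow_left₀ (by positivity) h 2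
      rw [mul_pow] at h2
      linarith
    have hstep : ∀ w ∈ X, D w * volume b ≤ ENNReal.ofReal (K ^ 2) * ∫⁻ w' in b, D w' := by
      intro w hw
      rw [← setLIntegral_const, ← lintegral_const_mul' _ _ ENNReal.ofReal_ne_top]
      exact setLIntegral_mono' hb fun w' hw' => hDD w hw w' hw'
    by_cases hbt : volume b = ⊤
    · exfalso
      have : volume b ≤ volume (Metric.ball y (ρ / 256)) := measure_mono hbs
      rw [hbt] at this
      exact absurd (top_le_iff.1 this) measure_ball_lt_top.ne
    · rw [← lintegral_const_mul' _ _ hbt, mul_assoc, mul_comm (volume X), ← mul_assoc,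
        ← setLIntegral_const]
      refine setLIntegral_mono' hX fun w hw => ?_
      rw [mul_comm]
      exact hstep w hw
  rw [hpre X hXs, hpre b hbs]
  have hmb : ∀ z₀ ∈ Y, MeasurableSet (G z₀ '' b) := fun z₀ hz₀ =>
    measurable_image_of_fderivWithin hb (fun w hw => ((det_fderiv_of_hasDerivAt
      ((hG1 z₀ hz₀).1.differentiableAt (Metric.isOpen_ball.mem_nhds
        (hsub (hbs hw)))).hasDerivAt).1).hasFDerivWithinAt) ((hinj z₀ hz₀).mono (hbs.trans hsub))
  rw [measure_biUnion hcount ?_ hmb]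
  · calc volume b * sphericalArea (⋃ z₀ ∈ Y, G z₀ '' X)
        ≤ volume b * ∑' z₀ : Y, sphericalArea (G z₀ '' X) := by
          gcongr
          exact measure_biUnion_le _ hcount _
      _ = ∑' z₀ : Y, volume b * sphericalArea (G z₀ '' X) := ENNReal.tsum_mul_left.symm
      _ ≤ ∑' z₀ : Y, ENNReal.ofReal (K ^ 2) * volume X * sphericalArea (G z₀ '' b) :=
          ENNReal.tsum_le_tsum fun z₀ => hsingle z₀ z₀.2
      _ = _ := ENNReal.tsum_mul_left
  · intro z₀ hz₀ z₁ hz₁ hne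
    rw [Function.onFun, Set.disjoint_left]
    rintro _ ⟨a, ha, rfl⟩ ⟨c, hc, hac⟩
    have h1 := (hG1 z₀ hz₀).2 a (hsub (hbs ha))
    have h2 := (hG1 z₁ hz₁).2 c (hsub (hbs hc))
    rw [hac, h1] at h2
    obtain rfl := OnePoint.coe_injective h2
    exact hne (hG3 z₀ z₁ a hz₀ hz₁ (hsub (hbs ha)) hac.symm)

/-! ### Bounded multiplicity of visits -/

/-- A root is attracting, so it has arbitrarily small forward invariant neighbourhoods. -/
theorem exists_forward_invariant {p : Polynomial ℂ} (hp : p ≠ 0) {v : ℂ} (hv : p.eval v = 0)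
    {O : Set (OnePoint ℂ)} (hO : O ∈ 𝓝 (v : OnePoint ℂ)) :
    ∃ U ⊆ O, IsOpen U ∧ (v : OnePoint ℂ) ∈ U ∧ ∀ x ∈ U, newtonMap p x ∈ U := by
  obtain ⟨g, m, hm, hg, hgv, hgd, hN⟩ := exists_local_form_at_root hp hv
  have hmult : ‖(1 - 1 / m : ℂ)‖ < 1 := norm_one_sub_inv_lt_one hm
  have hcontr := eventually_norm_sub_le_of_hasDerivAt hgd hmult
  rw [OnePoint.nhds_coe_eq, Filter.mem_map] at hO
  obtain ⟨ε, hε, hball⟩ := Metric.mem_nhds_iff.1 (Filter.inter_mem hO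
    (Filter.inter_mem hcontr hN))
  refine ⟨(fun z : ℂ => (z : OnePoint ℂ)) '' Metric.ball v ε, ?_,
    OnePoint.isOpenMap_coe _ Metric.isOpen_ball, ⟨v, Metric.mem_ball_self hε, rfl⟩, ?_⟩
  · rintro _ ⟨z, hz, rfl⟩
    exact (hball hz).1
  · rintro _ ⟨z, hz, rfl⟩
    obtain ⟨-, h1, h2⟩ := hball hz
    rw [Set.mem_ofPred_eq] at h2
    refine ⟨g z, ?_, h2.symm⟩
    have h3 : ‖g z - g v‖ ≤ 1 * ‖z - v‖ := h1
    rw [hgv, one_mul] at h3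
    rw [mem_ball_iff_norm] at hz ⊢
    exact h3.trans_lt hz

/-- Orbits visit a compact subset of a basin a bounded number of times, so the areas of its
iterated preimages are summable. -/
theorem tsum_area_preimage_ne_top {p : Polynomial ℂ} (hp : 2 ≤ p.natDegree) {v : ℂ}
    (hv : p.eval v = 0) {b : Set ℂ} (hb : IsCompact b)
    (hbv : ∀ w ∈ b, (w : OnePoint ℂ) ∈ basin (newtonMap p) v) (hvb : v ∉ b) :
    ∑' l : ℕ, sphericalArea {z : ℂ | ∃ w ∈ b, (newtonMap p)^[l] z = w} ≠ ⊤ := by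
  have hp0 : p ≠ 0 := by rintro rfl; simp at hp
  have hbC : IsCompact ((fun z : ℂ => (z : OnePoint ℂ)) '' b) := hb.image OnePoint.continuous_coe
  obtain ⟨U, hUO, hUo, hvU, hU⟩ := exists_forward_invariant hp0 hv
    (hbC.isClosed.isOpen_compl.mem_nhds (by
      rintro ⟨w, hw, hwv⟩
      exact hvb (OnePoint.coe_injective hwv ▸ hw)))
  have hUit : ∀ (m : ℕ) x, x ∈ U → (newtonMap p)^[m] x ∈ U := by
    intro m
    induction m with
    | zero => exact fun x hx => hx
    | succ m ih =>
      intro x hx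
      rw [Function.iterate_succ_apply']
      exact hU _ (ih x hx)
  -- by compactness, all orbits from `b` are in the forward invariant `U`, disjoint from `b`, from
  -- a common time `M` on; hence an orbit visits `b` at most `M` times
  obtain ⟨M, hM⟩ : ∃ M : ℕ, ∀ x ∈ (fun z : ℂ => (z : OnePoint ℂ)) '' b,
      (newtonMap p)^[M] x ∈ U := by
    obtain ⟨t, ht⟩ := hbC.elim_directed_cover (fun m : ℕ => (newtonMap p)^[m] ⁻¹' U)
      (fun m => hUo.preimage ((continuous_newtonMap hp).iterate m)) (by
        rintro _ ⟨w, hw, rfl⟩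
        have h := hbv w hw
        rw [basin_eq hp hv] at h
        obtain ⟨m, hm⟩ := (h.eventually (hUo.mem_nhds hvU)).exists
        exact Set.mem_iUnion.2 ⟨m, hm⟩) (directed_of_isDirected_le fun i j hij x hx => by
          obtain ⟨l, rfl⟩ := Nat.exists_eq_add_of_le hij
          rw [Set.mem_preimage, add_comm, Function.iterate_add_apply]
          exact hUit l _ hx)
    exact ⟨t, fun x hx => ht hx⟩
  set A : ℕ → Set ℂ := fun l => {z : ℂ | ∃ w ∈ b, (newtonMap p)^[l] z = w} with hA
  have hvisit : ∀ z l l', z ∈ A l → z ∈ A l' → l' < l + M := by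
    rintro z l l' ⟨w, hw, hzw⟩ ⟨w', hw', hzw'⟩
    by_contra hle
    rw [not_lt] at hle
    obtain ⟨i, rfl⟩ := Nat.exists_eq_add_of_le hle
    have h1 : (newtonMap p)^[l + M + i] z ∈ U := by
      rw [show l + M + i = i + (M + l) by ring, Function.iterate_add_apply,
        Function.iterate_add_apply, hzw]
      exact hUit i _ (hM _ ⟨w, hw, rfl⟩)
    rw [hzw'] at h1
    exact hUO h1 ⟨w', hw', rfl⟩
  have hAm : ∀ l, MeasurableSet (A l) := by
    intro l
    have : A l = (fun z : ℂ => (newtonMap p)^[l] z) ⁻¹' ((fun z : ℂ => (z : OnePoint ℂ)) '' b) := by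
      ext z
      exact ⟨fun ⟨w, hw, h⟩ => ⟨w, hw, h.symm⟩, fun ⟨w, hw, h⟩ => ⟨w, hw, h.symm⟩⟩
    rw [this]
    exact (hbC.isClosed.preimage
      (((continuous_newtonMap hp).iterate l).comp OnePoint.continuous_coe)).measurableSet
  have hint : ∀ l, sphericalArea (A l) = ∫⁻ z, (A l).indicator 1 z ∂sphericalArea := fun l => by
    rw [lintegral_indicator_one (hAm l)]
  change ∑' l, sphericalArea (A l) ≠ ⊤
  simp only [hint]
  rw [← lintegral_tsum fun l => (measurable_one.indicator (hAm l)).aemeasurable]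
  have hbound : ∀ z, ∑' l, (A l).indicator (1 : ℂ → ENNReal) z ≤ M := by
    intro z
    by_cases h : ∃ l, z ∈ A l
    · classical
      obtain ⟨hl1, hl2⟩ := And.intro (Nat.find_spec h) fun l => Nat.find_min h (m := l)
      set l₀ := Nat.find h
      rw [tsum_eq_sum (s := Finset.Ico l₀ (l₀ + M))]
      · refine (Finset.sum_le_card_nsmul _ _ 1 fun l _ => ?_).trans (by simp)
        exact Set.indicator_le_self' (fun _ _ => zero_le) z
      · intro l hl
        refine Set.indicator_of_notMem (fun hz => hl ?_) _
        rw [Finset.mem_Ico]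
        exact ⟨not_lt.1 fun hlt => hl2 l hlt hz, hvisit z l₀ l hl1 hz⟩
    · push Not at h
      simp [Set.indicator_of_notMem (h _)]
  refine ne_top_of_le_ne_top ?_ (lintegral_mono hbound)
  rw [lintegral_const]
  exact ENNReal.mul_ne_top (ENNReal.natCast_ne_top M) sphericalArea_univ_ne_top

/-! ### Area of the iterated preimages of a sequence of sets shrinking to infinity -/

theorem isOpen_nearSet_infty (s : ℝ) : IsOpen (nearSet OnePoint.infty s) := by
  have h : nearSet OnePoint.infty s =
      ((fun z : ℂ => (z : OnePoint ℂ)) '' Metric.closedBall 0 s⁻¹)ᶜ := by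
    ext x
    rw [mem_nearSet_infty]
    simp only [Set.mem_compl_iff, Set.mem_image, Metric.mem_closedBall, dist_zero_right, not_exists,
      not_and']
    exact ⟨fun h u hu h' => absurd (h u hu.symm) (not_lt.2 h'),
      fun h u hu => not_le.1 (h u hu.symm)⟩
  rw [h]
  exact ((isCompact_closedBall 0 s⁻¹).image OnePoint.continuous_coe).isClosed.isOpen_compl

theorem volume_le_sphericalArea {X : Set ℂ} {M : ℝ} (hX : MeasurableSet X)
    (h : ∀ z ∈ X, ‖z‖ ≤ M) : volume X ≤ ENNReal.ofReal ((1 + M ^ 2) ^ 2 / 4) * sphericalArea X := by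
  rw [sphericalArea, withDensity_apply _ hX, ← lintegral_const_mul' _ _ ENNReal.ofReal_ne_top,
    ← setLIntegral_one]
  refine setLIntegral_mono' hX fun z hz => ?_
  have h1 := h z hz
  have h0 := norm_nonneg z
  rw [← ENNReal.ofReal_mul (by positivity), ← ENNReal.ofReal_one]
  apply ENNReal.ofReal_le_ofReal
  rw [div_mul_div_comm, le_div_iff₀ (by positivity), one_mul, mul_comm]
  gcongr

/-- If a disc contains no postcritical point and meets the basin of a root, the total area of the
iterated preimages of a small subset of that disc is controlled by the area of the subset: it is
compared with the total area of the preimages of a compact part of the basin, which is finite. -/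
theorem powerDecay_tsum_preimage {p : Polynomial ℂ} (hp : 2 ≤ p.natDegree) {v₀ : ℂ}
    (hv₀ : p.eval v₀ = 0) {y : ℂ} {ρ : ℝ} (hρ : 0 < ρ) (hv₀y : v₀ ∉ Metric.ball y ρ)
    (hreg : ∀ (l : ℕ) (z w : ℂ), w ∈ Metric.ball y ρ → (newtonMap p)^[l] z = w →
      deriv (inPlane (newtonMap p)^[l]) z ≠ 0)
    (hmeet : ∃ u ∈ Metric.ball y (ρ / 256), ∃ v, p.eval v = 0 ∧
      (u : OnePoint ℂ) ∈ basin (newtonMap p) v)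
    {X : ℝ → Set ℂ} (hXm : ∀ s, MeasurableSet (X s)) (hXs : ∀ s, X s ⊆ Metric.ball y (ρ / 256))
    (hX : PowerDecay fun s => sphericalArea (X s)) :
    PowerDecay fun s => ∑' l : ℕ, sphericalArea {z : ℂ | ∃ w ∈ X s, (newtonMap p)^[l] z = w} := by
  obtain ⟨u, hu, v, hv, huv⟩ := hmeet
  have hO : IsOpen (Metric.ball y (ρ / 256) ∩
      (fun z : ℂ => (z : OnePoint ℂ)) ⁻¹' basin (newtonMap p) v) :=
    Metric.isOpen_ball.inter ((isOpen_basin _ _).preimage OnePoint.continuous_coe)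
  -- a closed disc `b` in the basin that avoids the attracting point
  obtain ⟨u', hu', hu'v⟩ := (dense_compl_singleton v).inter_open_nonempty _ hO ⟨u, hu, huv⟩
  obtain ⟨ε, hε, hball⟩ := Metric.nhds_basis_closedBall.mem_iff.1
    ((hO.inter isOpen_compl_singleton).mem_nhds ⟨hu', hu'v⟩)
  set b := Metric.closedBall u' ε
  obtain ⟨K, hK, hcomp⟩ := exists_area_preimage_comparison v₀
  have hsum := tsum_area_preimage_ne_top hp hv (b := b) (isCompact_closedBall _ _)
    (fun w hw => (hball hw).1.2) (fun h => (hball h).2 rfl)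
  have hb0 : volume b ≠ 0 := (Metric.measure_closedBall_pos volume u' hε).ne'
  have hbt : volume b ≠ ⊤ := (isCompact_closedBall u' ε).measure_lt_top.ne
  set M := ENNReal.ofReal ((1 + (‖y‖ + ρ) ^ 2) ^ 2 / 4)
  set tot := ∑' l : ℕ, sphericalArea {z : ℂ | ∃ w ∈ b, (newtonMap p)^[l] z = w}
  have hconst : (volume b)⁻¹ * (K * M * tot) ≠ ⊤ := by
    refine ENNReal.mul_ne_top (ENNReal.inv_ne_top.2 hb0)
      (ENNReal.mul_ne_top (ENNReal.mul_ne_top hK ENNReal.ofReal_ne_top) hsum)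
  refine (hX.const_mul hconst).mono fun s _ _ => ?_
  have hvol : volume (X s) ≤ M * sphericalArea (X s) :=
      volume_le_sphericalArea (hXm s) fun z hz => by
    have h1 := Metric.mem_ball.1 (hXs s hz)
    have h2 : ‖z‖ ≤ ‖y‖ + dist z y := by
      rw [dist_eq_norm]; simpa using norm_add_le y (z - y)
    linarith
  have hl : ∀ l : ℕ, sphericalArea {z : ℂ | ∃ w ∈ X s, (newtonMap p)^[l] z = w} ≤
      (volume b)⁻¹ * (K * (M * sphericalArea (X s))) *
        sphericalArea {z : ℂ | ∃ w ∈ b, (newtonMap p)^[l] z = w} := fun l => by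
    have h := hcomp hp hv₀ l hρ hv₀y (hreg l) (X s) b (hXm s) measurableSet_closedBall (hXs s)
      fun w hw => (hball hw).1.1
    rw [mul_assoc (volume b)⁻¹, mul_comm, ← div_eq_mul_inv,
      ENNReal.le_div_iff_mul_le (Or.inl hb0) (Or.inl hbt), mul_comm]
    exact h.trans (mul_le_mul' (mul_le_mul' le_rfl hvol) le_rfl)
  refine (ENNReal.tsum_le_tsum hl).trans (le_of_eq ?_)
  rw [ENNReal.tsum_mul_left]
  ring

/-- All critical points that ever land at `∞` do so within a bounded time. -/
theorem exists_landing_time {p : Polynomial ℂ} {Cr : Set ℂ} (hCr : Cr.Finite) :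
    ∃ L : ℕ, ∀ c ∈ Cr, ∀ i : ℕ, (newtonMap p)^[i] c = OnePoint.infty →
      (newtonMap p)^[L] c = OnePoint.infty := by
  have h1 : ∀ c : ℂ, ∃ n : ℕ, ∀ i : ℕ, (newtonMap p)^[i] c = OnePoint.infty →
      (newtonMap p)^[n] c = OnePoint.infty := fun c => by
    by_cases h : ∃ n : ℕ, (newtonMap p)^[n] c = OnePoint.infty
    · exact h.imp fun n hn _ _ => hn
    · exact ⟨0, fun i hi => absurd ⟨i, hi⟩ h⟩
  choose n hn using h1
  refine ⟨hCr.toFinset.sup n, fun c hc i hi => ?_⟩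
  by_contra hne
  exact iterate_ne_infty_of_le (Finset.le_sup (hCr.mem_toFinset.2 hc)) hne (hn c i hi)

/-- A point that lands at `∞` at the time `L + 1`, later than all critical points that land there,
is not in the closure of the postcritical set: orbits of critical points either converge to a root,
and then avoid the point with their limit, or are finite and miss the point. -/
theorem exists_postcritically_free_ball {p : Polynomial ℂ} (hp : 2 ≤ p.natDegree)
    {Cr : Set ℂ} (hCr : Cr.Finite)
    (hcrit : ∀ c ∈ Cr, (∃ v, p.eval v = 0 ∧ (c : OnePoint ℂ) ∈ basin (newtonMap p) v) ∨
      (Set.range fun m : ℕ => (newtonMap p)^[m] c).Finite)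
    {L : ℕ} (hL : ∀ c ∈ Cr, ∀ i : ℕ, (newtonMap p)^[i] c = OnePoint.infty →
      (newtonMap p)^[L] c = OnePoint.infty)
    {v₀ : ℂ} (hv₀ : p.eval v₀ = 0) {y : ℂ} (hy : (newtonMap p)^[L + 1] y = OnePoint.infty)
    (hy' : (newtonMap p)^[L] y ≠ OnePoint.infty) :
    ∃ ρ : ℝ, 0 < ρ ∧ v₀ ∉ Metric.ball y ρ ∧
      ∀ c ∈ Cr, ∀ (i : ℕ), ∀ w ∈ Metric.ball y ρ, (newtonMap p)^[i] c ≠ w := by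
  have hyb : ∀ v, p.eval v = 0 → (y : OnePoint ℂ) ∉ basin (newtonMap p) v := fun v hv h => by
    rw [← iterate_mem_basin_iff hp hv (L + 1), hy] at h
    exact infty_notMem_basin hp hv h
  have hyv : ∀ v, p.eval v = 0 → y ≠ v := fun v hv h =>
    hyb v hv (by rw [h]; exact mem_basin_self hp hv)
  have hnear : ∀ c ∈ Cr, ∀ᶠ w : ℂ in 𝓝 y, ∀ i : ℕ, (newtonMap p)^[i] c ≠ w := by
    intro c hc
    obtain ⟨Q, hQ, hQr, hyQ⟩ : ∃ Q : Set (OnePoint ℂ), IsClosed Q ∧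
        (∀ i : ℕ, (newtonMap p)^[i] c ∈ Q) ∧ (y : OnePoint ℂ) ∉ Q := by
      rcases hcrit c hc with ⟨v, hv, hcv⟩ | hfin
      · refine ⟨insert (v : OnePoint ℂ) (Set.range fun m : ℕ => (newtonMap p)^[m] c), ?_,
          fun i => Or.inr ⟨i, rfl⟩, ?_⟩
        · have h := hcv
          rw [basin_eq hp hv] at h
          exact (Tendsto.isCompact_insert_range h).isClosed
        · rintro (h | ⟨i, h⟩)
          · exact hyv v hv (OnePoint.coe_injective h)
          · refine hyb v hv (h ▸ ?_)
            exact (iterate_mem_basin_iff hp hv i _).2 hcv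
      · refine ⟨_, hfin.isClosed, fun i => ⟨i, rfl⟩, ?_⟩
        rintro ⟨i, h⟩
        simp only at h
        have h1 : (newtonMap p)^[L + 1 + i] c = OnePoint.infty := by
          rw [Function.iterate_add_apply, h, hy]
        have h2 := hL c hc _ h1
        apply hy'
        rw [← h, ← Function.iterate_add_apply, add_comm, Function.iterate_add_apply, h2,
          iterate_newtonMap_infty]
    have hopen := hQ.isOpen_compl.preimage (OnePoint.continuous_coe (X := ℂ))
    filter_upwards [hopen.mem_nhds hyQ] with w hw i hi
    exact hw (hi ▸ hQr i)
  have h1 := (hCr.eventually_all (l := 𝓝 y)).2 hnear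
  obtain ⟨ρ, hρ, hball⟩ := Metric.eventually_nhds_iff_ball.1
    (h1.and (eventually_ne_nhds (hyv v₀ hv₀)))
  exact ⟨ρ, hρ, fun h => (hball _ h).2 rfl, fun c hc i w hw => (hball w hw).1 c hc i⟩

/-- The chain rule: a critical point of an iterate has a critical point of `N` on its orbit. -/
theorem deriv_ne_zero_of_postcritically_free {p : Polynomial ℂ} (hp : 2 ≤ p.natDegree) {w : ℂ}
    (h : ∀ c : ℂ, newtonMap p c ≠ OnePoint.infty → deriv (inPlane (newtonMap p)) c = 0 →
      ∀ i : ℕ, (newtonMap p)^[i] c ≠ w) {l : ℕ} {z : ℂ} (hz : (newtonMap p)^[l] z = w) :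
    deriv (inPlane (newtonMap p)^[l]) z ≠ 0 := by
  have hne : (newtonMap p)^[l] z ≠ OnePoint.infty := hz ▸ OnePoint.coe_ne_infty w
  refine deriv_inPlane_iterate_ne_zero hp hne fun i hi hd => ?_
  have h1 := coe_inPlane (iterate_ne_infty_of_le hi.le hne)
  refine h _ ?_ hd (l - i) ?_
  · rw [h1, ← Function.iterate_succ_apply' (newtonMap p)]
    exact iterate_ne_infty_of_le hi hne
  · rw [h1, ← Function.iterate_add_apply, Nat.sub_add_cancel hi.le, hz]

/-- The points whose orbit enters a set `T m` close to `∞`: either this happens within time `L`, or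
some iterate is close to a point that lands at `∞` at time exactly `L + 1`. The reason is that the
Newton map is injective near `∞` and that `T m` has enough preimages inside `T m`. -/
theorem exists_cover_of_entering_set {p : Polynomial ℂ} (hp : 2 ≤ p.natDegree) (L : ℕ)
    (r : ℂ → ℝ) (hr : ∀ y, 0 < r y) {T : ℕ → Set ℂ} (hT : ∀ m, T (m + 1) ⊆ T m)
    {c Λ : ℝ} (hc : 0 < c) (hΛ : 1 < Λ) (hgrow : ∀ m, ∀ t ∈ T m, c * Λ ^ m ≤ ‖t‖)
    (hback : ∀ m, ∀ t ∈ T m, ∃ t' ∈ T (m + 1), newtonMap p t' = t) :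
    ∃ (F : Finset ℂ) (m₁ : ℕ), (∀ y ∈ F, (newtonMap p)^[L + 1] y = OnePoint.infty ∧
        (newtonMap p)^[L] y ≠ OnePoint.infty) ∧
      ∀ m ≥ m₁, ∀ z : ℂ, (∃ l : ℕ, ∃ t ∈ T m, (newtonMap p)^[l] z = t) →
        (∃ l ≤ L, (newtonMap p)^[l] z ∈ nearSet OnePoint.infty (2 / (c * Λ ^ m))) ∨
        ∃ y ∈ F, ∃ (l : ℕ) (w : ℂ), (newtonMap p)^[l] z = w ∧ w ∈ Metric.ball y (r y) ∧
          (newtonMap p)^[L + 1] w ∈ nearSet OnePoint.infty (2 / (c * Λ ^ m)) ∧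
          ∃ t ∈ T m, (newtonMap p)^[L + 1] w = t := by
  classical
  obtain ⟨R, -, hR, -, -, -, hinj, -⟩ := exists_expansion_at_infty hp
  have hcont : ∀ m, Continuous (newtonMap p)^[m] := fun m => (continuous_newtonMap hp).iterate m
  set D₀ := nearSet OnePoint.infty R⁻¹ with hD₀
  have hD₀i : OnePoint.infty ∈ D₀ := by
    rw [hD₀, mem_nearSet_infty]; exact fun u hu => absurd hu (OnePoint.infty_ne_coe u)
  set K : Set (OnePoint ℂ) := (newtonMap p)^[L] ⁻¹' D₀ᶜ with hK
  have hKc : IsClosed K := (isOpen_nearSet_infty _).isClosed_compl.preimage (hcont L)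
  set K' := K ∩ (newtonMap p)^[L + 1] ⁻¹' {OnePoint.infty} with hK'
  have hK'c : IsCompact K' :=
    (hKc.inter (isClosed_singleton.preimage (hcont (L + 1)))).isCompact
  set B : ℂ → Set (OnePoint ℂ) := fun y => (fun z : ℂ => (z : OnePoint ℂ)) '' Metric.ball y (r y)
  have hBo : ∀ y, IsOpen (B y) := fun y =>
    OnePoint.isOpenEmbedding_coe.isOpenMap _ Metric.isOpen_ball
  set Y : Set ℂ := {y | (newtonMap p)^[L + 1] y = OnePoint.infty ∧
        (newtonMap p)^[L] y ≠ OnePoint.infty} with hY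
  have hcover : K' ⊆ ⋃ y ∈ Y, B y := by
    rintro x ⟨hx1, hx2⟩
    have hxi : x ≠ OnePoint.infty := by
      rintro rfl
      exact hx1 (by rw [iterate_newtonMap_infty]; exact hD₀i)
    obtain ⟨y, rfl⟩ := OnePoint.ne_infty_iff_exists.1 hxi
    refine Set.mem_biUnion (x := y) ⟨hx2, fun h => hx1 (h ▸ hD₀i)⟩
      ⟨y, Metric.mem_ball_self (hr y), rfl⟩
  obtain ⟨F, hFY, hFf, hF⟩ := hK'c.elim_finite_subcover_image (fun y _ => hBo y) hcover
  obtain ⟨F, rfl⟩ := hFf.exists_finset_coe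
  -- off the discs, the iterate `N^(L+1)` stays away from `∞` on `K`
  have hrest : IsCompact ((newtonMap p)^[L + 1] '' (K \ ⋃ y ∈ (F : Set ℂ), B y)) :=
    ((hKc.sdiff (isOpen_biUnion fun y _ => hBo y)).isCompact).image (hcont _)
  have hrest_i : OnePoint.infty ∉ (newtonMap p)^[L + 1] '' (K \ ⋃ y ∈ (F : Set ℂ), B y) := by
    rintro ⟨x, ⟨hx1, hx2⟩, hx3⟩
    exact hx2 (hF ⟨hx1, hx3⟩)
  have hlim : Tendsto (fun m : ℕ => c * Λ ^ m) atTop atTop :=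
    (tendsto_pow_atTop_atTop_of_one_lt hΛ).const_mul_atTop hc
  obtain ⟨R₁, hR₁⟩ : ∃ R₁ : ℝ, ∀ u : ℂ,
      (u : OnePoint ℂ) ∈ (newtonMap p)^[L + 1] '' (K \ ⋃ y ∈ (F : Set ℂ), B y) → ‖u‖ ≤ R₁ := by
    have h1 : {x : OnePoint ℂ | x ∉ (newtonMap p)^[L + 1] '' (K \ ⋃ y ∈ (F : Set ℂ), B y)} ∈
        𝓝 OnePoint.infty := hrest.isClosed.isOpen_compl.mem_nhds hrest_i
    have h2 := OnePoint.tendsto_coe_infty (X := ℂ) h1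
    rw [coclosedCompact_eq_cocompact, ← Metric.cobounded_eq_cocompact] at h2
    obtain ⟨R₁, -, h3⟩ := Filter.hasBasis_cobounded_norm.mem_iff.1 (Filter.mem_map.1 h2)
    exact ⟨R₁, fun u hu => not_lt.1 fun h => h3 h.le hu⟩
  obtain ⟨m₁, hm₁⟩ := eventually_atTop.1
    ((hlim.eventually_gt_atTop R).and (hlim.eventually_gt_atTop (2 * R₁)))
  refine ⟨F, m₁, fun y hy => hFY hy, fun m hm z hz => ?_⟩
  obtain ⟨hmR, hmR₁⟩ := hm₁ m hm
  have hpos : 0 < c * Λ ^ m := by positivity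
  have hnear : ∀ t ∈ T m, (t : OnePoint ℂ) ∈ nearSet OnePoint.infty (2 / (c * Λ ^ m)) := by
    intro t ht
    rw [mem_nearSet_infty]
    intro u hu
    obtain rfl := OnePoint.coe_injective hu
    have := hgrow m t ht
    rw [inv_div]
    linarith
  -- `l` is the first entrance time
  obtain ⟨t, ht, hzt⟩ := Nat.find_spec hz
  have hmin := fun i => Nat.find_min hz (m := i)
  set l := Nat.find hz
  by_cases hl : l ≤ L
  · exact Or.inl ⟨l, hl, hzt ▸ hnear t ht⟩
  right
  obtain ⟨i, hi⟩ : ∃ i, l = L + 1 + i := Nat.exists_eq_add_of_le (by omega)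
  have hlne : (newtonMap p)^[l] z ≠ OnePoint.infty := hzt ▸ OnePoint.coe_ne_infty t
  obtain ⟨x, hx⟩ := OnePoint.ne_infty_iff_exists.1
    (iterate_ne_infty_of_le (i := L + i) (by omega) hlne)
  obtain ⟨w, hw⟩ := OnePoint.ne_infty_iff_exists.1 (iterate_ne_infty_of_le (i := i) (by omega) hlne)
  have hNx : newtonMap p x = t := by
    rw [hx, ← Function.iterate_succ_apply' (newtonMap p), ← hzt]; congr 2; omega
  have hLw : (newtonMap p)^[L] w = x := by rw [hw, hx, Function.iterate_add_apply]
  have hL1w : (newtonMap p)^[L + 1] w = t := by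
    rw [Function.iterate_succ_apply', hLw, hNx]
  -- by injectivity near `∞`, a point of the orbit near `∞` would already belong to `T m`
  have hxD : (x : OnePoint ℂ) ∉ D₀ := by
    intro hxD
    have hxR : R < ‖x‖ := by
      have := mem_nearSet_infty.1 hxD x rfl
      rwa [inv_inv] at this
    obtain ⟨t', ht', htt⟩ := hback m t ht
    have ht'R : R < ‖t'‖ := by
      refine hmR.trans_le ?_
      exact hgrow m t' (hT m ht')
    obtain rfl := hinj x t' hxR ht'R (hNx.trans htt.symm)
    exact hmin (L + i) (by omega) ⟨x, hT m ht', hx.symm⟩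
  have hwK : (w : OnePoint ℂ) ∈ K := by
    change (newtonMap p)^[L] w ∉ D₀; rwa [hLw]
  have hwB : (w : OnePoint ℂ) ∈ ⋃ y ∈ (F : Set ℂ), B y := by
    by_contra hwB
    have h1 := hR₁ t ⟨w, ⟨hwK, hwB⟩, hL1w⟩
    have h2 := hgrow m t ht
    have : 0 ≤ ‖t‖ := norm_nonneg t
    linarith
  obtain ⟨y, hy, w', hw', hww⟩ := Set.mem_iUnion₂.1 hwB
  obtain rfl : w' = w := OnePoint.coe_injective hww
  exact ⟨y, hy, i, w', hw.symm, hw', hL1w ▸ hnear t ht, t, ht, hL1w⟩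

/-- The area of the set of points whose orbit enters `T m` decays exponentially in `m`, if `T m`
escapes to `∞` exponentially, consists of points of basins, and is backward invariant near `∞`. -/
theorem exists_area_entering_le {p : Polynomial ℂ} (hp : 2 ≤ p.natDegree)
    (hcrit : ∀ c : ℂ, newtonMap p c ≠ OnePoint.infty → deriv (inPlane (newtonMap p)) c = 0 →
      (∃ v, p.eval v = 0 ∧ (c : OnePoint ℂ) ∈ basin (newtonMap p) v) ∨
      (Set.range fun m : ℕ => (newtonMap p)^[m] c).Finite)
    {v₀ : ℂ} (hv₀ : p.eval v₀ = 0) {T : ℕ → Set ℂ} (hT : ∀ m, T (m + 1) ⊆ T m)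
    (hbasin : ∀ m, ∀ t ∈ T m, ∃ v, p.eval v = 0 ∧ (t : OnePoint ℂ) ∈ basin (newtonMap p) v)
    {c Λ : ℝ} (hc : 0 < c) (hΛ : 1 < Λ) (hgrow : ∀ m, ∀ t ∈ T m, c * Λ ^ m ≤ ‖t‖)
    (hback : ∀ m, ∀ t ∈ T m, ∃ t' ∈ T (m + 1), newtonMap p t' = t) :
    ∃ (C q : ℝ) (m₁ : ℕ), 0 < C ∧ 0 < q ∧ q < 1 ∧ ∀ m ≥ m₁,
      sphericalArea {z : ℂ | ∃ l : ℕ, ∃ t ∈ T m, (newtonMap p)^[l] z = t} ≤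
        ENNReal.ofReal (C * q ^ m) := by
  classical
  set Cr : Set ℂ := {z | newtonMap p z ≠ OnePoint.infty ∧ deriv (inPlane (newtonMap p)) z = 0}
  have hCr : Cr.Finite := finite_setOf_deriv_eq_zero hp
  obtain ⟨L, hL⟩ := exists_landing_time (p := p) hCr
  have hex : ∀ y : ℂ, ∃ ρ : ℝ, 0 < ρ ∧ ((newtonMap p)^[L + 1] y = OnePoint.infty →
      (newtonMap p)^[L] y ≠ OnePoint.infty → v₀ ∉ Metric.ball y ρ ∧
      ∀ c ∈ Cr, ∀ (i : ℕ), ∀ w ∈ Metric.ball y ρ, (newtonMap p)^[i] c ≠ w) := fun y => by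
    by_cases h : (newtonMap p)^[L + 1] y = OnePoint.infty ∧ (newtonMap p)^[L] y ≠ OnePoint.infty
    · obtain ⟨ρ, hρ, h1⟩ := exists_postcritically_free_ball hp hCr
        (fun c hc => hcrit c hc.1 hc.2) hL hv₀ h.1 h.2
      exact ⟨ρ, hρ, fun _ _ => h1⟩
    · exact ⟨1, one_pos, fun h1 h2 => absurd ⟨h1, h2⟩ h⟩
  choose ρ hρ hρfree using hex
  obtain ⟨F, m₁, hF, hcov⟩ := exists_cover_of_entering_set hp L (fun y => ρ y / 256)
    (fun y => by have := hρ y; positivity) hT hc hΛ hgrow hback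
  set X : ℂ → ℝ → Set ℂ := fun y s => Metric.ball y (ρ y / 256) ∩
    {w : ℂ | (newtonMap p)^[L + 1] w ∈ nearSet OnePoint.infty s}
  have hXo : ∀ y s, IsOpen (X y s) := fun y s => Metric.isOpen_ball.inter
    ((isOpen_nearSet_infty s).preimage
      (((continuous_newtonMap hp).iterate (L + 1)).comp OnePoint.continuous_coe))
  -- only the discs that meet a basin matter, since `T m` consists of points of basins
  set F' := F.filter fun y => ∃ u ∈ Metric.ball y (ρ y / 256), ∃ v, p.eval v = 0 ∧
      (u : OnePoint ℂ) ∈ basin (newtonMap p) v with hF'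
  have hdecay : PowerDecay fun s =>
      (∑ l ∈ Finset.range (L + 1),
        sphericalArea {z : ℂ | (newtonMap p)^[l] z ∈ nearSet OnePoint.infty s}) +
      ∑ y ∈ F', ∑' l : ℕ, sphericalArea {z : ℂ | ∃ w ∈ X y s, (newtonMap p)^[l] z = w} := by
    refine (PowerDecay.sum _ fun l _ => powerDecay_iterate_preimage hp l _).add
      (PowerDecay.sum _ fun y hy => ?_)
    rw [hF', Finset.mem_filter] at hy
    obtain ⟨h1, h2⟩ := hρfree y (hF y hy.1).1 (hF y hy.1).2
    refine powerDecay_tsum_preimage hp hv₀ (hρ y) h1 (fun l z w hw hz => ?_) hy.2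
      (fun s => (hXo y s).measurableSet) (fun s => Set.inter_subset_left)
      ((powerDecay_iterate_preimage hp (L + 1) OnePoint.infty).mono
        fun s _ _ => measure_mono Set.inter_subset_right)
    exact deriv_ne_zero_of_postcritically_free hp (fun c hc hd i => h2 c ⟨hc, hd⟩ i w hw) hz
  obtain ⟨C, a, hC, ha, hdec⟩ := hdecay
  have hlim : Tendsto (fun m : ℕ => c * Λ ^ m) atTop atTop :=
    (tendsto_pow_atTop_atTop_of_one_lt hΛ).const_mul_atTop hc
  obtain ⟨m₂, hm₂⟩ := eventually_atTop.1 (hlim.eventually_gt_atTop 2)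
  refine ⟨C * (2 / c) ^ a, (Λ⁻¹) ^ a, max m₁ m₂, by positivity, by positivity,
    Real.rpow_lt_one (by positivity) (inv_lt_one_of_one_lt₀ hΛ) ha, fun m hm => ?_⟩
  have hΛm : 0 < c * Λ ^ m := by positivity
  have hs1 : 2 / (c * Λ ^ m) < 1 := (div_lt_one hΛm).2 (hm₂ m (le_trans (le_max_right _ _) hm))
  have hpow : C * (2 / c) ^ a * ((Λ⁻¹) ^ a) ^ m = C * (2 / (c * Λ ^ m)) ^ a := by
    rw [mul_assoc, ← Real.rpow_natCast ((Λ⁻¹) ^ a), ← Real.rpow_mul (by positivity), mul_comm a,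
      Real.rpow_mul (by positivity), Real.rpow_natCast, ← Real.mul_rpow (by positivity)
      (by positivity), inv_pow, ← div_eq_mul_inv, div_div]
  rw [hpow]
  refine le_trans ?_ (hdec _ (by positivity) hs1)
  have hsub : {z : ℂ | ∃ l : ℕ, ∃ t ∈ T m, (newtonMap p)^[l] z = t} ⊆
      (⋃ l ∈ Finset.range (L + 1),
        {z : ℂ | (newtonMap p)^[l] z ∈ nearSet OnePoint.infty (2 / (c * Λ ^ m))}) ∪
      ⋃ y ∈ F', ⋃ l : ℕ, {z : ℂ | ∃ w ∈ X y (2 / (c * Λ ^ m)), (newtonMap p)^[l] z = w} := by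
    intro z hz
    rcases hcov m (le_trans (le_max_left _ _) hm) z hz with
      ⟨l, hl, h⟩ | ⟨y, hy, l, w, hlw, hwy, hwn, t, ht, hwt⟩
    · exact Or.inl (Set.mem_biUnion
        (Finset.mem_coe.2 (Finset.mem_range.2 (Nat.lt_succ_of_le hl))) h)
    · right
      obtain ⟨v, hv, htv⟩ := hbasin m t ht
      rw [← hwt, iterate_mem_basin_iff hp hv] at htv
      exact Set.mem_biUnion (Finset.mem_coe.2 (Finset.mem_filter.2 ⟨hy, w, hwy, v, hv, htv⟩))
        (Set.mem_iUnion.2 ⟨l, w, ⟨hwy, hwn⟩, hlw⟩)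
  refine (measure_mono hsub).trans ((measure_union_le _ _).trans (add_le_add ?_ ?_))
  · exact measure_biUnion_finset_le _ _
  · exact (measure_biUnion_finset_le _ _).trans (Finset.sum_le_sum fun y _ => measure_iUnion_le _)

/-! ### Proper self-maps of the disc with a single zero of `f - f 0` -/

/-- The identity behind the fact that `(w - b) / (1 - b w)` maps the disc to itself and the circle
to the circle. -/
theorem normSq_one_sub_mul_sub (b : ℝ) (w : ℂ) :
    ‖1 - b * w‖ ^ 2 - ‖w - b‖ ^ 2 = (1 - b ^ 2) * (1 - ‖w‖ ^ 2) := by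
  simp only [← Complex.normSq_eq_norm_sq, Complex.normSq_apply]
  simp
  ring

theorem one_add_mul_ne_zero {b : ℝ} (hb0 : 0 < b) (hb1 : b < 1) {w : ℂ} (hw : ‖w‖ ≤ 1) :
    1 + (b : ℂ) * w ≠ 0 := by
  intro h
  have h1 : ‖(b : ℂ) * w‖ = 1 := by
    rw [eq_neg_of_add_eq_zero_right h]; simp
  rw [norm_mul, Complex.norm_real, Real.norm_of_nonneg hb0.le] at h1
  nlinarith [norm_nonneg w]

theorem one_sub_mul_ne_zero {b : ℝ} (hb0 : 0 < b) (hb1 : b < 1) {w : ℂ} (hw : ‖w‖ ≤ 1) :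
    1 - (b : ℂ) * w ≠ 0 := by
  have := one_add_mul_ne_zero hb0 hb1 (w := -w) (by simpa using hw)
  rwa [mul_neg, ← sub_eq_add_neg] at this

/-- A holomorphic function on the disc whose modulus is at most `1` in the limit at the boundary
is bounded by `1`. -/
theorem norm_le_one_of_boundary {h : ℂ → ℂ} (hh : DifferentiableOn ℂ h (Metric.ball 0 1))
    (hlim : ∀ ε > 0, ∃ r : ℝ, r < 1 ∧ ∀ z ∈ Metric.ball (0 : ℂ) 1, r < ‖z‖ → ‖h z‖ ≤ 1 + ε) {z : ℂ}
    (hz : z ∈ Metric.ball (0 : ℂ) 1) : ‖h z‖ ≤ 1 := by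
  refine le_of_forall_pos_le_add fun ε hε => ?_
  obtain ⟨r, hr, hrh⟩ := hlim ε hε
  rw [mem_ball_zero_iff] at hz
  obtain ⟨s, hs, hs1⟩ := exists_between (max_lt hr hz)
  have hs0 : 0 < s := (norm_nonneg z).trans_lt ((le_max_right _ _).trans_lt hs)
  refine Complex.norm_le_of_forall_mem_frontier_norm_le (U := Metric.ball 0 s) Metric.isBounded_ball
    ⟨hh.mono (Metric.ball_subset_ball hs1.le), ?_⟩ (fun w hw => ?_)
    (subset_closure (mem_ball_zero_iff.2 ((le_max_right _ _).trans_lt hs)))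
  · rw [closure_ball _ hs0.ne']
    exact hh.continuousOn.mono (Metric.closedBall_subset_ball hs1)
  · rw [frontier_ball _ hs0.ne', mem_sphere_zero_iff_norm] at hw
    exact hrh w (mem_ball_zero_iff.2 (hw ▸ hs1)) (hw ▸ (le_max_left _ _).trans_lt hs)

/-- A proper holomorphic self-map of the disc for which `f - f 0` has its only zero at `0` is, up to
a unimodular factor, a Blaschke product `(z^k + b) / (1 + b z^k)`. -/
theorem exists_unimodular_of_proper {f : ℂ → ℂ} {b : ℝ} {k : ℕ} (hb0 : 0 < b)
    (hf : DifferentiableOn ℂ f (Metric.ball 0 1))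
    (hmaps : Set.MapsTo f (Metric.ball 0 1) (Metric.ball 0 1))
    (hproper : ∀ q < 1, ∃ q' : ℝ, q' < 1 ∧ ∀ z ∈ Metric.ball (0 : ℂ) 1, ‖f z‖ ≤ q → ‖z‖ ≤ q')
    (hf0 : f 0 = b) (huniq : ∀ z ∈ Metric.ball (0 : ℂ) 1, f z = b → z = 0)
    {g : ℂ → ℂ} (hg : AnalyticAt ℂ g 0) (hg0 : g 0 ≠ 0)
    (hfg : ∀ᶠ z in 𝓝 0, f z - b = z ^ k * g z) :
    b < 1 ∧ ∃ ω : ℂ, ‖ω‖ = 1 ∧ ∀ z ∈ Metric.ball (0 : ℂ) 1,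
      f z = (ω * z ^ k + b) / (1 + b * (ω * z ^ k)) := by
  have hb1 : b < 1 := by
    have := hmaps (Metric.mem_ball_self one_pos)
    rwa [hf0, mem_ball_zero_iff, Complex.norm_real, Real.norm_of_nonneg hb0.le] at this
  refine ⟨hb1, ?_⟩
  have hnorm : ∀ z ∈ Metric.ball (0 : ℂ) 1, ‖f z‖ < 1 := fun z hz => mem_ball_zero_iff.1 (hmaps hz)
  have hden : ∀ z ∈ Metric.ball (0 : ℂ) 1, 1 - (b : ℂ) * f z ≠ 0 := fun z hz =>
    one_sub_mul_ne_zero hb0 hb1 (hnorm z hz).le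
  set F : ℂ → ℂ := fun z => (f z - b) / (1 - b * f z) with hF
  set h : ℂ → ℂ := fun z => if z = 0 then g 0 / (1 - b * b) else F z / z ^ k with hh
  have hFd : DifferentiableOn ℂ F (Metric.ball 0 1) :=
    (hf.sub (differentiableOn_const _)).div
      ((differentiableOn_const _).sub (hf.const_mul _)) hden
  have hF1 : ∀ z ∈ Metric.ball (0 : ℂ) 1,
      1 - ‖F z‖ ^ 2 = (1 - b ^ 2) * (1 - ‖f z‖ ^ 2) / ‖1 - b * f z‖ ^ 2 := fun z hz => by
    have := norm_pos_iff.2 (hden z hz)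
    simp only [hF]
    rw [norm_div, ← normSq_one_sub_mul_sub, div_pow, sub_div, div_self (pow_pos this 2).ne']
  have hFlt : ∀ z ∈ Metric.ball (0 : ℂ) 1, ‖F z‖ < 1 := fun z hz => by
    have h1 := hF1 z hz
    have h2 := norm_pos_iff.2 (hden z hz)
    have h3 := hnorm z hz
    have h4 : 0 < (1 - b ^ 2) * (1 - ‖f z‖ ^ 2) / ‖1 - b * f z‖ ^ 2 := by
      apply div_pos (mul_pos (by nlinarith) (by nlinarith [norm_nonneg (f z)])) (by positivity)
    nlinarith [norm_nonneg (F z)]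
  have hF_ne : ∀ z ∈ Metric.ball (0 : ℂ) 1, z ≠ 0 → F z ≠ 0 := fun z hz hz0 =>
    div_ne_zero (fun h => hz0 (huniq z hz (sub_eq_zero.1 h))) (hden z hz)
  have hhd : DifferentiableOn ℂ h (Metric.ball 0 1) := by
    intro z hz
    apply DifferentiableAt.differentiableWithinAt
    have hfz : DifferentiableAt ℂ f z := hf.differentiableAt (Metric.isOpen_ball.mem_nhds hz)
    by_cases hz0 : z = 0
    · subst hz0
      have h1 : h =ᶠ[𝓝 0] fun z => g z / (1 - b * f z) := by
        filter_upwards [hfg] with w hw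
        by_cases hw0 : w = 0
        · simp [hh, hw0, hf0]
        · simp only [hh, hw0, if_false, hF, hw]
          field_simp
      refine (DifferentiableAt.div hg.differentiableAt ?_ (hden 0 hz)).congr_of_eventuallyEq h1
      exact (differentiableAt_const _).sub (hfz.const_mul _)
    · have h1 : h =ᶠ[𝓝 z] fun z => F z / z ^ k := by
        filter_upwards [eventually_ne_nhds hz0] with w hw
        simp [hh, hw]
      exact ((hFd.differentiableAt (Metric.isOpen_ball.mem_nhds hz)).div
        (differentiableAt_id.pow k) (pow_ne_zero _ hz0)).congr_of_eventuallyEq h1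
  have hh_ne : ∀ z ∈ Metric.ball (0 : ℂ) 1, h z ≠ 0 := fun z hz => by
    by_cases hz0 : z = 0
    · have : (1 : ℂ) - b * b ≠ 0 := by rw [← hf0]; simpa [hf0] using hden 0 (by simp)
      simp only [hh, hz0, if_true]
      exact div_ne_zero hg0 this
    · simp only [hh, hz0, if_false]
      exact div_ne_zero (hF_ne z hz hz0) (pow_ne_zero _ hz0)
  -- `|F|` and `|z|^k` both tend to `1` at the boundary
  have hbd : ∀ δ > 0, ∃ r : ℝ, 0 ≤ r ∧ r < 1 ∧ ∀ z ∈ Metric.ball (0 : ℂ) 1, r < ‖z‖ →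
      1 - δ < ‖F z‖ ∧ 1 - δ < ‖z‖ ^ k := fun δ hδ => by
    set q : ℝ := 1 - δ * (1 - b) / 4
    have hq : q < 1 := by
      have : 0 < δ * (1 - b) / 4 := by have := sub_pos.2 hb1; positivity
      simp only [q]; linarith
    obtain ⟨q', hq', hqq⟩ := hproper q hq
    have hk : ∀ᶠ x : ℝ in 𝓝 1, 1 - δ < x ^ k := by
      have : ContinuousAt (fun x : ℝ => x ^ k) 1 := by fun_prop
      exact this.eventually_const_lt (by simpa using hδ)
    obtain ⟨r₀, hr₀, hr₀k⟩ := exists_Ioc_subset_of_mem_nhds hk ⟨0, one_pos⟩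
    refine ⟨max 0 (max q' r₀), le_max_left _ _, by simp [hq', hr₀], fun z hz hzr => ⟨?_, ?_⟩⟩
    · have h1 : q < ‖f z‖ := by
        by_contra hle
        have := hqq z hz (not_lt.1 hle)
        have := (le_max_left q' r₀).trans (le_max_right 0 (max q' r₀))
        linarith
      have h2 : 1 - b ≤ ‖1 - b * f z‖ := by
        have h3 := norm_sub_norm_le (1 : ℂ) (b * f z)
        rw [norm_one, norm_mul, Complex.norm_real, Real.norm_of_nonneg hb0.le] at h3
        nlinarith [hnorm z hz]
      have h3 := hF1 z hz
      have hkey : (1 - b ^ 2) * (1 - ‖f z‖ ^ 2) / ‖1 - b * f z‖ ^ 2 < δ := by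
          rw [div_lt_iff₀ (pow_pos ((sub_pos.2 hb1).trans_le h2) 2)]
          have h5 : 1 - ‖f z‖ ^ 2 < δ * (1 - b) / 2 := by
            have := hnorm z hz
            simp only [q] at h1
            nlinarith [norm_nonneg (f z)]
          have h6 : (1 - b) ^ 2 ≤ ‖1 - b * f z‖ ^ 2 := by
            have := sub_pos.2 hb1
            gcongr
          have h7 : (1 - b ^ 2) * (1 - ‖f z‖ ^ 2) < (1 - b ^ 2) * (δ * (1 - b) / 2) :=
            mul_lt_mul_of_pos_left h5 (by nlinarith)
          have h8 : (1 - b ^ 2) * (δ * (1 - b) / 2) ≤ δ * (1 - b) ^ 2 := by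
            have h9 : δ * (1 - b) ^ 2 - (1 - b ^ 2) * (δ * (1 - b) / 2) =
              δ * (1 - b) ^ 2 * ((1 - b) / 2) := by ring
            have : 0 ≤ δ * (1 - b) ^ 2 * ((1 - b) / 2) := by have := sub_pos.2 hb1; positivity
            linarith
          nlinarith
      have := hFlt z hz
      nlinarith [norm_nonneg (F z), hkey]
    · have h1 : r₀ < ‖z‖ := ((le_max_right q' r₀).trans (le_max_right 0 _)).trans_lt hzr
      exact hr₀k ⟨h1, (mem_ball_zero_iff.1 hz).le⟩
  have hval : ∀ z : ℂ, z ≠ 0 → ‖h z‖ = ‖F z‖ / ‖z‖ ^ k := fun z hz => by simp [hh, hz]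
  have hle : ∀ z ∈ Metric.ball (0 : ℂ) 1, ‖h z‖ ≤ 1 := fun z hz => by
    refine norm_le_one_of_boundary hhd (fun ε hε => ?_) hz
    obtain ⟨r, hr0, hr1, hr⟩ := hbd (ε / (1 + ε)) (by positivity)
    refine ⟨r, hr1, fun w hw hwr => ?_⟩
    have hw0 : w ≠ 0 := norm_pos_iff.1 (hr0.trans_lt hwr)
    have h1 := (hr w hw hwr).2
    have h2 := hFlt w hw
    have h3 : 1 - ε / (1 + ε) = 1 / (1 + ε) := by field_simp; ring
    rw [h3, div_lt_iff₀ (by positivity)] at h1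
    rw [hval w hw0, div_le_iff₀ (pow_pos (norm_pos_iff.2 hw0) k)]
    linarith
  have hge : ∀ z ∈ Metric.ball (0 : ℂ) 1, ‖(h z)⁻¹‖ ≤ 1 := fun z hz => by
    refine norm_le_one_of_boundary (hhd.inv hh_ne) (fun ε hε => ?_) hz
    obtain ⟨r, hr0, hr1, hr⟩ := hbd (ε / (1 + ε)) (by positivity)
    refine ⟨r, hr1, fun w hw hwr => ?_⟩
    have hw0 : w ≠ 0 := norm_pos_iff.1 (hr0.trans_lt hwr)
    have h1 := (hr w hw hwr).1
    have h2 : ‖w‖ ^ k ≤ 1 := pow_le_one₀ (norm_nonneg w) (mem_ball_zero_iff.1 hw).le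
    have h3 : 1 - ε / (1 + ε) = 1 / (1 + ε) := by field_simp; ring
    rw [h3, div_lt_iff₀ (by positivity)] at h1
    change ‖(h w)⁻¹‖ ≤ _
    rw [norm_inv, hval w hw0, inv_div, div_le_iff₀ (norm_pos_iff.2 (hF_ne w hw hw0))]
    linarith
  have hone : ∀ z ∈ Metric.ball (0 : ℂ) 1, ‖h z‖ = 1 := fun z hz => by
    refine le_antisymm (hle z hz) ?_
    have := hge z hz
    rwa [norm_inv, inv_le_one₀ (norm_pos_iff.2 (hh_ne z hz))] at this
  have hconst : Set.EqOn h (Function.const ℂ (h 0)) (Metric.ball 0 1) :=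
    Complex.eqOn_of_isPreconnected_of_isMaxOn_norm (convex_ball _ _).isPreconnected
      Metric.isOpen_ball hhd (Metric.mem_ball_self one_pos) fun z hz => by
        simp only [Function.comp_apply, Set.mem_ofPred_eq, hone z hz,
          hone 0 (Metric.mem_ball_self one_pos), le_refl]
  refine ⟨h 0, hone 0 (Metric.mem_ball_self one_pos), fun z hz => ?_⟩
  have hFz : F z = h 0 * z ^ k := by
    have h1 := hconst hz
    simp only [Function.const_apply] at h1
    by_cases hz0 : z = 0
    · subst hz0
      have h2 := hfg.self_of_nhds
      simp only [hF]
      rw [h2, ← h1]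
      by_cases hk : k = 0
      · exfalso
        rw [hk, hf0, sub_self, pow_zero, one_mul] at h2
        exact hg0 h2.symm
      · simp [hk]
    · rw [← h1]
      simp only [hh, hz0, if_false]
      field_simp
  have hu : ‖h 0 * z ^ k‖ ≤ 1 := hFz ▸ (hFlt z hz).le
  have h5 := hden z hz
  have h6 := one_add_mul_ne_zero hb0 hb1 hu
  have h7 : F z * (1 - b * f z) = f z - b := div_mul_cancel₀ _ h5
  rw [eq_div_iff h6, ← hFz]
  linear_combination -h7

/-- The rotational factor is trivial if the fixed point has multiplier `1/2`. -/
theorem unimodular_eq_one {b : ℝ} {k : ℕ} (hb0 : 0 < b) (hb1 : b < 1) (hk : k ≠ 0) {ω α : ℂ}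
    (hω : ‖ω‖ = 1) (hα : ‖α‖ < 1) (hfix : α * (1 + b * (ω * α ^ k)) = ω * α ^ k + b)
    (hmult : (ω * α ^ k + b) * (1 + b * (ω * α ^ k)) = 2 * k * (1 - b ^ 2) * (ω * α ^ k)) :
    ω = 1 ∧ ∃ a : ℝ, 0 < a ∧ α = a := by
  set u := ω * α ^ k with hu
  have hα0 : α ≠ 0 := by
    rintro rfl
    rw [zero_pow hk, mul_zero] at hu
    rw [hu] at hfix
    simp at hfix
    exact hb0.ne (by exact_mod_cast hfix)
  have hun : ‖u‖ = ‖α‖ ^ k := by rw [hu, norm_mul, hω, one_mul, norm_pow]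
  have hαpos : 0 < ‖α‖ := norm_pos_iff.2 hα0
  have hu_le : ‖u‖ ≤ ‖α‖ := by rw [hun]; exact pow_le_of_le_one hαpos.le hα.le hk
  have hu1 : ‖u‖ < 1 := hu_le.trans_lt hα
  have hu0 : 0 < ‖u‖ := by rw [hun]; positivity
  -- the quadratic equation for `u` has real coefficients and product of roots `1`
  have hquad : b * u ^ 2 + (1 + b ^ 2 - 2 * k * (1 - b ^ 2) : ℝ) * u + b = 0 := by
    push_cast
    linear_combination hmult
  have him : u.im = 0 := by
    have h1 := congrArg Complex.im hquad
    have h2 := congrArg Complex.re hquad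
    rw [pow_two] at h1 h2
    simp only [Complex.add_im, Complex.mul_im, Complex.ofReal_re, Complex.ofReal_im,
      Complex.zero_im,
      Complex.add_re, Complex.mul_re, Complex.zero_re] at h1 h2
    have h3 : u.re ^ 2 + u.im ^ 2 < 1 := by
      have h4 : u.re ^ 2 + u.im ^ 2 = ‖u‖ ^ 2 := by
        rw [← Complex.normSq_eq_norm_sq, Complex.normSq_apply]; ring
      rw [h4]; nlinarith
    by_contra h0
    have h5 : b * (2 * u.re) + (1 + b ^ 2 - 2 * k * (1 - b ^ 2)) = 0 := by
      apply mul_right_cancel₀ h0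
      linear_combination h1
    have h6 : b * (1 - (u.re ^ 2 + u.im ^ 2)) = 0 := by
      linear_combination h2 - u.re * h5
    have : 0 < b * (1 - (u.re ^ 2 + u.im ^ 2)) := mul_pos hb0 (by linarith)
    linarith
  obtain ⟨s, hs⟩ : ∃ s : ℝ, u = s := ⟨u.re, by apply Complex.ext <;> simp [him]⟩
  have hs1 : |s| < 1 := by rwa [hs, Complex.norm_real] at hu1
  have hs0 : s ≠ 0 := by rintro rfl; rw [hs] at hu0; simp at hu0
  rw [abs_lt] at hs1
  have hden : 0 < 1 + b * s := by nlinarith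
  have hαs : α = ((s + b) / (1 + b * s) : ℝ) := by
    have : (1 + b * s : ℂ) ≠ 0 := by exact_mod_cast hden.ne'
    push_cast
    rw [eq_div_iff this, ← hs, hfix]
  have hquadR : b * s ^ 2 + (1 + b ^ 2 - 2 * k * (1 - b ^ 2)) * s + b = 0 := by
    rw [hs] at hquad; exact_mod_cast hquad
  have hpos : 0 < s := by
    by_contra hneg
    have hsneg : s < 0 := lt_of_le_of_ne (not_lt.1 hneg) hs0
    have hbs : b < -s := by
      by_contra hle
      push Not at hle
      have h1 : 0 < 2 * k * (1 - b ^ 2) := by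
        have : (0 : ℝ) < k := by exact_mod_cast Nat.pos_of_ne_zero hk
        have : 0 < 1 - b ^ 2 := by nlinarith
        positivity
      have h3 : (b + s) * (1 + b * s) = 2 * k * (1 - b ^ 2) * s := by linear_combination hquadR
      have h4 : 0 ≤ (b + s) * (1 + b * s) := mul_nonneg (by linarith) hden.le
      nlinarith
    have h2 : ‖α‖ < ‖u‖ := by
      rw [hαs, hs, Complex.norm_real, Complex.norm_real, Real.norm_eq_abs, Real.norm_eq_abs,
        abs_of_neg hsneg, abs_of_neg (div_neg_of_neg_of_pos (by linarith) hden), ← neg_div,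
        div_lt_iff₀ hden]
      have h3 : 0 < b * (1 - s ^ 2) := mul_pos hb0 (by nlinarith)
      nlinarith
    linarith
  have ha : 0 < (s + b) / (1 + b * s) := by positivity
  refine ⟨?_, _, ha, hαs⟩
  have h1 : ω = ((s / ((s + b) / (1 + b * s)) ^ k : ℝ) : ℂ) := by
    have : α ^ k ≠ 0 := pow_ne_zero _ hα0
    rw [Complex.ofReal_div, Complex.ofReal_pow, ← hαs, eq_div_iff this, ← hu, hs]
  have h2 : 0 < s / ((s + b) / (1 + b * s)) ^ k := by positivity
  rw [h1, Complex.norm_real, Real.norm_of_nonneg h2.le] at hω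
  rw [h1, hω, Complex.ofReal_one]

/-- With `b` expressed by the fixed point `x` of the Blaschke product in the disc, this inequality
says that the multiplier `k (1 - b) / (1 + b)` at the fixed point `1` exceeds `1`. -/
theorem one_add_pow_mul_one_sub_gt {x : ℝ} (hx0 : 0 < x) (hx1 : x < 1) {k : ℕ} (hk : 2 ≤ k) :
    (1 + x) * (1 - x ^ k) < k * (1 + x ^ k) * (1 - x) := by
  have hE : ∀ k : ℕ, 0 < 1 + (k + 1) * x ^ (k + 2) - (k + 2) * x ^ (k + 1) := by
    intro k
    induction k with
    | zero => norm_num; nlinarith [pow_pos (sub_pos.2 hx1) 2]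
    | succ k ih =>
      have h1 : 0 ≤ (k + 2) * x ^ (k + 1) * (1 - x) ^ 2 := by positivity
      push_cast
      have h2 : 1 + ((k : ℝ) + 1 + 1) * x ^ (k + 1 + 2) - (k + 1 + 2) * x ^ (k + 1 + 1) =
        1 + (k + 1) * x ^ (k + 2) - (k + 2) * x ^ (k + 1) +
          (k + 2) * x ^ (k + 1) * (1 - x) ^ 2 := by
        ring
      linarith
  induction k, hk using Nat.le_induction with
  | base => push_cast; nlinarith [pow_pos (sub_pos.2 hx1) 3]
  | succ k hk ih =>
    obtain ⟨m, rfl⟩ := Nat.exists_eq_add_of_le' (le_of_lt hk)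
    have h1 := mul_pos (sub_pos.2 hx1) (hE m)
    push_cast at ih ⊢
    have h2 : (m + 1 + 1) * (1 + x ^ (m + 1 + 1)) * (1 - x) - (1 + x) * (1 - x ^ (m + 1 + 1)) =
      ((m + 1) * (1 + x ^ (m + 1)) * (1 - x) - (1 + x) * (1 - x ^ (m + 1))) +
      (1 - x) * (1 + (m + 1) * x ^ (m + 2) - (m + 2) * x ^ (m + 1)) := by ring
    linarith

/-- The fixed point `1` of a Blaschke product with a fixed point inside the disc is repelling. -/
theorem one_lt_multiplierAtOne {k : ℕ} (hk : 2 ≤ k) {b a : ℝ} (hb0 : 0 < b) (ha0 : 0 < a)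
    (ha1 : a < 1) (hfix : a * (1 + b * a ^ k) = a ^ k + b) : 1 < multiplierAtOne k b := by
  have h := one_add_pow_mul_one_sub_gt ha0 ha1 hk
  have hak : a ^ (k + 1) < 1 := pow_lt_one₀ ha0.le ha1 (by omega)
  have hD : 0 < 1 - a ^ (k + 1) := by linarith
  have h1 : (1 - b) * (1 - a ^ (k + 1)) = (1 - a) * (1 + a ^ k) := by
    linear_combination hfix
  have h2 : (1 + b) * (1 - a ^ (k + 1)) = (1 + a) * (1 - a ^ k) := by
    linear_combination -hfix
  rw [multiplierAtOne, one_lt_div (by positivity)]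
  nlinarith

/-! ### The Newton map on a marked immediate basin is conjugate to a Blaschke product -/

/-- The root `v` of `p` has multiplier `1/2` for the Newton map, its immediate basin has the single
critical point `c`, which is of local degree `k` and the only preimage of its image, and `ψ` is the
normalized Riemann map of the immediate basin. -/
structure IsMarkedBasin (p : Polynomial ℂ) (v c : ℂ) (k : ℕ) (b : ℝ)
    (ψ : OpenPartialHomeomorph ℂ ℂ) : Prop where
  natDegree : 2 ≤ p.natDegree
  root : p.eval v = 0
  multiplier : deriv (inPlane (newtonMap p)) v = 1 / 2
  center_mem : (c : OnePoint ℂ) ∈ immediateBasin (newtonMap p) v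
  critical : IsCriticalPoint (newtonMap p) c
  center_maximal : ∀ x ∈ immediateBasin (newtonMap p) v,
    newtonMap p x = newtonMap p c → x = c
  center_degree : analyticOrderAt
    (fun z => inPlane (newtonMap p) z - inPlane (newtonMap p) c) c = k
  riemann : IsNormalizedRiemannMap (newtonMap p) (immediateBasin (newtonMap p) v) c b ψ

namespace IsMarkedBasin

variable {p : Polynomial ℂ} {v c : ℂ} {k : ℕ} {b : ℝ} {ψ : OpenPartialHomeomorph ℂ ℂ}

theorem mem_source (h : IsMarkedBasin p v c k b ψ) {z : ℂ} :
    z ∈ ψ.source ↔ (z : OnePoint ℂ) ∈ immediateBasin (newtonMap p) v := by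
  rw [h.riemann.source]; rfl

theorem isOpen_basin (h : IsMarkedBasin p v c k b ψ) :
    IsOpen (immediateBasin (newtonMap p) v) :=
  isOpen_immediateBasin h.natDegree h.root (h.riemann.source ▸ ψ.open_source)

theorem newtonMap_ne_infty (h : IsMarkedBasin p v c k b ψ) {z : ℂ} (hz : z ∈ ψ.source) :
    newtonMap p z ≠ OnePoint.infty :=
  ne_infty_of_mem_immediateBasin h.natDegree h.root
    (newtonMap_mem_immediateBasin h.natDegree h.root (h.mem_source.1 hz))

theorem inPlane_mem_source (h : IsMarkedBasin p v c k b ψ) {z : ℂ} (hz : z ∈ ψ.source) :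
    inPlane (newtonMap p) z ∈ ψ.source := by
  rw [h.mem_source, coe_inPlane (h.newtonMap_ne_infty hz)]
  exact newtonMap_mem_immediateBasin h.natDegree h.root (h.mem_source.1 hz)

theorem ne_zero (h : IsMarkedBasin p v c k b ψ) : p ≠ 0 := by
  have := h.natDegree
  rintro rfl
  simp at this

theorem analyticAt_inPlane (h : IsMarkedBasin p v c k b ψ) {z : ℂ} (hz : z ∈ ψ.source) :
    AnalyticAt ℂ (inPlane (newtonMap p)) z :=
  analyticAt_inPlane_newtonMap h.ne_zero (h.newtonMap_ne_infty hz)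

theorem analyticAt (h : IsMarkedBasin p v c k b ψ) {z : ℂ} (hz : z ∈ ψ.source) :
    AnalyticAt ℂ ψ z :=
  h.riemann.holomorphic.analyticAt (ψ.open_source.mem_nhds hz)

theorem mem_ball (h : IsMarkedBasin p v c k b ψ) {z : ℂ} (hz : z ∈ ψ.source) :
    ψ z ∈ Metric.ball (0 : ℂ) 1 :=
  h.riemann.target ▸ ψ.map_source hz

theorem symm_mem (h : IsMarkedBasin p v c k b ψ) {w : ℂ} (hw : w ∈ Metric.ball (0 : ℂ) 1) :
    ψ.symm w ∈ ψ.source :=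
  ψ.map_target (h.riemann.target.symm ▸ hw)

theorem apply_symm (h : IsMarkedBasin p v c k b ψ) {w : ℂ} (hw : w ∈ Metric.ball (0 : ℂ) 1) :
    ψ (ψ.symm w) = w :=
  ψ.right_inv (h.riemann.target.symm ▸ hw)

theorem deriv_ne_zero (h : IsMarkedBasin p v c k b ψ) {z : ℂ} (hz : z ∈ ψ.source) :
    deriv ψ z ≠ 0 :=
  deriv_ne_zero_of_injOn (h.analyticAt hz) (ψ.open_source.mem_nhds hz) ψ.injOn

theorem hasDerivAt_symm (h : IsMarkedBasin p v c k b ψ) {w : ℂ}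
    (hw : w ∈ Metric.ball (0 : ℂ) 1) : HasDerivAt ψ.symm (deriv ψ (ψ.symm w))⁻¹ w :=
  ψ.hasDerivAt_symm (h.riemann.target.symm ▸ hw) (h.deriv_ne_zero (h.symm_mem hw))
    (h.analyticAt (h.symm_mem hw)).differentiableAt.hasDerivAt

theorem differentiableOn_symm (h : IsMarkedBasin p v c k b ψ) :
    DifferentiableOn ℂ ψ.symm (Metric.ball 0 1) := fun _ hw =>
  (h.hasDerivAt_symm hw).differentiableAt.differentiableWithinAt

theorem symm_zero (h : IsMarkedBasin p v c k b ψ) : ψ.symm 0 = c := by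
  rw [← h.riemann.center]
  exact ψ.left_inv (h.mem_source.2 h.center_mem)

/-- The map of the disc that corresponds to the Newton map is proper. -/
theorem proper (h : IsMarkedBasin p v c k b ψ) {q : ℝ} (hq : q < 1) :
    ∃ q' : ℝ, q' < 1 ∧ ∀ z ∈ Metric.ball (0 : ℂ) 1,
      ‖ψ (inPlane (newtonMap p) (ψ.symm z))‖ ≤ q → ‖z‖ ≤ q' := by
  set Q : Set (OnePoint ℂ) := (fun z : ℂ => (z : OnePoint ℂ)) '' (ψ.symm '' Metric.closedBall 0 q)
  have hqb : Metric.closedBall (0 : ℂ) q ⊆ Metric.ball 0 1 := Metric.closedBall_subset_ball hq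
  have hQ : IsCompact Q := ((isCompact_closedBall _ _).image_of_continuousOn
    (h.differentiableOn_symm.continuousOn.mono hqb)).image OnePoint.continuous_coe
  have hQA : Q ⊆ immediateBasin (newtonMap p) v := by
    rintro _ ⟨_, ⟨w, hw, rfl⟩, rfl⟩
    exact h.mem_source.1 (h.symm_mem (hqb hw))
  set Z := closure (immediateBasin (newtonMap p) v) ∩ newtonMap p ⁻¹' Q
  have hZ : IsCompact Z :=
    (isClosed_closure.inter (hQ.isClosed.preimage (continuous_newtonMap h.natDegree))).isCompact
  have hZA : Z ⊆ immediateBasin (newtonMap p) v := fun x hx =>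
    mem_immediateBasin_of_mem_closure h.natDegree h.root hx.1
      ((newtonMap_mem_basin_iff h.natDegree h.root x).1 (immediateBasin_subset _ _ (hQA hx.2)))
  have hZc : IsCompact ((fun z : ℂ => (z : OnePoint ℂ)) ⁻¹' Z) := by
    refine OnePoint.isOpenEmbedding_coe.isInducing.isCompact_preimage' hZ fun x hx => ?_
    exact OnePoint.ne_infty_iff_exists.1
      (ne_infty_of_mem_immediateBasin h.natDegree h.root (hZA hx))
  have himg : IsCompact (ψ '' ((fun z : ℂ => (z : OnePoint ℂ)) ⁻¹' Z)) :=
    hZc.image_of_continuousOn (h.riemann.holomorphic.continuousOn.mono fun z hz =>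
      h.mem_source.2 (hZA hz))
  have hsub : ψ '' ((fun z : ℂ => (z : OnePoint ℂ)) ⁻¹' Z) ⊆ Metric.ball 0 1 := by
    rintro _ ⟨z, hz, rfl⟩
    exact h.mem_ball (h.mem_source.2 (hZA hz))
  obtain ⟨q', hq', hsub'⟩ := exists_lt_subset_ball himg.isClosed hsub
  refine ⟨q', hq', fun z hz hzq => ?_⟩
  have hzs := h.symm_mem hz
  have hmem : z ∈ ψ '' ((fun z : ℂ => (z : OnePoint ℂ)) ⁻¹' Z) := by
    refine ⟨ψ.symm z, ⟨subset_closure (h.mem_source.1 hzs), ?_⟩, h.apply_symm hz⟩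
    refine ⟨inPlane (newtonMap p) (ψ.symm z), ⟨_, mem_closedBall_zero_iff.2 hzq, ?_⟩,
      coe_inPlane (h.newtonMap_ne_infty hzs)⟩
    exact ψ.left_inv (h.inPlane_mem_source hzs)
  exact (mem_ball_zero_iff.1 (hsub' hmem)).le

/-- A critical point has local degree at least two. -/
theorem two_le (h : IsMarkedBasin p v c k b ψ) : 2 ≤ k := by
  have hc := h.analyticAt_inPlane (h.mem_source.2 h.center_mem)
  have hd : deriv (inPlane (newtonMap p)) c = 0 := by
    by_contra hd
    obtain ⟨U, hU, hinj⟩ := exists_injOn_nhds hc hd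
    have hne := (continuous_newtonMap h.natDegree).comp OnePoint.continuous_coe
    refine h.critical ((fun z : ℂ => (z : OnePoint ℂ)) '' U) ?_ ?_
    · rw [OnePoint.nhds_coe_eq]; exact image_mem_map hU
    · rintro _ ⟨z, hz, rfl⟩ _ ⟨w, hw, rfl⟩ hzw
      exact congrArg _ (hinj hz hw (congrArg toPlane hzw))
  obtain ⟨g, hg, hg0, hfg⟩ := ((hc.sub analyticAt_const).analyticOrderAt_eq_natCast (n := k)).1
    h.center_degree
  by_contra hk
  have hk : k = 0 ∨ k = 1 := by omega
  rcases hk with rfl | rfl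
  · have := hfg.self_of_nhds
    simp at this
    exact hg0 this.symm
  · have h1 : HasDerivAt (fun z => (z - c) ^ 1 • g z) (g c) c := by
      have := ((hasDerivAt_id c).sub_const c).mul hg.differentiableAt.hasDerivAt
      simpa using! this
    have h2 : deriv (fun z => inPlane (newtonMap p) z - inPlane (newtonMap p) c) c = g c := by
      exact (Filter.EventuallyEq.deriv_eq hfg).trans h1.deriv
    rw [deriv_sub_const, hd] at h2
    exact hg0 h2.symm

/-- The order of the Newton map at the critical point, read off in the Riemann map. -/
theorem exists_local_form (h : IsMarkedBasin p v c k b ψ) :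
    ∃ g : ℂ → ℂ, AnalyticAt ℂ g 0 ∧ g 0 ≠ 0 ∧
      ∀ᶠ w in 𝓝 0, ψ (inPlane (newtonMap p) (ψ.symm w)) - b = w ^ k * g w := by
  have hcs := h.mem_source.2 h.center_mem
  have hc := h.analyticAt_inPlane hcs
  obtain ⟨g, hg, hg0, hfg⟩ := ((hc.sub analyticAt_const).analyticOrderAt_eq_natCast (n := k)).1
    h.center_degree
  have h0 : (0 : ℂ) ∈ Metric.ball (0 : ℂ) 1 := Metric.mem_ball_self one_pos
  set y := inPlane (newtonMap p) c
  have hys : y ∈ ψ.source := h.inPlane_mem_source hcs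
  have hsymm : AnalyticAt ℂ ψ.symm 0 :=
    h.differentiableOn_symm.analyticAt (Metric.isOpen_ball.mem_nhds h0)
  have hd1 : AnalyticAt ℂ (dslope ψ y) y :=
    ((Complex.differentiableOn_dslope (ψ.open_source.mem_nhds hys)).2
      h.riemann.holomorphic).analyticAt (ψ.open_source.mem_nhds hys)
  have hd2 : AnalyticAt ℂ (dslope ψ.symm 0) 0 :=
    ((Complex.differentiableOn_dslope (Metric.isOpen_ball.mem_nhds h0)).2
      h.differentiableOn_symm).analyticAt (Metric.isOpen_ball.mem_nhds h0)
  have hcomp : AnalyticAt ℂ (fun w => inPlane (newtonMap p) (ψ.symm w)) 0 :=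
    AnalyticAt.fun_comp (by rw [h.symm_zero]; exact hc) hsymm
  refine ⟨fun w => dslope ψ.symm 0 w ^ k * g (ψ.symm w) *
    dslope ψ y (inPlane (newtonMap p) (ψ.symm w)), ?_, ?_, ?_⟩
  · refine ((hd2.pow k).mul (AnalyticAt.fun_comp (by rw [h.symm_zero]; exact hg) hsymm)).mul ?_
    exact AnalyticAt.fun_comp (f := fun w => inPlane (newtonMap p) (ψ.symm w))
      (by rw [h.symm_zero]; exact hd1) hcomp
  · have h1 : inPlane (newtonMap p) c = y := rfl
    simp only [h.symm_zero, dslope_same, h1]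
    refine mul_ne_zero (mul_ne_zero (pow_ne_zero _ ?_) hg0) (h.deriv_ne_zero hys)
    rw [(h.hasDerivAt_symm h0).deriv]
    exact inv_ne_zero (h.deriv_ne_zero (h.symm_mem h0))
  · have hcont : Tendsto ψ.symm (𝓝 0) (𝓝 c) := by
      have := hsymm.continuousAt.tendsto
      rwa [h.symm_zero] at this
    filter_upwards [hcont.eventually hfg] with w hw
    have h1 := sub_smul_dslope ψ y (inPlane (newtonMap p) (ψ.symm w))
    have h2 := sub_smul_dslope ψ.symm 0 w
    rw [h.symm_zero, sub_zero] at h2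
    have h3 : inPlane (newtonMap p) (ψ.symm w) - y = (ψ.symm w - c) ^ k * g (ψ.symm w) := hw
    simp only [smul_eq_mul] at h1 h2
    rw [h.riemann.value] at h1
    rw [← h1, h3, ← h2]
    ring

/-- The Riemann map conjugates the Newton map to the Blaschke product with the same `k` and `b`, and
the fixed point corresponds to a positive number. The rotational factor that a proper map with a
single multiple preimage of `b` could have is excluded by the multiplier `1/2`. -/
theorem exists_conj (h : IsMarkedBasin p v c k b ψ) :
    b < 1 ∧ (∃ a : ℝ, 0 < a ∧ ψ v = a) ∧
      ∀ z ∈ ψ.source, ψ (inPlane (newtonMap p) z) = blaschke k b (ψ z) := by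
  have hb0 := h.riemann.value_pos
  set f : ℂ → ℂ := fun w => ψ (inPlane (newtonMap p) (ψ.symm w)) with hf
  have hmaps : Set.MapsTo f (Metric.ball 0 1) (Metric.ball 0 1) := fun w hw =>
    h.mem_ball (h.inPlane_mem_source (h.symm_mem hw))
  have hfd : DifferentiableOn ℂ f (Metric.ball 0 1) := fun w hw => by
    apply DifferentiableAt.differentiableWithinAt
    exact (h.analyticAt (h.inPlane_mem_source (h.symm_mem hw))).differentiableAt.comp w
      ((h.analyticAt_inPlane (h.symm_mem hw)).differentiableAt.comp w
        (h.hasDerivAt_symm hw).differentiableAt)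
  have hf0 : f 0 = b := by simp only [hf, h.symm_zero, h.riemann.value]
  have huniq : ∀ z ∈ Metric.ball (0 : ℂ) 1, f z = b → z = 0 := fun z hz hzb => by
    have hzs := h.symm_mem hz
    have hcs := h.mem_source.2 h.center_mem
    have h1 : inPlane (newtonMap p) (ψ.symm z) = inPlane (newtonMap p) c :=
      ψ.injOn (h.inPlane_mem_source hzs) (h.inPlane_mem_source hcs)
        (hzb.trans h.riemann.value.symm)
    have h2 : newtonMap p (ψ.symm z) = newtonMap p c := by
      rw [← coe_inPlane (h.newtonMap_ne_infty hzs), h1, coe_inPlane (h.newtonMap_ne_infty hcs)]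
    have h3 := OnePoint.coe_injective (h.center_maximal _ (h.mem_source.1 hzs) h2)
    rw [← h.apply_symm hz, h3, h.riemann.center]
  obtain ⟨g, hg, hg0, hfg⟩ := h.exists_local_form
  obtain ⟨hb1, ω, hω, hform⟩ := exists_unimodular_of_proper hb0 hfd hmaps
    (fun q hq => h.proper hq) hf0 huniq hg hg0 hfg
  have hvs : v ∈ ψ.source := h.mem_source.2 (mem_immediateBasin_self h.natDegree h.root)
  have hNv : inPlane (newtonMap p) v = v := by
    rw [inPlane, newtonMap_root h.root, toPlane_coe]
  set α := ψ v with hα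
  have hαb : α ∈ Metric.ball (0 : ℂ) 1 := h.mem_ball hvs
  have hαsymm : ψ.symm α = v := ψ.left_inv hvs
  have hfα : f α = α := by simp only [hf, hαsymm, hNv]; rfl
  have hk := h.two_le
  have hu : ‖ω * α ^ k‖ ≤ 1 := by
    rw [norm_mul, hω, one_mul, norm_pow]
    exact pow_le_one₀ (norm_nonneg _) (mem_ball_zero_iff.1 hαb).le
  have hden := one_add_mul_ne_zero hb0 hb1 hu
  -- the multiplier of `f` at `α` is that of the Newton map at `v`
  have hd1 : HasDerivAt f (1 / 2) α := by
    have e1 : HasDerivAt ψ.symm (deriv ψ v)⁻¹ α := by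
      have := h.hasDerivAt_symm hαb; rwa [hαsymm] at this
    have e2 : HasDerivAt (inPlane (newtonMap p)) (1 / 2) (ψ.symm α) := by
      rw [hαsymm, ← h.multiplier]
      exact (h.analyticAt_inPlane hvs).differentiableAt.hasDerivAt
    have e3 : HasDerivAt ψ (deriv ψ v) (inPlane (newtonMap p) (ψ.symm α)) := by
      rw [hαsymm, hNv]; exact (h.analyticAt hvs).differentiableAt.hasDerivAt
    have e4 := HasDerivAt.comp α e3 (HasDerivAt.comp α e2 e1)
    have e5 : deriv ψ v * (1 / 2 * (deriv ψ v)⁻¹) = 1 / 2 := by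
      have := h.deriv_ne_zero hvs
      field_simp
    rw [e5] at e4
    exact e4
  have hd2 : HasDerivAt f (((ω * (k * α ^ (k - 1))) * (1 + b * (ω * α ^ k)) -
      (ω * α ^ k + b) * (b * (ω * (k * α ^ (k - 1))))) / (1 + b * (ω * α ^ k)) ^ 2) α := by
    have e1 : HasDerivAt (fun z : ℂ => ω * z ^ k) (ω * (k * α ^ (k - 1))) α :=
      (hasDerivAt_pow k α).const_mul ω
    have e2 := (e1.add_const (b : ℂ)).div ((e1.const_mul (b : ℂ)).const_add 1) hden
    refine e2.congr_of_eventuallyEq ?_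
    filter_upwards [Metric.isOpen_ball.mem_nhds hαb] with z hz using hform z hz
  have hd := hd1.unique hd2
  have hfix : α * (1 + b * (ω * α ^ k)) = ω * α ^ k + b := by
    rw [← eq_div_iff hden, ← hform α hαb, hfα]
  have hmult : (ω * α ^ k + b) * (1 + b * (ω * α ^ k)) = 2 * k * (1 - b ^ 2) * (ω * α ^ k) := by
    have hαk : α ^ k = α ^ (k - 1) * α := by rw [← pow_succ]; congr 1; omega
    rw [eq_div_iff (pow_ne_zero 2 hden)] at hd
    have e1 : 1 / 2 * (1 + b * (ω * α ^ k)) ^ 2 * α =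
        ω * (k * α ^ (k - 1)) * (1 - b ^ 2) * α := by
      rw [hd]; ring
    have e2 : ω * (k * α ^ (k - 1)) * (1 - b ^ 2) * α = k * (1 - b ^ 2) * (ω * α ^ k) := by
      rw [hαk]; ring
    linear_combination 2 * e1 + 2 * e2 - (1 + b * (ω * α ^ k)) * hfix
  obtain ⟨hω1, ha⟩ := unimodular_eq_one hb0 hb1 (by omega) hω (mem_ball_zero_iff.1 hαb) hfix hmult
  refine ⟨hb1, ha, fun z hz => ?_⟩
  have h1 := hform (ψ z) (h.mem_ball hz)
  simp only [hf, ψ.left_inv hz, hω1, one_mul] at h1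
  rw [h1, blaschke]

theorem conj (h : IsMarkedBasin p v c k b ψ) {z : ℂ} (hz : z ∈ ψ.source) :
    ψ (inPlane (newtonMap p) z) = blaschke k b (ψ z) := h.exists_conj.2.2 z hz

theorem lt_one (h : IsMarkedBasin p v c k b ψ) : b < 1 := h.exists_conj.1

theorem blaschke_mem_ball (h : IsMarkedBasin p v c k b ψ) {w : ℂ}
    (hw : w ∈ Metric.ball (0 : ℂ) 1) : blaschke k b w ∈ Metric.ball (0 : ℂ) 1 := by
  have := h.conj (h.symm_mem hw)
  rw [h.apply_symm hw] at this
  rw [← this]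
  exact h.mem_ball (h.inPlane_mem_source (h.symm_mem hw))

theorem symm_conj (h : IsMarkedBasin p v c k b ψ) {w : ℂ} (hw : w ∈ Metric.ball (0 : ℂ) 1) :
    newtonMap p (ψ.symm w) = ψ.symm (blaschke k b w) := by
  have h1 := h.symm_mem hw
  have h2 := h.conj h1
  rw [h.apply_symm hw] at h2
  rw [← h2, ψ.left_inv (h.inPlane_mem_source h1), coe_inPlane (h.newtonMap_ne_infty h1)]

theorem iterate_blaschke_mem_ball (h : IsMarkedBasin p v c k b ψ) {w : ℂ}
    (hw : w ∈ Metric.ball (0 : ℂ) 1) (m : ℕ) : (blaschke k b)^[m] w ∈ Metric.ball (0 : ℂ) 1 :=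
  Set.MapsTo.iterate (fun _ => h.blaschke_mem_ball) m hw

theorem iterate_symm_conj (h : IsMarkedBasin p v c k b ψ) {w : ℂ}
    (hw : w ∈ Metric.ball (0 : ℂ) 1) (m : ℕ) :
    (newtonMap p)^[m] (ψ.symm w) = ψ.symm ((blaschke k b)^[m] w) := by
  induction m with
  | zero => rfl
  | succ m ih =>
    rw [Function.iterate_succ_apply', ih, Function.iterate_succ_apply',
      h.symm_conj (h.iterate_blaschke_mem_ball hw m)]

theorem tendsto_iterate_blaschke (h : IsMarkedBasin p v c k b ψ) {w : ℂ}
    (hw : w ∈ Metric.ball (0 : ℂ) 1) :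
    Tendsto (fun m : ℕ => (blaschke k b)^[m] w) atTop (𝓝 (ψ v)) := by
  have h1 := immediateBasin_subset _ _ (h.mem_source.1 (h.symm_mem hw))
  rw [basin_eq h.natDegree h.root] at h1
  simp only [Set.mem_ofPred_eq, h.iterate_symm_conj hw] at h1
  have h2 : Tendsto (fun m : ℕ => ψ.symm ((blaschke k b)^[m] w)) atTop (𝓝 v) :=
    (OnePoint.isOpenEmbedding_coe.tendsto_nhds_iff).2 h1
  have h3 := ((h.analyticAt (h.mem_source.2 (mem_immediateBasin_self h.natDegree
    h.root))).continuousAt.tendsto).comp h2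
  refine h3.congr fun m => ?_
  exact h.apply_symm (h.iterate_blaschke_mem_ball hw m)

theorem blaschke_fixed (h : IsMarkedBasin p v c k b ψ) : blaschke k b (ψ v) = ψ v := by
  have := h.conj (h.mem_source.2 (mem_immediateBasin_self h.natDegree h.root))
  rw [← this, inPlane, newtonMap_root h.root, toPlane_coe]

/-- The fixed point of the Blaschke product in the disc is unique. -/
theorem eq_of_blaschke_fixed (h : IsMarkedBasin p v c k b ψ) {w : ℂ}
    (hw : w ∈ Metric.ball (0 : ℂ) 1) (hfix : blaschke k b w = w) : w = ψ v := by
  have h1 := h.tendsto_iterate_blaschke hw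
  simp only [Function.iterate_fixed hfix] at h1
  exact tendsto_nhds_unique tendsto_const_nhds h1

theorem one_lt_multiplier (h : IsMarkedBasin p v c k b ψ) : 1 < multiplierAtOne k b := by
  obtain ⟨hb1, ⟨a, ha0, ha⟩, -⟩ := h.exists_conj
  have hb0 := h.riemann.value_pos
  have hball := h.mem_ball (h.mem_source.2 (mem_immediateBasin_self h.natDegree h.root))
  have hfix := h.blaschke_fixed
  rw [ha] at hball hfix
  rw [mem_ball_zero_iff, Complex.norm_real, Real.norm_of_nonneg ha0.le] at hball
  refine one_lt_multiplierAtOne h.two_le hb0 ha0 hball ?_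
  have hden : (1 + b * (a : ℂ) ^ k) ≠ 0 := by
    have : 0 < 1 + b * a ^ k := by positivity
    exact_mod_cast this.ne'
  rw [blaschke, div_eq_iff hden] at hfix
  exact_mod_cast hfix.symm

end IsMarkedBasin

/-! ### The sector at the repelling fixed point and its image near infinity -/

/-- To the first order, `|κ w|² - 1` is a positive multiple of `Re w`: the disc corresponds to the
left half-plane. -/
theorem _root_.IsLinearizer.exists_norm_sq_expansion {k : ℕ} {b r : ℝ} {κ : ℂ → ℂ}
    (h : IsLinearizer k b κ r) :
    ∃ a C δ : ℝ, 0 < a ∧ 0 < C ∧ 0 < δ ∧ δ ≤ r ∧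
      ∀ w : ℂ, ‖w‖ < δ → |‖κ w‖ ^ 2 - 1 - 2 * a * w.re| ≤ C * ‖w‖ ^ 2 := by
  obtain ⟨a, ha, hd⟩ := h.deriv_pos
  have h0 : Metric.ball (0 : ℂ) r ∈ 𝓝 (0 : ℂ) := Metric.ball_mem_nhds _ h.pos
  have hds : DifferentiableAt ℂ (dslope κ 0) 0 :=
    ((Complex.differentiableOn_dslope h0).2 h.holomorphic).differentiableAt h0
  obtain ⟨C, hC, hO⟩ := (hds.isBigO_sub).exists_pos
  obtain ⟨δ, hδ, hball⟩ := Metric.eventually_nhds_iff.1 hO.bound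
  refine ⟨a, 2 * C + (a + C) ^ 2, min (min δ 1) r, ha, by positivity,
    lt_min (lt_min hδ one_pos) h.pos, min_le_right _ _, fun w hw => ?_⟩
  have hw1 : ‖w‖ < 1 := hw.trans_le ((min_le_left _ _).trans (min_le_right _ _))
  have h1 := hball (y := w) (by
    rw [dist_zero_right]; exact hw.trans_le ((min_le_left _ _).trans (min_le_left _ _)))
  rw [dslope_same, hd, sub_zero] at h1
  have h2 := sub_smul_dslope κ 0 w
  rw [sub_zero, smul_eq_mul, h.map_zero] at h2
  set e := κ w - 1 with he
  have hκ : κ w = 1 + e := by rw [he]; ring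
  have h3 : ‖e - a * w‖ ≤ C * ‖w‖ ^ 2 := by
    have : e - a * w = w * (dslope κ 0 w - a) := by rw [← h2]; ring
    rw [this, norm_mul]
    nlinarith [norm_nonneg w]
  have h4 : ‖e‖ ≤ (a + C) * ‖w‖ := by
    have h5 : ‖e‖ ≤ ‖e - a * w‖ + ‖(a : ℂ) * w‖ := by simpa using norm_add_le (e - a * w) (a * w)
    rw [norm_mul, Complex.norm_real, Real.norm_of_nonneg ha.le] at h5
    nlinarith [norm_nonneg w, mul_nonneg hC.le (norm_nonneg w)]
  have h6 : ‖κ w‖ ^ 2 - 1 - 2 * a * w.re = 2 * (e - a * w).re + ‖e‖ ^ 2 := by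
    rw [hκ, ← Complex.normSq_eq_norm_sq, ← Complex.normSq_eq_norm_sq, Complex.normSq_apply,
      Complex.normSq_apply]
    simp
    ring
  rw [h6]
  have h7 := (Complex.abs_re_le_norm (e - a * w)).trans h3
  have h8 : ‖e‖ ^ 2 ≤ (a + C) ^ 2 * ‖w‖ ^ 2 := by
    rw [← mul_pow]; gcongr
  rw [abs_le] at h7 ⊢
  constructor <;> nlinarith [sq_nonneg ‖e‖]

/-- Near the fixed point `1`, a sector strictly inside the left half-plane corresponds to points of
the disc. -/
theorem _root_.IsLinearizer.exists_cone_subset_ball {k : ℕ} {b r : ℝ} {κ : ℂ → ℂ}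
    (h : IsLinearizer k b κ r) {σ : ℝ} (hσ : 0 < σ) :
    ∃ δ : ℝ, 0 < δ ∧ δ ≤ r ∧ ∀ w : ℂ, w ≠ 0 → ‖w‖ < δ → w.re ≤ -σ * ‖w‖ →
      κ w ∈ Metric.ball (0 : ℂ) 1 := by
  obtain ⟨a, C, δ, ha, hC, hδ, hδr, hexp⟩ := h.exists_norm_sq_expansion
  refine ⟨min δ (2 * a * σ / C), lt_min hδ (by positivity), (min_le_left _ _).trans hδr,
    fun w hw0 hwδ hre => ?_⟩
  have h1 := (abs_le.1 (hexp w (hwδ.trans_le (min_le_left _ _)))).2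
  have h2 := hwδ.trans_le (min_le_right _ _)
  rw [lt_div_iff₀ hC] at h2
  have h3 := norm_pos_iff.2 hw0
  rw [mem_ball_zero_iff]
  have h4 : ‖κ w‖ ^ 2 < 1 := by nlinarith [mul_pos h3 h3]
  nlinarith [norm_nonneg (κ w)]

theorem _root_.IsLinearizer.continuousAt_zero {k : ℕ} {b r : ℝ} {κ : ℂ → ℂ}
    (h : IsLinearizer k b κ r) : ContinuousAt κ 0 :=
  (h.holomorphic.differentiableAt (Metric.ball_mem_nhds _ h.pos)).continuousAt

/-- Points `κ (i t)` cannot all lie in the disc: the defect `1 - |κ (i t)|²` is `O(t²)`, but it is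
multiplied by about `λ` under `t ↦ λ t`. -/
theorem _root_.IsLinearizer.exists_notMem_ball_of_imaginary {k : ℕ} {b r : ℝ} {κ : ℂ → ℂ}
    (h : IsLinearizer k b κ r) (hb0 : 0 < b) (hb1 : b < 1)
    (hk : k ≠ 0) (hlam : 1 < multiplierAtOne k b) {t₀ : ℝ} (ht₀ : 0 < t₀) :
    ∃ t : ℝ, 0 < t ∧ t ≤ t₀ ∧ κ (t * Complex.I) ∉ Metric.ball (0 : ℂ) 1 := by
  by_contra hcon
  push Not at hcon
  obtain ⟨a, C, δ, ha, hC, hδ, hδr, hexp⟩ := h.exists_norm_sq_expansion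
  set lam := multiplierAtOne k b with hlamdef
  obtain ⟨μ, hμ1, hμ2⟩ := exists_between (show lam < lam ^ 2 by nlinarith)
  have hnear : ∀ᶠ z : ℂ in 𝓝 1, k * (1 - b ^ 2) / ‖1 + b * z ^ k‖ ^ 2 < μ := by
    have hval : k * (1 - b ^ 2) / ‖1 + (b : ℂ) * 1 ^ k‖ ^ 2 = lam := by
      have : ‖1 + (b : ℂ) * 1 ^ k‖ = 1 + b := by
        rw [one_pow, mul_one, ← Complex.ofReal_one, ← Complex.ofReal_add, Complex.norm_real,
          Real.norm_of_nonneg (by linarith)]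
      rw [this, hlamdef, multiplierAtOne]
      have : 1 + b ≠ 0 := by linarith
      field_simp
      ring
    have hcont : ContinuousAt (fun z : ℂ => k * (1 - b ^ 2) / ‖1 + (b : ℂ) * z ^ k‖ ^ 2) 1 := by
      refine ContinuousAt.div continuousAt_const (by fun_prop) ?_
      exact pow_ne_zero 2 (norm_ne_zero_iff.2 (one_add_mul_ne_zero hb0 hb1 (by simp)))
    exact hcont.eventually_lt_const (hval.trans_lt hμ1)
  have hκ0 := h.continuousAt_zero
  rw [ContinuousAt, h.map_zero] at hκ0
  obtain ⟨δ', hδ', hball⟩ := Metric.eventually_nhds_iff.1 (hκ0.eventually hnear)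
  obtain ⟨t₁, ht₁, ht₁'⟩ := exists_between (lt_min ht₀ (lt_min hδ hδ'))
  have hnormI : ∀ t : ℝ, 0 ≤ t → ‖(t : ℂ) * Complex.I‖ = t := fun t ht => by simp [abs_of_nonneg ht]
  have hlam0 : 0 < lam := one_pos.trans hlam
  set u : ℝ → ℝ := fun t => 1 - ‖κ (t * Complex.I)‖ ^ 2 with hu
  have hstep : ∀ t : ℝ, 0 < t → lam * t ≤ t₁ → u (lam * t) ≤ μ * u t := by
    intro t ht htt
    have htt₁ : t ≤ t₁ := by nlinarith
    have hz := mem_ball_zero_iff.1 (hcon t ht (htt₁.trans (ht₁'.le.trans (min_le_left _ _))))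
    set z := κ (t * Complex.I) with hzdef
    have h1 : κ ((lam * t : ℝ) * Complex.I) = blaschke k b z := by
      rw [hzdef, h.semiconj]
      · push_cast; rw [mul_assoc]
      · rw [hnormI t ht.le]
        linarith [ht₁'.trans_le ((min_le_right _ _).trans (min_le_left _ _))]
      · rw [norm_mul, hnormI t ht.le, Complex.norm_real, Real.norm_of_nonneg hlam0.le]
        linarith [ht₁'.trans_le ((min_le_right _ _).trans (min_le_left _ _))]
    have hzk : ‖z ^ k‖ ≤ 1 := by rw [norm_pow]; exact pow_le_one₀ (norm_nonneg _) hz.le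
    have hden := norm_pos_iff.2 (one_add_mul_ne_zero hb0 hb1 hzk)
    have h2 : 1 - ‖blaschke k b z‖ ^ 2 =
        (1 - b ^ 2) * (1 - (‖z‖ ^ 2) ^ k) / ‖1 + b * z ^ k‖ ^ 2 := by
      have h3 := normSq_one_sub_mul_sub (-b) (z ^ k)
      have h4 : ‖1 - ((-b : ℝ) : ℂ) * z ^ k‖ = ‖1 + b * z ^ k‖ := by push_cast; ring_nf
      have h5 : ‖z ^ k - ((-b : ℝ) : ℂ)‖ = ‖z ^ k + b‖ := by push_cast; ring_nf
      rw [h4, h5, neg_sq] at h3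
      have h9 : (‖z‖ ^ 2) ^ k = ‖z ^ k‖ ^ 2 := by rw [norm_pow, ← pow_mul, ← pow_mul, mul_comm]
      rw [h9, ← h3, blaschke, norm_div, div_pow, sub_div,
        div_self (pow_pos hden 2).ne']
    have h6 : 1 - (‖z‖ ^ 2) ^ k ≤ k * (1 - ‖z‖ ^ 2) := by
      have := one_add_mul_le_pow (a := ‖z‖ ^ 2 - 1) (by nlinarith [sq_nonneg ‖z‖]) k
      rw [add_sub_cancel] at this
      nlinarith
    have h7 : k * (1 - b ^ 2) / ‖1 + b * z ^ k‖ ^ 2 < μ := by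
      apply hball
      rw [dist_zero_right, hnormI t ht.le]
      exact htt₁.trans_lt (ht₁'.trans_le ((min_le_right _ _).trans (min_le_right _ _)))
    simp only [hu]
    rw [h1, h2]
    have h8 : 0 ≤ 1 - ‖z‖ ^ 2 := by nlinarith [norm_nonneg z]
    calc (1 - b ^ 2) * (1 - (‖z‖ ^ 2) ^ k) / ‖1 + b * z ^ k‖ ^ 2
        ≤ (1 - b ^ 2) * (k * (1 - ‖z‖ ^ 2)) / ‖1 + b * z ^ k‖ ^ 2 := by
          have : 0 ≤ 1 - b ^ 2 := by nlinarith
          gcongr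
      _ = k * (1 - b ^ 2) / ‖1 + b * z ^ k‖ ^ 2 * (1 - ‖z‖ ^ 2) := by ring
      _ ≤ μ * (1 - ‖z‖ ^ 2) := by gcongr
  have hμ0 : 0 < μ := hlam0.trans hμ1
  have hiter : ∀ n : ℕ, u t₁ ≤ μ ^ n * u (t₁ / lam ^ n) := by
    intro n
    induction n with
    | zero => simp
    | succ n ih =>
      have h1 := hstep (t₁ / lam ^ (n + 1)) (by positivity) (by
        have h2 : lam * (t₁ / lam ^ (n + 1)) = t₁ / lam ^ n := by rw [pow_succ]; field_simp
        rw [h2]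
        exact div_le_self ht₁.le (one_le_pow₀ hlam.le))
      have h2 : lam * (t₁ / lam ^ (n + 1)) = t₁ / lam ^ n := by rw [pow_succ]; field_simp
      rw [h2] at h1
      calc u t₁ ≤ μ ^ n * u (t₁ / lam ^ n) := ih
        _ ≤ μ ^ n * (μ * u (t₁ / lam ^ (n + 1))) := by gcongr
        _ = _ := by ring
  have hsq : ∀ t : ℝ, 0 < t → t ≤ t₁ → u t ≤ C * t ^ 2 := by
    intro t ht htt
    have h1 := (abs_le.1 (hexp (t * Complex.I) (by
      rw [hnormI t ht.le]
      exact htt.trans_lt (ht₁'.trans_le ((min_le_right _ _).trans (min_le_left _ _)))))).1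
    rw [hnormI t ht.le] at h1
    simp only [Complex.mul_re, Complex.ofReal_re, Complex.I_re, Complex.ofReal_im,
      Complex.I_im] at h1
    simp only [hu]
    linarith
  have hu1 : 0 < u t₁ := by
    have := mem_ball_zero_iff.1 (hcon t₁ ht₁ (ht₁'.le.trans (min_le_left _ _)))
    simp only [hu]
    nlinarith [norm_nonneg (κ (t₁ * Complex.I))]
  have hle : ∀ n : ℕ, u t₁ ≤ C * t₁ ^ 2 * (μ / lam ^ 2) ^ n := by
    intro n
    have h1 := hsq (t₁ / lam ^ n) (by positivity) (div_le_self ht₁.le (one_le_pow₀ hlam.le))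
    calc u t₁ ≤ μ ^ n * u (t₁ / lam ^ n) := hiter n
      _ ≤ μ ^ n * (C * (t₁ / lam ^ n) ^ 2) := by gcongr
      _ = _ := by rw [div_pow, div_pow, ← pow_mul, ← pow_mul, mul_comm 2 n]; ring
  have hlim : Tendsto (fun n : ℕ => C * t₁ ^ 2 * (μ / lam ^ 2) ^ n) atTop (𝓝 (C * t₁ ^ 2 * 0)) :=
    (tendsto_pow_atTop_nhds_zero_of_lt_one (by positivity)
      ((div_lt_one (by positivity)).2 hμ2)).const_mul _
  rw [mul_zero] at hlim
  exact absurd (ge_of_tendsto' hlim hle) (not_le.2 hu1)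

theorem mul_mem_modelQuad {lam θ : ℝ} (hlam : 0 < lam) {m : ℕ} {w : ℂ}
    (hw : w ∈ modelQuad lam θ (m + 1)) : (lam : ℂ) * w ∈ modelQuad lam θ m := by
  obtain ⟨h1, h2, h3⟩ := hw
  have hn : ‖(lam : ℂ) * w‖ = lam * ‖w‖ := by
    rw [norm_mul, Complex.norm_real, Real.norm_of_nonneg hlam.le]
  refine ⟨?_, ?_, ?_⟩
  · rw [hn]
    calc (lam ^ (m + 1))⁻¹ = lam * (lam ^ (m + 1 + 1))⁻¹ := by rw [pow_succ _ (m + 1)]; field_simp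
      _ ≤ lam * ‖w‖ := by gcongr
  · rw [hn]
    calc lam * ‖w‖ ≤ lam * (lam ^ (m + 1))⁻¹ := by gcongr
      _ = (lam ^ m)⁻¹ := by rw [pow_succ]; field_simp
  · rwa [← mul_neg, Complex.arg_real_mul _ hlam]

theorem div_mem_modelQuad {lam θ : ℝ} (hlam : 0 < lam) {m : ℕ} {w : ℂ}
    (hw : w ∈ modelQuad lam θ m) : w / lam ∈ modelQuad lam θ (m + 1) := by
  obtain ⟨h1, h2, h3⟩ := hw
  have hn : ‖w / (lam : ℂ)‖ = ‖w‖ / lam := by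
    rw [norm_div, Complex.norm_real, Real.norm_of_nonneg hlam.le]
  refine ⟨?_, ?_, ?_⟩
  · rw [hn, pow_succ, mul_inv, div_eq_mul_inv]; gcongr
  · rw [hn, pow_succ, mul_inv, div_eq_mul_inv]; gcongr
  · have : -(w / (lam : ℂ)) = ((lam⁻¹ : ℝ) : ℂ) * -w := by push_cast; rw [div_eq_mul_inv]; ring
    rwa [this, Complex.arg_real_mul _ (inv_pos.2 hlam)]

theorem ne_zero_of_mem_modelQuad {lam θ : ℝ} (hlam : 0 < lam) {m : ℕ} {w : ℂ}
    (hw : w ∈ modelQuad lam θ m) : w ≠ 0 :=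
  norm_pos_iff.1 (lt_of_lt_of_le (by positivity) hw.1)

/-- For `θ > π/2` the constant `-cos θ` is positive, and the quadrilaterals lie in a cone strictly
inside the left half-plane. -/
theorem re_le_of_mem_modelQuad {lam θ : ℝ} (hθ : 0 < θ) {m : ℕ} {w : ℂ}
    (hw : w ∈ modelQuad lam θ m) : w.re ≤ -(-Real.cos θ) * ‖w‖ := by
  have h1 : Real.cos (Real.pi - θ) ≤ Real.cos (Complex.arg (-w)) := by
    rw [← Real.cos_abs (Complex.arg (-w))]
    exact Real.cos_le_cos_of_nonneg_of_le_pi (abs_nonneg _) (by linarith) hw.2.2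
  have h2 : (-w).re = ‖w‖ * Real.cos (Complex.arg (-w)) := by
    rw [← norm_neg w]; exact (Complex.norm_mul_cos_arg (-w)).symm
  rw [Real.cos_pi_sub] at h1
  rw [Complex.neg_re] at h2
  nlinarith [norm_nonneg w]

/-- A point of a small punctured disc lies in some quadrilateral if its argument is right. -/
theorem exists_mem_modelQuad {lam θ : ℝ} (hlam : 1 < lam) {m₀ : ℕ} {w : ℂ} (hw : w ≠ 0)
    (hw₀ : ‖w‖ ≤ (lam ^ m₀)⁻¹) (harg : |Complex.arg (-w)| ≤ Real.pi - θ) :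
    ∃ m ≥ m₀, w ∈ modelQuad lam θ m := by
  classical
  have hex : ∃ m : ℕ, (lam ^ (m + 1))⁻¹ ≤ ‖w‖ := by
    obtain ⟨m, hm⟩ := exists_pow_lt_of_lt_one (norm_pos_iff.2 hw) (inv_lt_one_of_one_lt₀ hlam)
    refine ⟨m, ?_⟩
    rw [inv_pow] at hm
    refine le_trans ?_ hm.le
    gcongr
    · linarith
    · omega
  set P : ℕ → Prop := fun i => (lam ^ (m₀ + i + 1))⁻¹ ≤ ‖w‖ with hP
  have hexP : ∃ i, P i := by
    obtain ⟨m, hm⟩ := hex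
    refine ⟨m, le_trans ?_ hm⟩
    gcongr
    · linarith
    · omega
  refine ⟨m₀ + Nat.find hexP, by omega, Nat.find_spec hexP, ?_, harg⟩
  by_cases h0 : Nat.find hexP = 0
  · rw [h0]; exact hw₀
  · have := Nat.find_min hexP (m := Nat.find hexP - 1) (by omega)
    simp only [hP, not_le] at this
    have e : m₀ + (Nat.find hexP - 1) + 1 = m₀ + Nat.find hexP := by omega
    rw [e] at this
    exact this.le

namespace IsMarkedBasin

variable {p : Polynomial ℂ} {v c : ℂ} {k : ℕ} {b : ℝ} {ψ : OpenPartialHomeomorph ℂ ℂ}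

theorem newtonMap_symm_linearizer (h : IsMarkedBasin p v c k b ψ) {κ : ℂ → ℂ} {r : ℝ}
    (hκ : IsLinearizer k b κ r) {w : ℂ} (hw : κ w ∈ Metric.ball (0 : ℂ) 1)
    (hwr : multiplierAtOne k b * ‖w‖ < r) :
    newtonMap p (ψ.symm (κ w)) = ψ.symm (κ (multiplierAtOne k b * w)) := by
  have hlam := h.one_lt_multiplier
  have hn : ‖(multiplierAtOne k b : ℂ) * w‖ = multiplierAtOne k b * ‖w‖ := by
    rw [norm_mul, Complex.norm_real, Real.norm_of_nonneg (by linarith)]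
  rw [h.symm_conj hw, hκ.semiconj w (by nlinarith [norm_nonneg w]) (by rwa [hn])]

/-- If `ψ⁻¹ ∘ κ` has a finite limit along a sequence in the sector, it has the same limit along the
dilated sequence: by bounded distortion, moving a point of the sector by a small proportion of its
modulus changes the value by at most a multiple of its distance to the omitted limit. -/
theorem tendsto_symm_linearizer_mul (h : IsMarkedBasin p v c k b ψ) {κ : ℂ → ℂ} {r : ℝ}
    (hκ : IsLinearizer k b κ r) {σ : ℝ} (hσ : 0 < σ) (hσ1 : σ ≤ 1) {x : ℕ → ℂ}
    (hx0 : ∀ n, x n ≠ 0) (hxre : ∀ n, (x n).re ≤ -σ * ‖x n‖) (hx : Tendsto x atTop (𝓝 0)) {y : ℂ}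
    (hy : y ∉ ψ.source) (hlim : Tendsto (fun n => ψ.symm (κ (x n))) atTop (𝓝 y)) {s : ℝ}
    (hs1 : 1 ≤ s) (hs2 : s ≤ 1 + σ / 256) :
    Tendsto (fun n => ψ.symm (κ (s * x n))) atTop (𝓝 y) := by
  obtain ⟨δ, hδ, hδr, hcone⟩ := hκ.exists_cone_subset_ball (half_pos hσ)
  have hxn : Tendsto (fun n => ‖x n‖) atTop (𝓝 0) := by simpa using hx.norm
  have hev : ∀ᶠ n in atTop, ‖ψ.symm (κ (s * x n)) - ψ.symm (κ (x n))‖ ≤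
      20 * ‖y - ψ.symm (κ (x n))‖ := by
    filter_upwards [hxn.eventually_lt_const (half_pos hδ)] with n hn
    have hpos := norm_pos_iff.2 (hx0 n)
    set R := σ / 8 * ‖x n‖ with hR
    have hball : ∀ w ∈ Metric.ball (x n) R, w ∈ Metric.ball (0 : ℂ) r ∧
        κ w ∈ Metric.ball (0 : ℂ) 1 := by
      intro w hw
      rw [mem_ball_iff_norm] at hw
      have h1 : ‖w‖ ≤ ‖x n‖ + ‖w - x n‖ := by simpa using norm_add_le (x n) (w - x n)
      have h1' : ‖x n‖ ≤ ‖w‖ + ‖w - x n‖ := by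
        have := norm_sub_le w (w - x n); simpa using this
      have h2 : w.re ≤ (x n).re + ‖w - x n‖ := by
        have := (Complex.re_le_norm (w - x n)); rw [Complex.sub_re] at this; linarith
      have h3 := hxre n
      have hwδ : ‖w‖ < δ := by nlinarith
      refine ⟨mem_ball_zero_iff.2 (hwδ.trans_le hδr), hcone w ?_ hwδ ?_⟩
      · exact norm_pos_iff.1 (by nlinarith)
      · nlinarith
    have hd : DifferentiableOn ℂ (fun w => ψ.symm (κ w)) (Metric.ball (x n) R) :=
      h.differentiableOn_symm.comp (hκ.holomorphic.mono fun w hw => (hball w hw).1)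
        fun w hw => (hball w hw).2
    refine (norm_sub_le_of_injOn_of_omitted (R := R) (by positivity) hd ?_ ?_ ?_).1
    · intro w hw w' hw' hww
      refine hκ.injOn (hball w hw).1 (hball w' hw').1 ?_
      have := congrArg ψ hww
      simp only at this
      rwa [h.apply_symm (hball w hw).2, h.apply_symm (hball w' hw').2] at this
    · rintro ⟨w, hw, rfl⟩
      exact hy (h.symm_mem (hball w hw).2)
    · have : (s : ℂ) * x n - x n = ((s - 1 : ℝ) : ℂ) * x n := by push_cast; ring
      rw [this, norm_mul, Complex.norm_real, Real.norm_of_nonneg (by linarith)]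
      nlinarith
  have h0 : Tendsto (fun n => 20 * ‖y - ψ.symm (κ (x n))‖) atTop (𝓝 0) := by
    have := ((tendsto_const_nhds (x := y)).sub hlim).norm.const_mul 20
    simpa using this
  have h1 := (squeeze_zero_norm' hev h0).add hlim
  simpa using h1

/-- The map `ψ⁻¹ ∘ κ` tends to `∞` at the vertex of the sector: a finite limit point would be a
fixed point on the boundary of the immediate basin. -/
theorem exists_lt_norm_symm_linearizer (h : IsMarkedBasin p v c k b ψ) {κ : ℂ → ℂ} {r : ℝ}
    (hκ : IsLinearizer k b κ r) {σ : ℝ} (hσ : 0 < σ) (hσ1 : σ ≤ 1) (R : ℝ) :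
    ∃ δ : ℝ, 0 < δ ∧ δ ≤ r ∧ ∀ w : ℂ, w ≠ 0 → ‖w‖ < δ → w.re ≤ -σ * ‖w‖ →
      κ w ∈ Metric.ball (0 : ℂ) 1 ∧ R < ‖ψ.symm (κ w)‖ := by
  obtain ⟨δ, hδ, hδr, hcone⟩ := hκ.exists_cone_subset_ball hσ
  by_contra hcon
  push Not at hcon
  have hex : ∀ n : ℕ, ∃ w : ℂ, w ≠ 0 ∧ ‖w‖ < δ / (n + 1) ∧ w.re ≤ -σ * ‖w‖ ∧
      κ w ∈ Metric.ball (0 : ℂ) 1 ∧ ‖ψ.symm (κ w)‖ ≤ R := by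
    intro n
    have h1 : δ / (n + 1) ≤ δ := div_le_self hδ.le (by linarith [n.cast_nonneg (α := ℝ)])
    obtain ⟨w, hw0, hwδ, hre, hw⟩ := hcon (δ / (n + 1)) (by positivity) (h1.trans hδr)
    have hb := hcone w hw0 (hwδ.trans_le h1) hre
    exact ⟨w, hw0, hwδ, hre, hb, hw hb⟩
  choose x hx0 hxδ hxre hxb hxR using hex
  obtain ⟨y, -, g, hg, hlim⟩ := (isCompact_closedBall (0 : ℂ) R).tendsto_subseq
    (x := fun n => ψ.symm (κ (x n))) fun n => mem_closedBall_zero_iff.2 (hxR n)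
  have hx : Tendsto (x ∘ g) atTop (𝓝 0) := by
    have h1 : Tendsto x atTop (𝓝 0) := by
      refine squeeze_zero_norm (fun n => (hxδ n).le) ?_
      have := (tendsto_one_div_add_atTop_nhds_zero_nat (𝕜 := ℝ)).const_mul δ
      simpa [div_eq_mul_inv] using this
    exact h1.comp hg.tendsto_atTop
  have hκx : Tendsto (fun n => κ (x (g n))) atTop (𝓝 1) := by
    have := hκ.continuousAt_zero.tendsto.comp hx
    rwa [hκ.map_zero] at this
  have hys : y ∉ ψ.source := by
    intro hys
    have h1 := (h.analyticAt hys).continuousAt.tendsto.comp hlim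
    have h2 : (fun n => κ (x (g n))) = ψ ∘ ((fun n => ψ.symm (κ (x n))) ∘ g) :=
      funext fun n => (h.apply_symm (hxb (g n))).symm
    rw [← h2] at h1
    have h3 := h.mem_ball hys
    rw [tendsto_nhds_unique h1 hκx] at h3
    simp at h3
  have hcl : (y : OnePoint ℂ) ∈ closure (immediateBasin (newtonMap p) v) :=
    mem_closure_of_tendsto ((OnePoint.continuous_coe.tendsto y).comp hlim)
      (Eventually.of_forall fun n => h.mem_source.1 (h.symm_mem (hxb (g n))))
  set lam := multiplierAtOne k b
  have hlam : 1 < lam := h.one_lt_multiplier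
  obtain ⟨J, hJ⟩ := pow_unbounded_of_one_lt lam (show 1 < 1 + σ / 256 by linarith)
  have hJ0 : J ≠ 0 := by rintro rfl; rw [pow_zero] at hJ; linarith
  set s : ℝ := lam ^ ((J : ℝ)⁻¹)
  have hsJ : s ^ J = lam := Real.rpow_inv_natCast_pow (by linarith) hJ0
  have hs1 : 1 ≤ s := Real.one_le_rpow hlam.le (by positivity)
  have hs2 : s ≤ 1 + σ / 256 := by
    by_contra hlt
    push Not at hlt
    have : (1 + σ / 256) ^ J ≤ s ^ J := by gcongr
    rw [hsJ] at this
    linarith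
  have hiter : ∀ j : ℕ,
      Tendsto (fun n => ψ.symm (κ (((s ^ j : ℝ) : ℂ) * x (g n)))) atTop (𝓝 y) := by
    intro j
    induction j with
    | zero => simpa [Function.comp_def] using hlim
    | succ j ih =>
      have hsj : 0 < s ^ j := by positivity
      have hn : ∀ n, ‖((s ^ j : ℝ) : ℂ) * x (g n)‖ = s ^ j * ‖x (g n)‖ := fun n => by
        rw [norm_mul, Complex.norm_real, Real.norm_of_nonneg hsj.le]
      have := h.tendsto_symm_linearizer_mul hκ hσ hσ1 (x := fun n => ((s ^ j : ℝ) : ℂ) * x (g n))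
        (fun n => mul_ne_zero (by exact_mod_cast hsj.ne') (hx0 _)) (fun n => by
          rw [hn, Complex.re_ofReal_mul]
          nlinarith [hxre (g n)]) (by simpa using hx.const_mul ((s ^ j : ℝ) : ℂ)) hys ih hs1 hs2
      refine this.congr fun n => ?_
      rw [← mul_assoc, ← Complex.ofReal_mul, ← pow_succ']
  have hlast := hiter J
  rw [hsJ] at hlast
  have hN1 : Tendsto (fun n => newtonMap p (ψ.symm (κ (x (g n))))) atTop (𝓝 (newtonMap p y)) :=
    (((continuous_newtonMap h.natDegree).comp OnePoint.continuous_coe).tendsto y).comp hlim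
  have hN2 : Tendsto (fun n => newtonMap p (ψ.symm (κ (x (g n))))) atTop (𝓝 (y : OnePoint ℂ)) := by
    refine ((OnePoint.continuous_coe.tendsto y).comp hlast).congr' ?_
    have hxn : Tendsto (fun n => lam * ‖x (g n)‖) atTop (𝓝 0) := by
      simpa using (hx.norm).const_mul lam
    filter_upwards [hxn.eventually_lt_const hκ.pos] with n hn
    exact (h.newtonMap_symm_linearizer hκ (hxb (g n)) hn).symm
  exact newtonMap_ne_self_of_mem_closure h.natDegree h.root hcl
    (fun hA => hys (h.mem_source.2 hA)) (tendsto_nhds_unique hN1 hN2)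

/-- The sector of a disc surgery has an opening angle less than `π`. -/
theorem pi_div_two_lt (h : IsMarkedBasin p v c k b ψ) {κ : ℂ → ℂ} {r θ : ℝ} {m₀ : ℕ}
    (hκ : IsLinearizer k b κ r) (hmem : ∀ m ≥ m₀, ∀ w ∈ modelQuad (multiplierAtOne k b) θ m,
      κ w ∈ Metric.ball (0 : ℂ) 1) : Real.pi / 2 < θ := by
  by_contra hle
  push Not at hle
  have hlam := h.one_lt_multiplier
  obtain ⟨t, ht, htt, hnot⟩ := hκ.exists_notMem_ball_of_imaginary h.riemann.value_pos h.lt_one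
    (by have := h.two_le; omega) hlam (t₀ := (multiplierAtOne k b ^ m₀)⁻¹) (by positivity)
  have harg : |Complex.arg (-(t * Complex.I))| ≤ Real.pi - θ := by
    have : -((t : ℂ) * Complex.I) = (t : ℂ) * -Complex.I := by ring
    rw [this, Complex.arg_real_mul _ ht, Complex.arg_neg_I, abs_neg, abs_of_pos (by positivity)]
    linarith
  obtain ⟨m, hm, hw⟩ := exists_mem_modelQuad hlam (θ := θ) (m₀ := m₀)
    (w := t * Complex.I) (by simp [ht.ne']) (by simpa [abs_of_pos ht] using htt) harg
  exact hnot (hmem m hm _ hw)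

/-- The quadrilaterals of the sector correspond to sets of the immediate basin that converge to
`∞` exponentially fast. -/
theorem exists_le_norm_of_mem_modelQuad (h : IsMarkedBasin p v c k b ψ) {κ : ℂ → ℂ} {r θ : ℝ}
    {m₀ : ℕ} (hκ : IsLinearizer k b κ r) (hθ : 0 < θ) (hθπ : θ < Real.pi)
    (hmem : ∀ m ≥ m₀, ∀ w ∈ modelQuad (multiplierAtOne k b) θ m, κ w ∈ Metric.ball (0 : ℂ) 1)
    {R ρ : ℝ} (hR : 1 ≤ R) (hρ : 0 < ρ)
    (hexp : ∀ z : ℂ, R < ‖z‖ → ∃ w : ℂ, newtonMap p z = w ∧ ‖w‖ ≤ ρ * ‖z‖) :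
    ∃ M₀ : ℕ, m₀ ≤ M₀ ∧ ∀ M ≥ M₀, ∀ m ≥ M, ∀ w ∈ modelQuad (multiplierAtOne k b) θ m,
      ‖w‖ < r / multiplierAtOne k b ∧ ρ ^ M * ρ⁻¹ ^ m ≤ ‖ψ.symm (κ w)‖ := by
  have hθ2 := h.pi_div_two_lt hκ hmem
  have hσ : 0 < -Real.cos θ := neg_pos.2 (Real.cos_neg_of_pi_div_two_lt_of_lt hθ2 (by linarith))
  obtain ⟨δ, hδ, hδr, hbig⟩ := h.exists_lt_norm_symm_linearizer hκ hσ
    (by linarith [Real.neg_one_le_cos θ]) R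
  set lam := multiplierAtOne k b
  have hlam : 1 < lam := h.one_lt_multiplier
  have hlam0 : 0 < lam := one_pos.trans hlam
  obtain ⟨M₁, hM₁⟩ := exists_pow_lt_of_lt_one (div_pos hδ hlam0) (inv_lt_one_of_one_lt₀ hlam)
  have hsmall : ∀ m ≥ M₁, ∀ w ∈ modelQuad lam θ m, ‖w‖ < δ / lam := by
    intro m hm w hw
    refine hw.2.1.trans_lt (lt_of_le_of_lt ?_ hM₁)
    rw [inv_pow]
    gcongr
    exact hlam.le
  have hδl : δ / lam ≤ δ := div_le_self hδ.le hlam.le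
  have hgrow : ∀ M ≥ M₁, ∀ j : ℕ, ∀ w ∈ modelQuad lam θ (M + j), ρ⁻¹ ^ j ≤ ‖ψ.symm (κ w)‖ := by
    intro M hM j
    induction j with
    | zero =>
      intro w hw
      have := (hbig w (ne_zero_of_mem_modelQuad hlam0 hw) ((hsmall _ hM w hw).trans_le hδl)
        (re_le_of_mem_modelQuad hθ hw)).2
      rw [pow_zero]
      linarith
    | succ j ih =>
      intro w hw
      have hws := hsmall _ (by omega) w hw
      obtain ⟨hwb, hwR⟩ := hbig w (ne_zero_of_mem_modelQuad hlam0 hw)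
        (hws.trans_le hδl) (re_le_of_mem_modelQuad hθ hw)
      obtain ⟨z, hz, hzle⟩ := hexp _ hwR
      rw [h.newtonMap_symm_linearizer hκ hwb (by
        rw [lt_div_iff₀ hlam0] at hws; rw [mul_comm]; exact hws.trans_le hδr)] at hz
      have h1 := ih _ (mul_mem_modelQuad hlam0 hw)
      rw [OnePoint.coe_injective hz] at h1
      rw [pow_succ, mul_comm, inv_mul_le_iff₀ hρ]
      exact h1.trans hzle
  refine ⟨max m₀ M₁, le_max_left _ _, fun M hM m hm w hw => ⟨?_, ?_⟩⟩
  · refine (hsmall m (by have := le_max_right m₀ M₁; omega) w hw).trans_le ?_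
    gcongr
  · obtain ⟨j, rfl⟩ := Nat.exists_eq_add_of_le hm
    have := hgrow M ((le_max_right m₀ M₁).trans hM) j w hw
    rwa [pow_add, inv_pow, ← mul_assoc, mul_inv_cancel₀ (pow_ne_zero _ hρ.ne'), one_mul]

end IsMarkedBasin

/-! ### Wirtinger calculus -/

open scoped ComplexConjugate

theorem fderiv_apply_eq (f : ℂ → ℂ) (z h : ℂ) :
    fderiv ℝ f z h = dz f z * h + dzbar f z * conj h := by
  have h1 : h = h.re • (1 : ℂ) + h.im • Complex.I := by
    simp
  have h2 : fderiv ℝ f z h = h.re • fderiv ℝ f z 1 + h.im • fderiv ℝ f z Complex.I := by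
    conv_lhs => rw [h1, map_add, map_smul, map_smul]
  have h3 : conj h = h.re - h.im * Complex.I := by
    apply Complex.ext <;> simp
  have h4 : h = h.re + h.im * Complex.I := (Complex.re_add_im h).symm
  rw [h2, h3]
  nth_rw 3 [h4]
  simp only [dz, dzbar, Complex.real_smul]
  linear_combination ((h.im : ℂ) * fderiv ℝ f z Complex.I) * Complex.I_mul_I

theorem dz_eq_of_hasFDerivAt {f : ℂ → ℂ} {z a b : ℂ} {L : ℂ →L[ℝ] ℂ} (hf : HasFDerivAt f L z)
    (hL : ∀ h, L h = a * h + b * conj h) : dz f z = a ∧ dzbar f z = b := by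
  rw [dz, dzbar, hf.fderiv, hL, hL]
  simp only [map_one, mul_one, Complex.conj_I]
  constructor
  · linear_combination (b / 2 - a / 2) * Complex.I_mul_I
  · linear_combination (a / 2 - b / 2) * Complex.I_mul_I

theorem dz_comp {f g : ℂ → ℂ} {z : ℂ} (hg : DifferentiableAt ℝ g (f z))
    (hf : DifferentiableAt ℝ f z) :
    dz (fun w => g (f w)) z =
        dz g (f z) * dz f z + dzbar g (f z) * conj (dzbar f z) ∧
      dzbar (fun w => g (f w)) z =
        dz g (f z) * dzbar f z + dzbar g (f z) * conj (dz f z) := by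
  refine dz_eq_of_hasFDerivAt (HasFDerivAt.comp z hg.hasFDerivAt hf.hasFDerivAt) fun h => ?_
  rw [ContinuousLinearMap.comp_apply, fderiv_apply_eq f, fderiv_apply_eq g]
  simp only [map_add, map_mul, Complex.conj_conj]
  ring

theorem dz_of_differentiableAt {f : ℂ → ℂ} {z : ℂ} (hf : DifferentiableAt ℂ f z) :
    dz f z = deriv f z ∧ dzbar f z = 0 :=
  dz_eq_of_hasFDerivAt (det_fderiv_of_hasDerivAt hf.hasDerivAt).1 fun h => by simp

theorem beltramiPullback_congr {f g μ ν : ℂ → ℂ} {z : ℂ} (h : f =ᶠ[𝓝 z] g)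
    (hμ : μ (g z) = ν (g z)) : beltramiPullback f μ z = beltramiPullback g ν z := by
  simp only [beltramiPullback, dz, dzbar, h.fderiv_eq, h.self_of_nhds, hμ]

/-- Functoriality of the pull-back of Beltrami forms. -/
theorem beltramiPullback_comp {f g μ : ℂ → ℂ} {z : ℂ} (hg : DifferentiableAt ℝ g (f z))
    (hf : DifferentiableAt ℝ f z)
    (hden : dz g (f z) + μ (g (f z)) * conj (dzbar g (f z)) ≠ 0) :
    beltramiPullback (fun w => g (f w)) μ z = beltramiPullback f (beltramiPullback g μ) z := by
  obtain ⟨h1, h2⟩ := dz_comp hg hf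
  set A := dz g (f z) + μ (g (f z)) * conj (dzbar g (f z))
  set B := dzbar g (f z) + μ (g (f z)) * conj (dz g (f z)) with hB
  have hν : beltramiPullback g μ (f z) = B / A := rfl
  have e1 : beltramiPullback (fun w => g (f w)) μ z =
      (A * dzbar f z + B * conj (dz f z)) / (A * dz f z + B * conj (dzbar f z)) := by
    rw [beltramiPullback, h1, h2]
    congr 1 <;> simp only [map_add, map_mul, Complex.conj_conj, A, B] <;> ring
  have e2 : ∀ x y : ℂ, x + B / A * y = (A * x + B * y) / A := fun x y => by
    field_simp
  rw [e1, beltramiPullback, hν, e2, e2, div_div_div_cancel_right₀ hden]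

theorem beltramiPullback_of_differentiableAt {f μ : ℂ → ℂ} {z : ℂ} (hf : DifferentiableAt ℂ f z) :
    beltramiPullback f μ z = μ (f z) * conj (deriv f z) / deriv f z := by
  obtain ⟨h1, h2⟩ := dz_of_differentiableAt hf
  rw [beltramiPullback, h1, h2]
  simp

theorem norm_beltramiPullback {f μ : ℂ → ℂ} {z : ℂ} (hf : DifferentiableAt ℂ f z)
    (hd : deriv f z ≠ 0) : ‖beltramiPullback f μ z‖ = ‖μ (f z)‖ := by
  rw [beltramiPullback_of_differentiableAt hf, norm_div, norm_mul, RCLike.norm_conj,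
    mul_div_cancel_right₀ _ (norm_ne_zero_iff.2 hd)]

theorem beltramiPullback_comp_holomorphic {f g μ : ℂ → ℂ} {z : ℂ} (hg : DifferentiableAt ℂ g (f z))
    (hf : DifferentiableAt ℝ f z) (hd : deriv g (f z) ≠ 0) :
    beltramiPullback (fun w => g (f w)) μ z = beltramiPullback f (beltramiPullback g μ) z := by
  obtain ⟨h1, h2⟩ := dz_of_differentiableAt hg
  refine beltramiPullback_comp (hg.restrictScalars ℝ) hf ?_
  rw [h1, h2]
  simpa using hd

theorem complexDilatation_apply (f : ℂ → ℂ) (z : ℂ) :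
    complexDilatation f z = dzbar f z / dz f z := by
  simp [complexDilatation, beltramiPullback]

theorem complexDilatation_of_differentiableAt {f : ℂ → ℂ} {z : ℂ} (hf : DifferentiableAt ℂ f z) :
    complexDilatation f z = 0 := by
  rw [complexDilatation_apply, (dz_of_differentiableAt hf).2, zero_div]

theorem det_fderiv_eq (f : ℂ → ℂ) (z : ℂ) :
    (fderiv ℝ f z).det = ‖dz f z‖ ^ 2 - ‖dzbar f z‖ ^ 2 := by
  have h1 : (fderiv ℝ f z).det =
      (fderiv ℝ f z 1).re * (fderiv ℝ f z Complex.I).im -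
        (fderiv ℝ f z Complex.I).re * (fderiv ℝ f z 1).im := by
    rw [ContinuousLinearMap.det, ← LinearMap.det_toMatrix Complex.basisOneI, Matrix.det_fin_two]
    simp [LinearMap.toMatrix_apply]
  rw [h1, ← Complex.normSq_eq_norm_sq, ← Complex.normSq_eq_norm_sq, dz, dzbar, Complex.normSq_apply,
    Complex.normSq_apply]
  simp
  ring

/-! ### Regular points of a piecewise smooth homeomorphism -/

/-- The map is differentiable at the point, with positive Jacobian. -/
def IsRegularAt (f : ℂ → ℂ) (z : ℂ) : Prop :=
  DifferentiableAt ℝ f z ∧ 0 < (fderiv ℝ f z).det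

theorem IsRegularAt.norm_dzbar_lt {f : ℂ → ℂ} {z : ℂ} (h : IsRegularAt f z) :
    ‖dzbar f z‖ < ‖dz f z‖ := by
  have := h.2
  rw [det_fderiv_eq] at this
  nlinarith [norm_nonneg (dz f z), norm_nonneg (dzbar f z)]

theorem IsRegularAt.dz_ne_zero {f : ℂ → ℂ} {z : ℂ} (h : IsRegularAt f z) : dz f z ≠ 0 :=
  norm_pos_iff.1 ((norm_nonneg _).trans_lt h.norm_dzbar_lt)

theorem IsRegularAt.norm_complexDilatation_lt {f : ℂ → ℂ} {z : ℂ} (h : IsRegularAt f z) :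
    ‖complexDilatation f z‖ < 1 := by
  rw [complexDilatation_apply, norm_div, div_lt_one (norm_pos_iff.2 h.dz_ne_zero)]
  exact h.norm_dzbar_lt

theorem IsRegularAt.differentiableAt_symm {φ : OpenPartialHomeomorph ℂ ℂ} {z : ℂ}
    (hz : z ∈ φ.source) (h : IsRegularAt φ z) : DifferentiableAt ℝ φ.symm (φ z) := by
  have hf : HasFDerivAt φ ((fderiv ℝ φ z).toContinuousLinearEquivOfDetNeZero h.2.ne' : ℂ →L[ℝ] ℂ)
      (φ.symm (φ z)) := by
    rw [φ.left_inv hz]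
    exact h.1.hasFDerivAt
  exact (φ.hasFDerivAt_symm (φ.map_source hz) hf).differentiableAt

theorem countable_of_finite_inter_compact {E : Set ℂ}
    (h : ∀ C : Set ℂ, IsCompact C → C ⊆ Metric.ball 0 1 → (E ∩ C).Finite) :
    (E ∩ Metric.ball 0 1).Countable := by
  have hsub : E ∩ Metric.ball 0 1 ⊆
      ⋃ n : ℕ, E ∩ Metric.closedBall (0 : ℂ) (1 - 1 / (n + 1)) := by
    rintro z ⟨hz, hzb⟩
    rw [mem_ball_zero_iff] at hzb
    obtain ⟨n, hn⟩ := exists_nat_one_div_lt (sub_pos.2 hzb)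
    exact Set.mem_iUnion.2 ⟨n, hz, mem_closedBall_zero_iff.2 (by linarith)⟩
  refine Set.Countable.mono hsub (Set.countable_iUnion fun n => (h _ (isCompact_closedBall _ _)
    (Metric.closedBall_subset_ball ?_)).countable)
  have : (0 : ℝ) < 1 / (n + 1) := by positivity
  linarith

/-- The irregular points lie in the countable exceptional set or on the boundaries of the pieces. -/
theorem ae_isRegularAt {φ : ℂ → ℂ} (h : IsPiecewiseC1OnDisk φ) :
    volume {z ∈ Metric.ball (0 : ℂ) 1 | ¬ IsRegularAt φ z} = 0 := by
  obtain ⟨⟨E, P, f, hfin, hcov, hP⟩, -⟩ := h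
  have hE := countable_of_finite_inter_compact fun C hC hCb => (hfin C hC hCb).1
  have hsub : {z ∈ Metric.ball (0 : ℂ) 1 | ¬ IsRegularAt φ z} ⊆
      (E ∩ Metric.ball 0 1) ∪ ⋃ i, frontier (P i) := by
    rintro z ⟨hz, hreg⟩
    by_contra hnot
    rw [Set.mem_union, not_or] at hnot
    obtain ⟨hnE, hnF⟩ := hnot
    have hzE : z ∉ E := fun h => hnE ⟨h, hz⟩
    rw [← hcov] at hz
    obtain ⟨i, hi⟩ := Set.mem_iUnion.1 hz
    have hint : z ∈ interior (P i) := by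
      by_contra hni
      exact hnF (Set.mem_iUnion.2 ⟨i, subset_closure hi, hni⟩)
    obtain ⟨-, -, heq, hC⟩ := hP i
    obtain ⟨hsm, hdet⟩ := hC z ⟨hi, hzE⟩
    have hev : φ =ᶠ[𝓝 z] f i := by
      filter_upwards [mem_interior_iff_mem_nhds.1 hint] with w hw using heq hw
    refine hreg ⟨(hsm.differentiableAt one_ne_zero).congr_of_eventuallyEq hev, ?_⟩
    rwa [hev.fderiv_eq]
  refine measure_mono_null hsub (measure_union_null (hE.measure_zero _)
    (measure_iUnion_null fun i => (hP i).2.1))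

/-- A piecewise smooth homeomorphism maps null sets to null sets. -/
theorem volume_image_eq_zero {φ : ℂ → ℂ} (h : IsPiecewiseC1OnDisk φ) {E : Set ℂ}
    (hEb : E ⊆ Metric.ball 0 1) (hE : volume E = 0) : volume (φ '' E) = 0 := by
  obtain ⟨⟨E', P, f, hfin, hcov, hP⟩, -⟩ := h
  have hE' := countable_of_finite_inter_compact fun C hC hCb => (hfin C hC hCb).1
  have hsub : φ '' E ⊆ φ '' (E' ∩ Metric.ball 0 1) ∪ ⋃ i, f i '' (E ∩ (P i \ E')) := by
    rintro _ ⟨z, hz, rfl⟩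
    by_cases hzE : z ∈ E'
    · exact Or.inl ⟨z, ⟨hzE, hEb hz⟩, rfl⟩
    · have := hEb hz
      rw [← hcov] at this
      obtain ⟨i, hi⟩ := Set.mem_iUnion.1 this
      exact Or.inr (Set.mem_iUnion.2 ⟨i, z, ⟨hz, hi, hzE⟩, ((hP i).2.2.1 hi).symm⟩)
  refine measure_mono_null hsub (measure_union_null ((hE'.image _).measure_zero _)
    (measure_iUnion_null fun i => ?_))
  refine addHaar_image_eq_zero_of_differentiableOn_of_addHaar_eq_zero _ (fun z hz => ?_)
    (measure_mono_null Set.inter_subset_left hE)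
  exact (((hP i).2.2.2 z hz.2).1.differentiableAt one_ne_zero).differentiableWithinAt

/-- Preimages of null sets are null, since the inverse is differentiable at the images of regular
points and the other points form a null set. -/
theorem volume_preimage_eq_zero {φ : OpenPartialHomeomorph ℂ ℂ} (h : IsPiecewiseC1OnDisk φ)
    (hs : φ.source = Metric.ball 0 1) {E : Set ℂ} (hE : volume E = 0) :
    volume {z ∈ Metric.ball (0 : ℂ) 1 | φ z ∈ E} = 0 := by
  have hsub : {z ∈ Metric.ball (0 : ℂ) 1 | φ z ∈ E} ⊆
      {z ∈ Metric.ball (0 : ℂ) 1 | ¬ IsRegularAt φ z} ∪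
        φ.symm '' {w ∈ E | ∃ z ∈ φ.source, IsRegularAt φ z ∧ φ z = w} := by
    rintro z ⟨hz, hzE⟩
    by_cases hreg : IsRegularAt φ z
    · rw [← hs] at hz
      exact Or.inr ⟨φ z, ⟨hzE, z, hz, hreg, rfl⟩, φ.left_inv hz⟩
    · exact Or.inl ⟨hz, hreg⟩
  refine measure_mono_null hsub (measure_union_null (ae_isRegularAt h) ?_)
  refine addHaar_image_eq_zero_of_differentiableOn_of_addHaar_eq_zero _ ?_
    (measure_mono_null (fun w hw => hw.1) hE)
  rintro _ ⟨-, z, hz, hreg, rfl⟩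
  exact (hreg.differentiableAt_symm hz).differentiableWithinAt

/-! ### The dilatation of a disc surgery -/

theorem hasDerivAt_blaschke {b : ℝ} (hb0 : 0 < b) (hb1 : b < 1) (k : ℕ) {z : ℂ}
    (hz : z ∈ Metric.ball (0 : ℂ) 1) :
    HasDerivAt (blaschke k b) (k * z ^ (k - 1) * (1 - b ^ 2) / (1 + b * z ^ k) ^ 2) z := by
  have hzk : ‖z ^ k‖ ≤ 1 := by
    rw [norm_pow]; exact pow_le_one₀ (norm_nonneg _) (mem_ball_zero_iff.1 hz).le
  have e1 := (((hasDerivAt_pow k z).add_const (b : ℂ)).div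
    (((hasDerivAt_pow k z).const_mul (b : ℂ)).const_add 1) (one_add_mul_ne_zero hb0 hb1 hzk))
  convert! e1 using 2
  ring

theorem deriv_blaschke_ne_zero {b : ℝ} (hb0 : 0 < b) (hb1 : b < 1) {k : ℕ} (hk : k ≠ 0) {z : ℂ}
    (hz : z ∈ Metric.ball (0 : ℂ) 1) (hz0 : z ≠ 0) : deriv (blaschke k b) z ≠ 0 := by
  have hzk : ‖z ^ k‖ ≤ 1 := by
    rw [norm_pow]; exact pow_le_one₀ (norm_nonneg _) (mem_ball_zero_iff.1 hz).le
  rw [(hasDerivAt_blaschke hb0 hb1 k hz).deriv]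
  refine div_ne_zero (mul_ne_zero (mul_ne_zero (by exact_mod_cast hk) (pow_ne_zero _ hz0)) ?_)
    (pow_ne_zero 2 (one_add_mul_ne_zero hb0 hb1 hzk))
  have : (1 : ℝ) - b ^ 2 ≠ 0 := by nlinarith
  exact_mod_cast this

theorem analyticAt_blaschke {b : ℝ} (hb0 : 0 < b) (hb1 : b < 1) (k : ℕ) {z : ℂ}
    (hz : z ∈ Metric.ball (0 : ℂ) 1) : AnalyticAt ℂ (blaschke k b) z :=
  DifferentiableOn.analyticAt (s := Metric.ball 0 1)
    (fun _ hw => (hasDerivAt_blaschke hb0 hb1 k hw).differentiableAt.differentiableWithinAt)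
    (Metric.isOpen_ball.mem_nhds hz)

theorem blaschke_mem_ball {b : ℝ} (hb0 : 0 < b) (hb1 : b < 1) {k : ℕ} (hk : k ≠ 0) {z : ℂ}
    (hz : z ∈ Metric.ball (0 : ℂ) 1) : blaschke k b z ∈ Metric.ball (0 : ℂ) 1 := by
  have hzk : ‖z ^ k‖ < 1 := by
    rw [norm_pow]; exact pow_lt_one₀ (norm_nonneg _) (mem_ball_zero_iff.1 hz) hk
  have h3 := normSq_one_sub_mul_sub (-b) (z ^ k)
  have h4 : ‖1 - ((-b : ℝ) : ℂ) * z ^ k‖ = ‖1 + b * z ^ k‖ := by push_cast; ring_nf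
  have h5 : ‖z ^ k - ((-b : ℝ) : ℂ)‖ = ‖z ^ k + b‖ := by push_cast; ring_nf
  rw [h4, h5, neg_sq] at h3
  have hden := norm_pos_iff.2 (one_add_mul_ne_zero hb0 hb1 hzk.le)
  rw [mem_ball_zero_iff, blaschke, norm_div, div_lt_one hden]
  have h6 : 0 < (1 - b ^ 2) * (1 - ‖z ^ k‖ ^ 2) :=
    mul_pos (by nlinarith) (by nlinarith [norm_nonneg (z ^ k)])
  exact lt_of_pow_lt_pow_left₀ 2 hden.le (by linarith)

theorem parabolic_parameter {k : ℕ} (hk : 2 ≤ k) :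
    0 < ((k : ℝ) - 1) / (k + 1) ∧ ((k : ℝ) - 1) / (k + 1) < 1 := by
  have : (2 : ℝ) ≤ k := by exact_mod_cast hk
  constructor
  · apply div_pos <;> linarith
  · rw [div_lt_one (by linarith)]; linarith

theorem volume_iterate_blaschke_preimage {b : ℝ} (hb0 : 0 < b) (hb1 : b < 1) {k : ℕ} (hk : k ≠ 0)
    {E : Set ℂ} (hE : volume E = 0) (i : ℕ) :
    volume {z ∈ Metric.ball (0 : ℂ) 1 | (blaschke k b)^[i] z ∈ E} = 0 := by
  induction i with
  | zero => exact measure_mono_null (fun z hz => hz.2) hE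
  | succ i ih =>
    have hsub : {z ∈ Metric.ball (0 : ℂ) 1 | (blaschke k b)^[i + 1] z ∈ E} ⊆ {0} ∪
        ({z ∈ Metric.ball (0 : ℂ) 1 | z ≠ 0} ∩
          blaschke k b ⁻¹' {z ∈ Metric.ball (0 : ℂ) 1 | (blaschke k b)^[i] z ∈ E}) := by
      rintro z ⟨hz, hzE⟩
      by_cases hz0 : z = 0
      · exact Or.inl hz0
      · exact Or.inr ⟨⟨hz, hz0⟩, blaschke_mem_ball hb0 hb1 hk hz, hzE⟩
    refine measure_mono_null hsub (measure_union_null (measure_singleton 0)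
      (volume_inter_preimage_eq_zero ih fun z hz => ?_))
    exact ⟨analyticAt_blaschke hb0 hb1 k hz.1, deriv_blaschke_ne_zero hb0 hb1 hk hz.1 hz.2⟩

namespace IsMarkedBasin

variable {p : Polynomial ℂ} {v c : ℂ} {k : ℕ} {b : ℝ} {ψ φ : OpenPartialHomeomorph ℂ ℂ}
  {S S₁ : Set ℂ}

theorem ne_zero_degree (h : IsMarkedBasin p v c k b ψ) : k ≠ 0 := by
  have := h.two_le; omega

/-- Off the sector, the surgery map has the same dilatation at a point and at its image. -/
theorem norm_complexDilatation_blaschke (h : IsMarkedBasin p v c k b ψ)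
    (hφ : IsDiskSurgery k b φ S S₁) {z : ℂ} (hz : z ∈ Metric.ball (0 : ℂ) 1) (hzS : z ∉ S)
    (hz0 : z ≠ 0) (hreg : IsRegularAt φ z) (hregB : IsRegularAt φ (blaschke k b z))
    (hφz : φ z ≠ 0) : ‖complexDilatation φ (blaschke k b z)‖ = ‖complexDilatation φ z‖ := by
  have hb0 := h.riemann.value_pos
  have hb1 := h.lt_one
  have hev : (fun w => φ (blaschke k b w)) =ᶠ[𝓝 z] fun w => parabolicBlaschke k (φ w) := by
    have h1 : (Metric.ball (0 : ℂ) 1 \ insert 1 S) ∈ 𝓝 z := by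
      refine (Metric.isOpen_ball.sdiff hφ.sector_compact.isClosed).mem_nhds ⟨hz, ?_⟩
      rintro (rfl | h)
      · simp at hz
      · exact hzS h
    filter_upwards [h1] with w hw
    exact hφ.conj w ⟨hw.1, fun hwS => hw.2 (Set.mem_insert_of_mem _ hwS)⟩
  have hφb : φ z ∈ Metric.ball (0 : ℂ) 1 := hφ.target ▸ φ.map_source (hφ.source ▸ hz)
  have hBd := (hasDerivAt_blaschke hb0 hb1 k hz).differentiableAt
  obtain ⟨ha0, ha1⟩ := parabolic_parameter h.two_le
  have hPd : DifferentiableAt ℂ (parabolicBlaschke k) (φ z) :=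
    (hasDerivAt_blaschke ha0 ha1 k hφb).differentiableAt
  have hP' : deriv (parabolicBlaschke k) (φ z) ≠ 0 :=
    deriv_blaschke_ne_zero ha0 ha1 h.ne_zero_degree hφb hφz
  have h1 : beltramiPullback (fun w => φ (blaschke k b w)) 0 z =
      beltramiPullback (blaschke k b) (beltramiPullback φ 0) z :=
    beltramiPullback_comp hregB.1 (hBd.restrictScalars ℝ) (by simpa using hregB.dz_ne_zero)
  have h2 : beltramiPullback (fun w => parabolicBlaschke k (φ w)) 0 z =
      beltramiPullback φ (beltramiPullback (parabolicBlaschke k) 0) z :=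
    beltramiPullback_comp_holomorphic hPd hreg.1 hP'
  have h3 : beltramiPullback φ (beltramiPullback (parabolicBlaschke k) 0) z =
      beltramiPullback φ 0 z :=
    beltramiPullback_congr Filter.EventuallyEq.rfl (complexDilatation_of_differentiableAt hPd)
  have h4 := beltramiPullback_congr (μ := 0) (ν := 0) hev rfl
  rw [h1, h2, h3] at h4
  change ‖beltramiPullback φ 0 (blaschke k b z)‖ = ‖beltramiPullback φ 0 z‖
  rw [← h4, norm_beltramiPullback hBd (deriv_blaschke_ne_zero hb0 hb1 h.ne_zero_degree hz hz0)]

/-- Almost every point of large dilatation is mapped by some iterate into a quadrilateral of large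
index. -/
theorem ae_exists_iterate_mem_modelQuad (h : IsMarkedBasin p v c k b ψ)
    (hφ : IsDiskSurgery k b φ S S₁) {κ : ℂ → ℂ} {θ C : ℝ} {m₀ : ℕ} (hC : 0 < C)
    (hS₁ : S₁ = ⋃ m ∈ Set.Ici m₀, κ '' modelQuad (multiplierAtOne k b) θ m)
    (hK : ∀ m : ℕ, m₀ ≤ m → ∀ᵐ z : ℂ, z ∈ κ '' modelQuad (multiplierAtOne k b) θ m →
        realDilatation φ z ≤ C * m) :
    ∃ ε₀ : ℝ, 0 < ε₀ ∧ ∀ᵐ z : ℂ, z ∈ Metric.ball (0 : ℂ) 1 → IsRegularAt φ z ∧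
      ∀ ε : ℝ, 0 < ε → ε < ε₀ → 1 - ε < ‖complexDilatation φ z‖ →
        ∃ i m : ℕ, ∃ w ∈ modelQuad (multiplierAtOne k b) θ m,
          (C * ε)⁻¹ < m ∧ (blaschke k b)^[i] z = κ w := by
  have hb0 := h.riemann.value_pos
  have hb1 := h.lt_one
  obtain ⟨W, hW, hSW⟩ := hφ.sector_end
  -- away from `1` the sector is compactly contained in the disc
  have hcomp : IsCompact (insert 1 S \ interior W) := hφ.sector_compact.diff isOpen_interior
  have hcompb : insert 1 S \ interior W ⊆ Metric.ball 0 1 := by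
    rintro z ⟨rfl | hz, hzW⟩
    · exact absurd (mem_interior_iff_mem_nhds.2 hW) hzW
    · exact hφ.sector_subset hz
  obtain ⟨q, hq, hqae⟩ := hφ.piecewise.2 _ hcomp hcompb
  -- the points at which one of the almost everywhere properties fails, or a derivative vanishes
  set Z₀ : Set ℂ := {z ∈ Metric.ball (0 : ℂ) 1 | ¬ IsRegularAt φ z} ∪
    ({z ∈ Metric.ball (0 : ℂ) 1 | φ z ∈ ({0} : Set ℂ)} ∪ ({0} ∪
    ((⋃ m : ℕ, {z | ¬ (m₀ ≤ m → z ∈ κ '' modelQuad (multiplierAtOne k b) θ m →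
      realDilatation φ z ≤ C * m)}) ∪
    {z | ¬ (z ∈ insert 1 S \ interior W → ‖complexDilatation φ z‖ ≤ q)}))) with hZ₀
  have hZ₀null : volume Z₀ = 0 := by
    refine measure_union_null (ae_isRegularAt hφ.piecewise) (measure_union_null
      (volume_preimage_eq_zero hφ.piecewise hφ.source (measure_singleton _)) (measure_union_null
      (measure_singleton _) (measure_union_null (measure_iUnion_null fun m => ?_) hqae)))
    by_cases hm : m₀ ≤ m
    · refine measure_mono_null ?_ (ae_iff.1 (hK m hm))
      intro z hz hz'
      exact hz fun _ => hz'
    · simp [hm]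
  have hZ : ∀ᵐ z : ℂ, ∀ i : ℕ, ¬ (z ∈ Metric.ball (0 : ℂ) 1 ∧ (blaschke k b)^[i] z ∈ Z₀) := by
    refine ae_all_iff.2 fun i => ?_
    rw [ae_iff]
    simp only [not_not]
    exact volume_iterate_blaschke_preimage hb0 hb1 h.ne_zero_degree hZ₀null i
  refine ⟨1 - q, sub_pos.2 hq, hZ.mono fun z hzZ hz => ?_⟩
  have hgood : ∀ i : ℕ, (blaschke k b)^[i] z ∉ Z₀ := fun i hi => hzZ i ⟨hz, hi⟩
  have hball : ∀ i : ℕ, (blaschke k b)^[i] z ∈ Metric.ball (0 : ℂ) 1 :=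
    h.iterate_blaschke_mem_ball hz
  have hreg : ∀ i : ℕ, IsRegularAt φ ((blaschke k b)^[i] z) := fun i => by
    by_contra hn
    exact hgood i (Or.inl ⟨hball i, hn⟩)
  refine ⟨hreg 0, fun ε hε hεq hdil => ?_⟩
  obtain ⟨α, hαb, hαfix, hαS⟩ := hφ.sector_nhds
  have hent : ∃ i : ℕ, (blaschke k b)^[i] z ∈ S := by
    have h1 := h.tendsto_iterate_blaschke hz
    rw [← h.eq_of_blaschke_fixed hαb hαfix] at h1
    exact (h1.eventually hαS).exists
  classical
  -- the dilatation does not change before the first entry to the sector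
  have hsame : ∀ i ≤ Nat.find hent,
      ‖complexDilatation φ ((blaschke k b)^[i] z)‖ = ‖complexDilatation φ z‖ := by
    intro i
    induction i with
    | zero => intro; rfl
    | succ i ih =>
      intro hi
      rw [← ih (by omega), Function.iterate_succ_apply']
      have hg := hgood i
      simp only [hZ₀, Set.mem_union, not_or] at hg
      refine h.norm_complexDilatation_blaschke hφ (hball i) (Nat.find_min hent (by omega)) hg.2.2.1
        (hreg i) ?_ fun h0 => hg.2.1 ⟨hball i, h0⟩
      have := hreg (i + 1)
      rwa [Function.iterate_succ_apply'] at this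
  set i := Nat.find hent
  set y := (blaschke k b)^[i] z
  have hyS : y ∈ S := Nat.find_spec hent
  have hyd : 1 - ε < ‖complexDilatation φ y‖ := by rw [hsame i le_rfl]; exact hdil
  have hg := hgood i
  simp only [hZ₀, Set.mem_union, not_or] at hg
  have hyW : y ∈ S₁ := by
    rw [hSW]
    refine ⟨hyS, ?_⟩
    by_contra hyW
    have h1 := not_not.1 hg.2.2.2.2 ⟨Or.inr hyS, fun hyi => hyW (interior_subset hyi)⟩
    linarith
  rw [hS₁] at hyW
  obtain ⟨m, hm, w, hw, hwy⟩ := Set.mem_iUnion₂.1 hyW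
  refine ⟨i, m, w, hw, ?_, hwy.symm⟩
  have hKy : realDilatation φ y ≤ C * m := by
    by_contra hn
    exact hg.2.2.2.1 (Set.mem_iUnion.2 ⟨m, fun hcon => hn (hcon hm ⟨w, hw, hwy⟩)⟩)
  have hy1 := (hreg i).norm_complexDilatation_lt
  rw [realDilatation, div_le_iff₀ (by linarith)] at hKy
  have h1 : 1 < C * m * ε := by
    have h2 : 0 ≤ C * m := by positivity
    have h4 : 0 < C * m := by
      by_contra hn
      have : C * m = 0 := le_antisymm (not_lt.1 hn) h2
      rw [this, zero_mul] at hKy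
      linarith [norm_nonneg (complexDilatation φ y)]
    have h5 : C * m * (1 - ‖complexDilatation φ y‖) < C * m * ε :=
      mul_lt_mul_of_pos_left (by linarith) h4
    linarith [norm_nonneg (complexDilatation φ y)]
  rw [inv_lt_iff_one_lt_mul₀ (by positivity)]
  linarith

end IsMarkedBasin

theorem modelQuad_mem_nhds {lam θ : ℝ} (hlam : 1 < lam) (hθ : θ < Real.pi) (m : ℕ) :
    ∃ w : ℂ, modelQuad lam θ m ∈ 𝓝 w := by
  obtain ⟨x, hx1, hx2⟩ := exists_between (show (lam ^ (m + 1))⁻¹ < (lam ^ m)⁻¹ by gcongr; omega)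
  have hx0 : 0 < x := lt_trans (by positivity) hx1
  refine ⟨-(x : ℂ), ?_⟩
  have hn : ‖-(x : ℂ)‖ = x := by rw [norm_neg, Complex.norm_real, Real.norm_of_nonneg hx0.le]
  have hc : ContinuousAt (fun w : ℂ => |Complex.arg (-w)|) (-(x : ℂ)) := by
    refine ContinuousAt.abs (ContinuousAt.comp (g := Complex.arg) ?_ continuousAt_neg)
    rw [neg_neg]
    exact Complex.continuousAt_arg (Complex.ofReal_mem_slitPlane.2 hx0)
  have h1 : ∀ᶠ w : ℂ in 𝓝 (-(x : ℂ)), |Complex.arg (-w)| < Real.pi - θ := by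
    refine hc.eventually_lt_const ?_
    simp only [neg_neg, Complex.arg_ofReal_of_nonneg hx0.le, abs_zero]
    linarith
  have h2 : ∀ᶠ w : ℂ in 𝓝 (-(x : ℂ)), (lam ^ (m + 1))⁻¹ < ‖w‖ :=
    continuous_norm.continuousAt.eventually_const_lt (hx1.trans_eq hn.symm)
  have h3 : ∀ᶠ w : ℂ in 𝓝 (-(x : ℂ)), ‖w‖ < (lam ^ m)⁻¹ :=
    continuous_norm.continuousAt.eventually_lt_const (hn.trans_lt hx2)
  filter_upwards [h1, h2, h3] with w a1 a2 a3 using ⟨a2.le, a3.le, a1.le⟩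

theorem volume_image_modelQuad_ne_zero {k : ℕ} {b r θ : ℝ} {κ : ℂ → ℂ}
    (hκ : IsLinearizer k b κ r) (hlam : 1 < multiplierAtOne k b) (hθ : θ < Real.pi) {m : ℕ}
    (hm : (multiplierAtOne k b ^ m)⁻¹ < r) :
    volume (κ '' modelQuad (multiplierAtOne k b) θ m) ≠ 0 := by
  intro h0
  obtain ⟨w, hw⟩ := modelQuad_mem_nhds hlam hθ m
  have hsub : modelQuad (multiplierAtOne k b) θ m ⊆ Metric.ball 0 r := fun u hu =>
    mem_ball_zero_iff.2 (hu.2.1.trans_lt hm)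
  have h1 := volume_inter_preimage_eq_zero (f := κ) (Z := modelQuad (multiplierAtOne k b) θ m) h0
    fun u hu => by
      have ha := hκ.holomorphic.analyticAt (Metric.isOpen_ball.mem_nhds (hsub hu))
      exact ⟨ha, deriv_ne_zero_of_injOn ha (Metric.isOpen_ball.mem_nhds (hsub hu)) hκ.injOn⟩
  rw [Set.inter_eq_left.2 (Set.subset_preimage_image _ _)] at h1
  exact (MeasureTheory.Measure.measure_pos_of_mem_nhds volume hw).ne' h1

/-- The dilatation of a disc surgery is not bounded away from `1`. -/
theorem volume_large_dilatation_ne_zero {k : ℕ} {b : ℝ} {φ : OpenPartialHomeomorph ℂ ℂ}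
    {S S₁ : Set ℂ} (hφ : IsDiskSurgery k b φ S S₁) (hlam : 1 < multiplierAtOne k b) {q : ℝ}
    (hq : q < 1) : volume {z ∈ Metric.ball (0 : ℂ) 1 | q < ‖complexDilatation φ z‖} ≠ 0 := by
  obtain ⟨κ, r, θ, m₀, hκ, hθ, hθπ, hm₀, hmr, hS₁, C, hC, hK⟩ := hφ.quads
  obtain ⟨W, -, hSW⟩ := hφ.sector_end
  -- on the quadrilateral of index `m` the real dilatation exceeds `2 / (1 - q)`
  obtain ⟨m, hm⟩ := exists_nat_gt (max (m₀ : ℝ) (C * (2 / (1 - q))))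
  have hmm₀ : m₀ ≤ m := by exact_mod_cast ((le_max_left _ _).trans_lt hm).le
  have hmC : C * (2 / (1 - q)) < m := (le_max_right _ _).trans_lt hm
  intro h0
  have hball : κ '' modelQuad (multiplierAtOne k b) θ m ⊆ Metric.ball 0 1 := fun z hz =>
    hφ.sector_subset (hSW.subset (hS₁ ▸ Set.mem_biUnion (Set.mem_Ici.2 hmm₀) hz)).1
  refine volume_image_modelQuad_ne_zero hκ hlam hθπ (m := m) (lt_of_le_of_lt ?_ hmr)
    (measure_mono_null ?_ (measure_union_null (measure_union_null h0
      (ae_isRegularAt hφ.piecewise)) (ae_iff.1 (hK m hmm₀))))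
  · gcongr
    exact hlam.le
  · intro z hz
    by_contra hn
    simp only [Set.mem_union, not_or, Set.mem_ofPred_eq, not_not, not_and, not_lt] at hn
    obtain ⟨⟨h1, h2⟩, h3⟩ := hn
    have hd := h1 (hball hz)
    have hr := (h2 (hball hz)).norm_complexDilatation_lt
    have hKz := (h3 hz).1
    rw [realDilatation, le_div_iff₀ (by linarith)] at hKz
    have h4 : 2 / (1 - q) < C⁻¹ * m := by
      rw [lt_inv_mul_iff₀ hC]; exact hmC
    have h5 : 2 / (1 - q) * (1 - q) = 2 := div_mul_cancel₀ _ (by linarith)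
    have h6 : 0 < 1 - q := by linarith
    have h7 : 2 / (1 - q) * (1 - ‖complexDilatation φ z‖) <
        C⁻¹ * m * (1 - ‖complexDilatation φ z‖) :=
      mul_lt_mul_of_pos_right h4 (by linarith)
    have h8 : 2 / (1 - q) * (1 - q) ≤ 2 / (1 - q) * (1 - ‖complexDilatation φ z‖) := by
      gcongr
    linarith

/-! ### The invariant form and the topological model in local terms -/

/-- The immediate basins of the marked roots. -/
abbrev markedBasins (p : Polynomial ℂ) {n : ℕ} (ζ : Fin n → ℂ) : Fin n → Set (OnePoint ℂ) :=
  fun j => immediateBasin (newtonMap p) (ζ j)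

theorem surgeryForm_of_first_entry {N : OnePoint ℂ → OnePoint ℂ} {n : ℕ}
    {A : Fin n → Set (OnePoint ℂ)} {ψ φ : Fin n → OpenPartialHomeomorph ℂ ℂ} {z : ℂ} {m : ℕ}
    (hm : N^[m] z ∈ ⋃ j, A j) (hmin : ∀ i < m, N^[i] z ∉ ⋃ j, A j) :
    surgeryForm N A ψ φ z = beltramiPullback (inPlane N^[m]) (coreForm A ψ φ) z := by
  classical
  have hex : ∃ m : ℕ, N^[m] z ∈ ⋃ j, A j := ⟨m, hm⟩
  rw [surgeryForm, dif_pos hex, (Nat.find_eq_iff hex).2 ⟨hm, hmin⟩]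

theorem surgeryForm_of_never {N : OnePoint ℂ → OnePoint ℂ} {n : ℕ}
    {A : Fin n → Set (OnePoint ℂ)} {ψ φ : Fin n → OpenPartialHomeomorph ℂ ℂ} {z : ℂ}
    (h : ∀ m : ℕ, N^[m] z ∉ ⋃ j, A j) : surgeryForm N A ψ φ z = 0 := by
  rw [surgeryForm, dif_neg (by push Not; exact h)]

theorem beltramiPullback_id (μ : ℂ → ℂ) (z : ℂ) : beltramiPullback id μ z = μ z := by
  rw [beltramiPullback_of_differentiableAt differentiableAt_id]
  simp

theorem surgeryForm_of_mem {N : OnePoint ℂ → OnePoint ℂ} {n : ℕ}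
    {A : Fin n → Set (OnePoint ℂ)} {ψ φ : Fin n → OpenPartialHomeomorph ℂ ℂ} {z : ℂ}
    (h : (z : OnePoint ℂ) ∈ ⋃ j, A j) : surgeryForm N A ψ φ z = coreForm A ψ φ z := by
  rw [surgeryForm_of_first_entry (m := 0) h (by simp)]
  exact beltramiPullback_id _ z

section MarkedBasins

variable {p : Polynomial ℂ} {n : ℕ} {ζ c : Fin n → ℂ} {k : Fin n → ℕ} {b : Fin n → ℝ}
  {ψ φ : Fin n → OpenPartialHomeomorph ℂ ℂ} {S S₁ : Fin n → Set ℂ}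

theorem eq_of_mem_markedBasins (h : ∀ j, IsMarkedBasin p (ζ j) (c j) (k j) (b j) (ψ j))
    (hinj : Function.Injective ζ) {i j : Fin n} {x : OnePoint ℂ} (hi : x ∈ markedBasins p ζ i)
    (hj : x ∈ markedBasins p ζ j) : i = j :=
  hinj (eq_of_mem_basin (h i).natDegree (h i).root (h j).root (immediateBasin_subset _ _ hi)
    (immediateBasin_subset _ _ hj))

theorem coreForm_of_mem (h : ∀ j, IsMarkedBasin p (ζ j) (c j) (k j) (b j) (ψ j))
    (hinj : Function.Injective ζ) {j : Fin n} {z : ℂ} (hz : z ∈ (ψ j).source) :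
    coreForm (markedBasins p ζ) ψ φ z =
      beltramiPullback (ψ j) (complexDilatation (φ j)) z := by
  have hzA := (h j).mem_source.1 hz
  rw [coreForm, Finset.sum_eq_single j]
  · exact Set.indicator_of_mem (s := {z : ℂ | (z : OnePoint ℂ) ∈ markedBasins p ζ j}) hzA _
  · intro i _ hij
    refine Set.indicator_of_notMem (s := {z : ℂ | (z : OnePoint ℂ) ∈ markedBasins p ζ i}) ?_ _
    exact fun hi => hij (eq_of_mem_markedBasins h hinj hi hzA)
  · intro hj
    exact absurd (Finset.mem_univ j) hj

theorem modelMap_of_mem (h : ∀ j, IsMarkedBasin p (ζ j) (c j) (k j) (b j) (ψ j))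
    (hinj : Function.Injective ζ) {j : Fin n} {z : ℂ} (hz : z ∈ (ψ j).source) :
    modelMap (newtonMap p) (markedBasins p ζ) k ψ φ z =
      ((ψ j).symm ((φ j).symm (parabolicBlaschke (k j) (φ j (ψ j z)))) : ℂ) := by
  have hzA := (h j).mem_source.1 hz
  have hex : ∃ j, (z : OnePoint ℂ) ∈ markedBasins p ζ j := ⟨j, hzA⟩
  have hj : hex.choose = j := eq_of_mem_markedBasins h hinj hex.choose_spec hzA
  rw [modelMap, dif_pos hex]
  simp only [hj, toPlane_coe]

theorem modelMap_of_notMem {x : OnePoint ℂ} (hx : x ∉ ⋃ j, markedBasins p ζ j) :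
    modelMap (newtonMap p) (markedBasins p ζ) k ψ φ x = newtonMap p x := by
  rw [modelMap, dif_neg]
  simpa using hx

theorem norm_surgeryForm (h : ∀ j, IsMarkedBasin p (ζ j) (c j) (k j) (b j) (ψ j))
    (hinj : Function.Injective ζ) {m : ℕ} {j : Fin n} {z w : ℂ} (hzw : (newtonMap p)^[m] z = w)
    (hw : w ∈ (ψ j).source) (hmin : ∀ i < m, (newtonMap p)^[i] z ∉ ⋃ j, markedBasins p ζ j)
    (hd : deriv (inPlane (newtonMap p)^[m]) z ≠ 0) :
    ‖surgeryForm (newtonMap p) (markedBasins p ζ) ψ φ z‖ =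
      ‖complexDilatation (φ j) (ψ j w)‖ := by
  have hne : (newtonMap p)^[m] z ≠ OnePoint.infty := hzw ▸ OnePoint.coe_ne_infty w
  have hw' : inPlane (newtonMap p)^[m] z = w := by rw [inPlane, hzw, toPlane_coe]
  rw [surgeryForm_of_first_entry (m := m)
    (Set.mem_iUnion.2 ⟨j, by rw [hzw]; exact (h j).mem_source.1 hw⟩) hmin,
    norm_beltramiPullback (analyticAt_inPlane_iterate (h j).natDegree hne).differentiableAt hd, hw',
    coreForm_of_mem h hinj hw,
    norm_beltramiPullback ((h j).analyticAt hw).differentiableAt ((h j).deriv_ne_zero hw)]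

/-- Almost every orbit avoids a given null set and the critical points. -/
theorem ae_orbit_avoids (hp : 2 ≤ p.natDegree) {E : Set ℂ} (hE : volume E = 0) :
    ∀ᵐ z : ℂ, ∀ (m : ℕ) (w : ℂ), (newtonMap p)^[m] z = w →
      w ∉ E ∧ deriv (inPlane (newtonMap p)^[m]) z ≠ 0 := by
  set Cr : Set ℂ := {z | newtonMap p z ≠ OnePoint.infty ∧ deriv (inPlane (newtonMap p)) z = 0}
  have hCr : volume Cr = 0 := (finite_setOf_deriv_eq_zero hp).measure_zero _
  have h1 : ∀ᵐ z : ℂ, ∀ m : ℕ, ¬ ∃ w ∈ E ∪ Cr, (newtonMap p)^[m] z = w := by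
    refine ae_all_iff.2 fun m => ?_
    rw [ae_iff]
    simp only [not_not]
    exact volume_iterate_preimage_eq_zero hp (measure_union_null hE hCr) m
  refine h1.mono fun z hz m w hw => ⟨fun hwE => hz m ⟨w, Or.inl hwE, hw⟩, ?_⟩
  have hne : (newtonMap p)^[m] z ≠ OnePoint.infty := hw ▸ OnePoint.coe_ne_infty w
  refine deriv_inPlane_iterate_ne_zero hp hne fun i hi hd => ?_
  have h2 := coe_inPlane (iterate_ne_infty_of_le hi.le hne)
  refine hz i ⟨inPlane (newtonMap p)^[i] z, Or.inr ⟨?_, hd⟩, h2.symm⟩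
  rw [h2, ← Function.iterate_succ_apply' (newtonMap p)]
  exact iterate_ne_infty_of_le hi hne

theorem IsMarkedBasin.volume_preimage_eq_zero {v c₀ : ℂ} {k₀ : ℕ} {b₀ : ℝ}
    {ψ₀ : OpenPartialHomeomorph ℂ ℂ} (h : IsMarkedBasin p v c₀ k₀ b₀ ψ₀) {E : Set ℂ}
    (hE : volume E = 0) : volume {z ∈ ψ₀.source | ψ₀ z ∈ E} = 0 :=
  volume_inter_preimage_eq_zero hE fun _ hz => ⟨h.analyticAt hz, h.deriv_ne_zero hz⟩

/-! ### Measurability -/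

theorem measurable_dz (f : ℂ → ℂ) : Measurable (dz f) := by
  have h1 := measurable_fderiv_apply_const ℝ f 1
  have h2 := measurable_fderiv_apply_const ℝ f Complex.I
  exact (h1.sub (h2.const_mul _)).div_const 2

theorem measurable_dzbar (f : ℂ → ℂ) : Measurable (dzbar f) := by
  have h1 := measurable_fderiv_apply_const ℝ f 1
  have h2 := measurable_fderiv_apply_const ℝ f Complex.I
  exact (h1.add (h2.const_mul _)).div_const 2

theorem measurable_complexDilatation (f : ℂ → ℂ) : Measurable (complexDilatation f) := by
  have : complexDilatation f = fun z => dzbar f z / dz f z :=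
    funext fun z => complexDilatation_apply f z
  rw [this]
  exact (measurable_dzbar f).div (measurable_dz f)

theorem measurable_pullback_formula (f : ℂ → ℂ) {ν : ℂ → ℂ} (hν : Measurable ν) :
    Measurable fun z => (dzbar f z + ν z * conj (dz f z)) / (dz f z + ν z * conj (dzbar f z)) := by
  have h1 := measurable_dz f
  have h2 := measurable_dzbar f
  have hc : Measurable (conj : ℂ → ℂ) := Complex.continuous_conj.measurable
  exact (h2.add (hν.mul (hc.comp h1))).div (h1.add (hν.mul (hc.comp h2)))

/-- The measurability of the function outside `s` is not required: there it is replaced by `0`. -/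
theorem measurable_indicator_pullback {s : Set ℂ} (hs : IsOpen s) {f μ : ℂ → ℂ}
    (hf : ContinuousOn f s) (hμ : Measurable μ) :
    Measurable (s.indicator (beltramiPullback f μ)) := by
  classical
  have hfm : Measurable (s.indicator f) := by
    have := ContinuousOn.measurable_piecewise (g := fun _ => (0 : ℂ)) hf continuousOn_const
      hs.measurableSet
    rw [← Set.piecewise_eq_indicator]
    exact this
  have heq : s.indicator (beltramiPullback f μ) = s.indicator fun z =>
      (dzbar f z + μ (s.indicator f z) * conj (dz f z)) /
        (dz f z + μ (s.indicator f z) * conj (dzbar f z)) := by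
    refine Set.indicator_congr fun z hz => ?_
    rw [beltramiPullback, Set.indicator_of_mem hz]
  rw [heq]
  exact (measurable_pullback_formula f (hμ.comp hfm)).indicator hs.measurableSet

theorem measurable_coreForm (h : ∀ j, IsMarkedBasin p (ζ j) (c j) (k j) (b j) (ψ j)) :
    Measurable (coreForm (markedBasins p ζ) ψ φ) := by
  have : coreForm (markedBasins p ζ) ψ φ = fun z => ∑ j,
      {z : ℂ | (z : OnePoint ℂ) ∈ markedBasins p ζ j}.indicator
        (beltramiPullback (ψ j) (complexDilatation (φ j))) z := rfl
  rw [this]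
  refine Finset.measurable_fun_sum _ fun j _ => ?_
  have hs := (h j).riemann.source
  refine measurable_indicator_pullback ?_ ?_ (measurable_complexDilatation _)
  · rw [← hs]; exact (ψ j).open_source
  · rw [← hs]; exact (h j).riemann.holomorphic.continuousOn

theorem measurable_inPlane_iterate (hp : 2 ≤ p.natDegree) (m : ℕ) :
    Measurable (inPlane (newtonMap p)^[m]) := by
  classical
  have hc := (continuous_newtonMap hp).iterate m
  have ho : IsOpen {z : ℂ | (newtonMap p)^[m] z ≠ OnePoint.infty} :=
    isClosed_singleton.isOpen_compl.preimage (hc.comp OnePoint.continuous_coe)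
  have := ContinuousOn.measurable_piecewise (g := fun _ => (0 : ℂ)) (continuousOn_inPlane hc)
    continuousOn_const ho.measurableSet
  convert! this using 1
  ext z
  by_cases hz : (newtonMap p)^[m] z ≠ OnePoint.infty
  · rw [Set.piecewise_eq_of_mem _ _ _ hz]
  · rw [Set.piecewise_eq_of_notMem _ _ _ hz, inPlane, not_not.1 hz]
    rfl

theorem measurable_surgeryForm (hp : 2 ≤ p.natDegree)
    (h : ∀ j, IsMarkedBasin p (ζ j) (c j) (k j) (b j) (ψ j)) :
    Measurable (surgeryForm (newtonMap p) (markedBasins p ζ) ψ φ) := by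
  have hopen : ∀ m : ℕ, IsOpen {z : ℂ | (newtonMap p)^[m] z ∈ ⋃ j, markedBasins p ζ j} := fun m =>
    (isOpen_iUnion fun j => (h j).isOpen_basin).preimage
      (((continuous_newtonMap hp).iterate m).comp OnePoint.continuous_coe)
  set M : ℕ → Set ℂ := fun m => {z : ℂ | (newtonMap p)^[m] z ∈ ⋃ j, markedBasins p ζ j} ∩
    ⋂ i ∈ Finset.range m, {z : ℂ | (newtonMap p)^[i] z ∈ ⋃ j, markedBasins p ζ j}ᶜ with hM
  have hMm : ∀ m, MeasurableSet (M m) := fun m => (hopen m).measurableSet.inter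
    (Finset.measurableSet_biInter _ fun i _ => (hopen i).measurableSet.compl)
  set F : ℕ → ℂ → ℂ := fun m => beltramiPullback (inPlane (newtonMap p)^[m])
    (coreForm (markedBasins p ζ) ψ φ) with hF
  have hFm : ∀ m, Measurable (F m) := fun m => measurable_pullback_formula _
    ((measurable_coreForm h).comp (measurable_inPlane_iterate hp m))
  have hon : ∀ m, ∀ z ∈ M m, surgeryForm (newtonMap p) (markedBasins p ζ) ψ φ z = F m z := by
    rintro m z ⟨hz1, hz2⟩
    refine surgeryForm_of_first_entry hz1 fun i hi => ?_
    exact Set.mem_iInter₂.1 hz2 i (Finset.mem_range.2 hi)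
  have hoff : ∀ z, (∀ m, z ∉ M m) → surgeryForm (newtonMap p) (markedBasins p ζ) ψ φ z = 0 := by
    intro z hz
    refine surgeryForm_of_never fun m => ?_
    induction m using Nat.strong_induction_on with
    | _ m ih =>
      intro hm
      exact hz m ⟨hm, Set.mem_iInter₂.2 fun i hi => ih i (Finset.mem_range.1 hi)⟩
  -- the form is glued from countably many measurable functions on disjoint measurable sets
  intro B hB
  have hset : surgeryForm (newtonMap p) (markedBasins p ζ) ψ φ ⁻¹' B =
      (⋃ m, M m ∩ F m ⁻¹' B) ∪ ((⋃ m, M m)ᶜ ∩ {_z | (0 : ℂ) ∈ B}) := by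
    ext z
    by_cases hz : ∃ m, z ∈ M m
    · obtain ⟨m, hm⟩ := hz
      constructor
      · intro hzB
        exact Or.inl (Set.mem_iUnion.2 ⟨m, hm, by rw [Set.mem_preimage, ← hon m z hm]; exact hzB⟩)
      · rintro (hz | ⟨hz, -⟩)
        · obtain ⟨m', hm', hzB⟩ := Set.mem_iUnion.1 hz
          rw [Set.mem_preimage, hon m' z hm']
          exact hzB
        · exact absurd (Set.mem_iUnion.2 ⟨m, hm⟩) hz
    · push Not at hz
      rw [Set.mem_preimage, hoff z hz]
      constructor
      · exact fun h0 => Or.inr ⟨by simpa using hz, h0⟩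
      · rintro (hz' | ⟨-, h0⟩)
        · obtain ⟨m, hm, -⟩ := Set.mem_iUnion.1 hz'
          exact absurd hm (hz m)
        · exact h0
  rw [hset]
  exact (MeasurableSet.iUnion fun m => (hMm m).inter (hFm m hB)).union
    ((MeasurableSet.iUnion hMm).compl.inter (MeasurableSet.const _))

end MarkedBasins

/-! ### Invariance of the form -/

/-- Two maps that agree on a measurable set have the same derivative at almost every point of the
set at which both are differentiable. -/
theorem ae_fderiv_eq_of_eqOn {f g : ℂ → ℂ} {s : Set ℂ} (hs : MeasurableSet s) (hfg : Set.EqOn f g s)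
    (hf : ∀ z ∈ s, DifferentiableAt ℝ f z) (hg : ∀ z ∈ s, DifferentiableAt ℝ g z) :
    ∀ᵐ z : ℂ, z ∈ s → fderiv ℝ f z = fderiv ℝ g z := by
  have happ : ApproximatesLinearOn (f - g) (0 : ℂ →L[ℝ] ℂ) s 0 := fun x hx y hy => by
    simp [hfg hx, hfg hy]
  have h1 := happ.norm_fderiv_sub_le volume hs (fun z => fderiv ℝ f z - fderiv ℝ g z) fun z hz =>
    ((hf z hz).hasFDerivAt.sub (hg z hz).hasFDerivAt).hasFDerivWithinAt
  rw [ae_restrict_iff' hs] at h1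
  refine h1.mono fun z hz hzs => ?_
  have := hz hzs
  simpa [sub_eq_zero] using this

theorem beltramiPullback_eq_zero_of_dzbar {f μ : ℂ → ℂ} {z : ℂ} (h : dzbar f z = 0)
    (hμ : μ (f z) = 0) : beltramiPullback f μ z = 0 := by
  simp [beltramiPullback, h, hμ]

theorem IsRegularAt.beltramiPullback_comp {φ ψ : ℂ → ℂ} {z : ℂ} (hφ : IsRegularAt φ (ψ z))
    (hψ : DifferentiableAt ℂ ψ z) : beltramiPullback (fun w => φ (ψ w)) 0 z =
      beltramiPullback ψ (complexDilatation φ) z :=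
  NewtonSurgery.beltramiPullback_comp hφ.1 (hψ.restrictScalars ℝ) (by simpa using hφ.dz_ne_zero)

/-- On a marked immediate basin, the model map is conjugate to the parabolic Blaschke product by
`φ ∘ ψ`, and the form is the pull-back of the standard structure under `φ ∘ ψ`. -/
theorem IsMarkedBasin.beltramiPullback_model_eq {p : Polynomial ℂ} {v c : ℂ} {k : ℕ} {b : ℝ}
    {ψ φ : OpenPartialHomeomorph ℂ ℂ} {S S₁ : Set ℂ} (h : IsMarkedBasin p v c k b ψ)
    (hφ : IsDiskSurgery k b φ S S₁) {z : ℂ} (hz : z ∈ ψ.source) (hreg : IsRegularAt φ (ψ z))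
    (hφz : φ (ψ z) ≠ 0)
    (hreg' : IsRegularAt φ (φ.symm (parabolicBlaschke k (φ (ψ z))))) {μ : ℂ → ℂ}
    (hμ : ∀ w ∈ ψ.source, μ w = beltramiPullback ψ (complexDilatation φ) w) :
    beltramiPullback (fun w => ψ.symm (φ.symm (parabolicBlaschke k (φ (ψ w))))) μ z = μ z := by
  obtain ⟨ha0, ha1⟩ := parabolic_parameter h.two_le
  set g : ℂ → ℂ := fun w => ψ.symm (φ.symm (parabolicBlaschke k (φ (ψ w)))) with hg
  have hball : ∀ w ∈ ψ.source, φ (ψ w) ∈ Metric.ball (0 : ℂ) 1 := fun w hw =>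
    hφ.target ▸ φ.map_source (hφ.source ▸ h.mem_ball hw)
  have hPball : ∀ w ∈ ψ.source, parabolicBlaschke k (φ (ψ w)) ∈ Metric.ball (0 : ℂ) 1 :=
    fun w hw => NewtonSurgery.blaschke_mem_ball ha0 ha1 h.ne_zero_degree (hball w hw)
  have hsymm : ∀ w ∈ ψ.source,
      φ.symm (parabolicBlaschke k (φ (ψ w))) ∈ Metric.ball (0 : ℂ) 1 := fun w hw =>
    hφ.source ▸ φ.map_target (hφ.target.symm ▸ hPball w hw)
  have hψg : ∀ w ∈ ψ.source, ψ (g w) = φ.symm (parabolicBlaschke k (φ (ψ w))) := fun w hw =>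
    h.apply_symm (hsymm w hw)
  have hgs : g z ∈ ψ.source := h.symm_mem (hsymm z hz)
  have hψd : DifferentiableAt ℂ ψ z := (h.analyticAt hz).differentiableAt
  have hFd : DifferentiableAt ℝ (fun w => φ (ψ w)) z :=
    hreg.1.comp z (hψd.restrictScalars ℝ)
  have hPd : DifferentiableAt ℂ (parabolicBlaschke k) (φ (ψ z)) :=
    (hasDerivAt_blaschke ha0 ha1 k (hball z hz)).differentiableAt
  have hP' : deriv (parabolicBlaschke k) (φ (ψ z)) ≠ 0 :=
    deriv_blaschke_ne_zero ha0 ha1 h.ne_zero_degree (hball z hz) hφz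
  have hgd : DifferentiableAt ℝ g z := by
    have e1 : DifferentiableAt ℝ (fun w => parabolicBlaschke k (φ (ψ w))) z :=
      (hPd.restrictScalars ℝ).comp z hFd
    have e2 : DifferentiableAt ℝ φ.symm (parabolicBlaschke k (φ (ψ z))) := by
      have := hreg'.differentiableAt_symm (hφ.source ▸ hsymm z hz)
      rwa [φ.right_inv (hφ.target.symm ▸ hPball z hz)] at this
    have e3 : DifferentiableAt ℝ ψ.symm (φ.symm (parabolicBlaschke k (φ (ψ z)))) :=
      (h.hasDerivAt_symm (hsymm z hz)).differentiableAt.restrictScalars ℝ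
    exact e3.comp z (e2.comp z e1)
  have hregg : IsRegularAt φ (ψ (g z)) := by rw [hψg z hz]; exact hreg'
  have hψgd : DifferentiableAt ℂ ψ (g z) := (h.analyticAt hgs).differentiableAt
  have hdzF : dz (fun w => φ (ψ w)) (g z) ≠ 0 := by
    rw [(dz_comp hregg.1 (hψgd.restrictScalars ℝ)).1, (dz_of_differentiableAt hψgd).1,
      (dz_of_differentiableAt hψgd).2]
    simpa using ⟨hregg.dz_ne_zero, h.deriv_ne_zero hgs⟩
  have hμF : ∀ w ∈ ψ.source, IsRegularAt φ (ψ w) →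
      μ w = beltramiPullback (fun w => φ (ψ w)) 0 w := fun w hw hr => by
    rw [hμ w hw, hr.beltramiPullback_comp (h.analyticAt hw).differentiableAt]
  have h1 : beltramiPullback (fun w => (fun u => φ (ψ u)) (g w)) 0 z =
      beltramiPullback g (beltramiPullback (fun w => φ (ψ w)) 0) z :=
    NewtonSurgery.beltramiPullback_comp (hregg.1.comp _ (hψgd.restrictScalars ℝ)) hgd
      (by rw [Pi.zero_apply, zero_mul, add_zero]; exact hdzF)
  have h2 : beltramiPullback (fun w => parabolicBlaschke k ((fun u => φ (ψ u)) w)) 0 z =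
      beltramiPullback (fun w => φ (ψ w)) (beltramiPullback (parabolicBlaschke k) 0) z :=
    beltramiPullback_comp_holomorphic hPd hFd hP'
  have h3 : beltramiPullback (fun w => φ (ψ w)) (beltramiPullback (parabolicBlaschke k) 0) z =
      beltramiPullback (fun w => φ (ψ w)) 0 z :=
    beltramiPullback_congr Filter.EventuallyEq.rfl (complexDilatation_of_differentiableAt hPd)
  have hev : (fun w => (fun u => φ (ψ u)) (g w)) =ᶠ[𝓝 z]
      fun w => parabolicBlaschke k ((fun u => φ (ψ u)) w) := by
    filter_upwards [ψ.open_source.mem_nhds hz] with w hw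
    simp only [hψg w hw]
    exact φ.right_inv (hφ.target.symm ▸ hPball w hw)
  have h4 := beltramiPullback_congr (μ := 0) (ν := 0) hev rfl
  have h5 : beltramiPullback g μ z =
      beltramiPullback g (beltramiPullback (fun w => φ (ψ w)) 0) z :=
    beltramiPullback_congr Filter.EventuallyEq.rfl (hμF _ hgs hregg)
  rw [h5, ← h1, h4, h2, h3, ← hμF z hz hreg]

/-- The exceptional points of the disc have measure zero. -/
theorem IsMarkedBasin.volume_exceptional {p : Polynomial ℂ} {v c : ℂ} {k : ℕ} {b : ℝ}
    {ψ φ : OpenPartialHomeomorph ℂ ℂ} {S S₁ : Set ℂ} (h : IsMarkedBasin p v c k b ψ)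
    (hφ : IsDiskSurgery k b φ S S₁) :
    volume {u ∈ Metric.ball (0 : ℂ) 1 | ¬ (IsRegularAt φ u ∧ φ u ≠ 0 ∧
      IsRegularAt φ (φ.symm (parabolicBlaschke k (φ u))))} = 0 := by
  obtain ⟨ha0, ha1⟩ := parabolic_parameter h.two_le
  set Irr : Set ℂ := {u ∈ Metric.ball (0 : ℂ) 1 | ¬ IsRegularAt φ u}
  have hIrr : volume Irr = 0 := ae_isRegularAt hφ.piecewise
  have h1 := volume_iterate_blaschke_preimage ha0 ha1 h.ne_zero_degree
    (volume_image_eq_zero hφ.piecewise (fun u hu => hu.1) hIrr) 1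
  refine measure_mono_null ?_ (measure_union_null hIrr (measure_union_null
    (NewtonSurgery.volume_preimage_eq_zero hφ.piecewise hφ.source (measure_singleton (0 : ℂ)))
    (NewtonSurgery.volume_preimage_eq_zero hφ.piecewise hφ.source h1)))
  rintro u ⟨hu, hbad⟩
  by_contra hn
  simp only [Set.mem_union, not_or] at hn
  obtain ⟨n1, n2, n3⟩ := hn
  have hφu : φ u ∈ Metric.ball (0 : ℂ) 1 := hφ.target ▸ φ.map_source (hφ.source ▸ hu)
  have hPu : parabolicBlaschke k (φ u) ∈ φ.target :=
    hφ.target.symm ▸ NewtonSurgery.blaschke_mem_ball ha0 ha1 h.ne_zero_degree hφu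
  refine hbad ⟨?_, fun h0 => n2 ⟨hu, h0⟩, ?_⟩
  · by_contra hr
    exact n1 ⟨hu, hr⟩
  · by_contra hr
    refine n3 ⟨hu, hφu, φ.symm (parabolicBlaschke k (φ u)), ⟨?_, hr⟩, φ.right_inv hPu⟩
    rw [← hφ.source]
    exact φ.map_target hPu

section MarkedBasins

variable {p : Polynomial ℂ} {n : ℕ} {ζ c : Fin n → ℂ} {k : Fin n → ℕ} {b : Fin n → ℝ}
  {ψ φ : Fin n → OpenPartialHomeomorph ℂ ℂ} {S S₁ : Fin n → Set ℂ}

theorem ae_invariant_of_mem (h : ∀ j, IsMarkedBasin p (ζ j) (c j) (k j) (b j) (ψ j))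
    (hinj : Function.Injective ζ) (hφ : ∀ j, IsDiskSurgery (k j) (b j) (φ j) (S j) (S₁ j)) :
    ∀ᵐ z : ℂ, (z : OnePoint ℂ) ∈ ⋃ j, markedBasins p ζ j →
      beltramiPullback (inPlane (modelMap (newtonMap p) (markedBasins p ζ) k ψ φ))
        (surgeryForm (newtonMap p) (markedBasins p ζ) ψ φ) z =
      surgeryForm (newtonMap p) (markedBasins p ζ) ψ φ z := by
  have hnull : ∀ᵐ z : ℂ, ∀ j, ¬ (z ∈ (ψ j).source ∧ ψ j z ∈
      {u ∈ Metric.ball (0 : ℂ) 1 | ¬ (IsRegularAt (φ j) u ∧ φ j u ≠ 0 ∧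
      IsRegularAt (φ j) ((φ j).symm (parabolicBlaschke (k j) (φ j u))))}) := by
    refine ae_all_iff.2 fun j => ?_
    rw [ae_iff]
    simp only [not_not]
    exact (h j).volume_preimage_eq_zero ((h j).volume_exceptional (hφ j))
  refine hnull.mono fun z hz hzA => ?_
  obtain ⟨j, hj⟩ := Set.mem_iUnion.1 hzA
  have hzs := (h j).mem_source.2 hj
  obtain ⟨hr1, hr2, hr3⟩ : IsRegularAt (φ j) (ψ j z) ∧ φ j (ψ j z) ≠ 0 ∧
      IsRegularAt (φ j) ((φ j).symm (parabolicBlaschke (k j) (φ j (ψ j z)))) := by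
    by_contra hn
    exact hz j ⟨hzs, (h j).mem_ball hzs, hn⟩
  have hμ : ∀ w ∈ (ψ j).source, surgeryForm (newtonMap p) (markedBasins p ζ) ψ φ w =
      beltramiPullback (ψ j) (complexDilatation (φ j)) w := fun w hw => by
    rw [surgeryForm_of_mem (Set.mem_iUnion.2 ⟨j, (h j).mem_source.1 hw⟩), coreForm_of_mem h hinj hw]
  rw [← (h j).beltramiPullback_model_eq (hφ j) hzs hr1 hr2 hr3 hμ]
  have hev : inPlane (modelMap (newtonMap p) (markedBasins p ζ) k ψ φ) =ᶠ[𝓝 z]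
      fun w => (ψ j).symm ((φ j).symm (parabolicBlaschke (k j) (φ j (ψ j w)))) := by
    filter_upwards [(ψ j).open_source.mem_nhds hzs] with w hw
    rw [inPlane, modelMap_of_mem h hinj hw, toPlane_coe]
  exact beltramiPullback_congr hev rfl

/-- Near a point of a marked basin outside the marked immediate basins, the model map is the Newton
map. -/
theorem modelMap_eventuallyEq (h : ∀ j, IsMarkedBasin p (ζ j) (c j) (k j) (b j) (ψ j)) {j : Fin n}
    {z : ℂ} (hz : (z : OnePoint ℂ) ∈ basin (newtonMap p) (ζ j))
    (hzA : (z : OnePoint ℂ) ∉ ⋃ j, markedBasins p ζ j) :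
    inPlane (modelMap (newtonMap p) (markedBasins p ζ) k ψ φ) =ᶠ[𝓝 z] inPlane (newtonMap p) := by
  have hcl : ∀ i, (z : OnePoint ℂ) ∉ closure (markedBasins p ζ i) := by
    intro i hi
    have h1 := eq_of_mem_closure_of_mem_basin (h i).natDegree (h i).root (h j).root hi hz
    rw [← h1] at hz
    exact hzA (Set.mem_iUnion.2 ⟨i, mem_immediateBasin_of_mem_closure (h i).natDegree (h i).root
      hi hz⟩)
  have hev : ∀ᶠ w : ℂ in 𝓝 z, ∀ i, (w : OnePoint ℂ) ∉ closure (markedBasins p ζ i) := by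
    refine eventually_all.2 fun i => ?_
    exact (isClosed_closure.isOpen_compl.preimage OnePoint.continuous_coe).mem_nhds (hcl i)
  filter_upwards [hev] with w hw
  rw [inPlane, modelMap_of_notMem, inPlane]
  rw [Set.mem_iUnion]
  rintro ⟨i, hi⟩
  exact hw i (subset_closure hi)

/-- Outside the immediate basins, but on points that enter them, the model map is the Newton map and
the form is defined by pulling back. -/
theorem ae_invariant_of_enters (hp : 2 ≤ p.natDegree)
    (h : ∀ j, IsMarkedBasin p (ζ j) (c j) (k j) (b j) (ψ j)) :
    ∀ᵐ z : ℂ, (z : OnePoint ℂ) ∉ ⋃ j, markedBasins p ζ j →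
      (∃ m : ℕ, (newtonMap p)^[m] z ∈ ⋃ j, markedBasins p ζ j) →
      beltramiPullback (inPlane (modelMap (newtonMap p) (markedBasins p ζ) k ψ φ))
        (surgeryForm (newtonMap p) (markedBasins p ζ) ψ φ) z =
      surgeryForm (newtonMap p) (markedBasins p ζ) ψ φ z := by
  classical
  refine (ae_orbit_avoids hp (measure_empty (μ := volume))).mono fun z hz hzA hex => ?_
  obtain ⟨m, hm⟩ : ∃ m, Nat.find hex = m + 1 := by
    refine Nat.exists_eq_succ_of_ne_zero fun h0 => hzA ?_
    have := Nat.find_spec hex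
    rwa [h0] at this
  have hspec := Nat.find_spec hex
  have hmin := fun i => Nat.find_min hex (m := i)
  rw [hm] at hspec hmin
  obtain ⟨j, hj⟩ := Set.mem_iUnion.1 hspec
  have hne : (newtonMap p)^[m + 1] z ≠ OnePoint.infty :=
    ne_infty_of_mem_immediateBasin hp (h j).root hj
  have hzb : (z : OnePoint ℂ) ∈ basin (newtonMap p) (ζ j) :=
    (iterate_mem_basin_iff hp (h j).root (m + 1) z).1 (immediateBasin_subset _ _ hj)
  have hNz : newtonMap p z ≠ OnePoint.infty :=
    iterate_ne_infty_of_le (i := 1) (by omega) hne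
  set u := inPlane (newtonMap p) z with hu
  have huz : (u : OnePoint ℂ) = newtonMap p z := coe_inPlane hNz
  have hμu : surgeryForm (newtonMap p) (markedBasins p ζ) ψ φ u =
      beltramiPullback (inPlane (newtonMap p)^[m]) (coreForm (markedBasins p ζ) ψ φ) u := by
    refine surgeryForm_of_first_entry ?_ fun i hi => ?_
    · rw [huz, ← Function.iterate_succ_apply]; exact hspec
    · rw [huz, ← Function.iterate_succ_apply]; exact hmin (i + 1) (by omega)
  have hneu : (newtonMap p)^[m] u ≠ OnePoint.infty := by
    rw [huz, ← Function.iterate_succ_apply]; exact hne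
  have hp0 : p ≠ 0 := (h j).ne_zero
  have hNd : DifferentiableAt ℂ (inPlane (newtonMap p)) z :=
    (analyticAt_inPlane_newtonMap hp0 hNz).differentiableAt
  have hmd : DifferentiableAt ℂ (inPlane (newtonMap p)^[m]) u :=
    (analyticAt_inPlane_iterate hp hneu).differentiableAt
  have hev : inPlane (newtonMap p)^[m + 1] =ᶠ[𝓝 z]
      fun w => inPlane (newtonMap p)^[m] (inPlane (newtonMap p) w) := by
    filter_upwards [eventually_iterate_ne_infty hp (m := 1) hNz] with w hw
    exact inPlane_iterate_succ' hw
  have hd : deriv (inPlane (newtonMap p)^[m]) u ≠ 0 := by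
    have h1 := (hz (m + 1) (inPlane (newtonMap p)^[m + 1] z) (coe_inPlane hne).symm).2
    rw [hev.deriv_eq] at h1
    intro h0
    apply h1
    have h2 := HasDerivAt.comp z (hmd.hasDerivAt) hNd.hasDerivAt
    rw [h0, zero_mul] at h2
    exact h2.deriv
  rw [beltramiPullback_congr (modelMap_eventuallyEq h hzb hzA) (ν := beltramiPullback
      (inPlane (newtonMap p)^[m]) (coreForm (markedBasins p ζ) ψ φ)) hμu,
    surgeryForm_of_first_entry hspec hmin,
    ← beltramiPullback_comp_holomorphic hmd (hNd.restrictScalars ℝ) hd]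
  exact (beltramiPullback_congr hev rfl).symm

/-- Where the form vanishes because the orbit never enters the marked immediate basins, the model
map agrees with the holomorphic Newton map only on a closed set that may have empty interior. At
almost every point of this set at which the model map is differentiable, the derivatives agree. -/
theorem ae_invariant_of_never (hp : 2 ≤ p.natDegree)
    (h : ∀ j, IsMarkedBasin p (ζ j) (c j) (k j) (b j) (ψ j)) :
    ∀ᵐ z : ℂ, (∀ m : ℕ, (newtonMap p)^[m] z ∉ ⋃ j, markedBasins p ζ j) →
      beltramiPullback (inPlane (modelMap (newtonMap p) (markedBasins p ζ) k ψ φ))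
        (surgeryForm (newtonMap p) (markedBasins p ζ) ψ φ) z =
      surgeryForm (newtonMap p) (markedBasins p ζ) ψ φ z := by
  have hp0 : p ≠ 0 := by rintro rfl; simp at hp
  set G := inPlane (modelMap (newtonMap p) (markedBasins p ζ) k ψ φ) with hG
  have hAo : IsOpen {z : ℂ | (z : OnePoint ℂ) ∈ ⋃ j, markedBasins p ζ j} :=
    (isOpen_iUnion fun j => (h j).isOpen_basin).preimage OnePoint.continuous_coe
  have hPo : IsOpen {z : ℂ | newtonMap p z ≠ OnePoint.infty} :=
    isClosed_singleton.isOpen_compl.preimage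
      ((continuous_newtonMap hp).comp OnePoint.continuous_coe)
  set s : Set ℂ := ({z : ℂ | (z : OnePoint ℂ) ∈ ⋃ j, markedBasins p ζ j}ᶜ ∩
    {z : ℂ | newtonMap p z ≠ OnePoint.infty}) ∩ {z | DifferentiableAt ℝ G z}
  have hs : MeasurableSet s := (hAo.measurableSet.compl.inter hPo.measurableSet).inter
    (measurableSet_of_differentiableAt ℝ G)
  have hpoles : ∀ᵐ z : ℂ, newtonMap p z ≠ OnePoint.infty := by
    have hd : p.derivative ≠ 0 := by
      intro h0
      have := Polynomial.natDegree_derivative (p := p)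
      rw [h0, Polynomial.natDegree_zero] at this
      omega
    refine measure_mono_null ?_ ((p.derivative.roots.toFinset.finite_toSet).measure_zero volume)
    intro z hz
    have hz' : newtonMap p z = OnePoint.infty := not_not.1 hz
    rw [Finset.mem_coe, Multiset.mem_toFinset, Polynomial.mem_roots hd]
    exact (newtonMap_coe_eq_infty_iff.1 hz').1
  have hGN : Set.EqOn G (inPlane (newtonMap p)) s := fun z hz => by
    rw [hG, inPlane, modelMap_of_notMem hz.1.1, inPlane]
  have hae := ae_fderiv_eq_of_eqOn hs hGN (fun z hz => hz.2) fun z hz =>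
    (analyticAt_inPlane_newtonMap hp0 hz.1.2).differentiableAt.restrictScalars ℝ
  filter_upwards [hpoles, hae] with z hNz hfd hnever
  rw [surgeryForm_of_never hnever]
  by_cases hGd : DifferentiableAt ℝ G z
  · have hzs : z ∈ s := ⟨⟨hnever 0, hNz⟩, hGd⟩
    refine beltramiPullback_eq_zero_of_dzbar ?_ ?_
    · have h1 := (dz_of_differentiableAt
        (analyticAt_inPlane_newtonMap hp0 hNz).differentiableAt).2
      rw [dzbar, hfd hzs]
      exact h1
    · rw [hGN hzs]
      refine surgeryForm_of_never fun m => ?_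
      rw [coe_inPlane hNz, ← Function.iterate_succ_apply]
      exact hnever (m + 1)
  -- where the model map is not differentiable, the pull-back has the value `0` by convention
  · simp [beltramiPullback, dz, dzbar, fderiv_zero_of_not_differentiableAt hGd]

/-- The form is invariant under the topological model. -/
theorem ae_invariant (hp : 2 ≤ p.natDegree)
    (h : ∀ j, IsMarkedBasin p (ζ j) (c j) (k j) (b j) (ψ j))
    (hinj : Function.Injective ζ) (hφ : ∀ j, IsDiskSurgery (k j) (b j) (φ j) (S j) (S₁ j)) :
    ∀ᵐ z : ℂ, beltramiPullback (inPlane (modelMap (newtonMap p) (markedBasins p ζ) k ψ φ))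
        (surgeryForm (newtonMap p) (markedBasins p ζ) ψ φ) z =
      surgeryForm (newtonMap p) (markedBasins p ζ) ψ φ z := by
  filter_upwards [ae_invariant_of_mem h hinj hφ, ae_invariant_of_enters (φ := φ) hp h,
    ae_invariant_of_never (φ := φ) hp h] with z h1 h2 h3
  by_cases hzA : (z : OnePoint ℂ) ∈ ⋃ j, markedBasins p ζ j
  · exact h1 hzA
  by_cases hex : ∃ m : ℕ, (newtonMap p)^[m] z ∈ ⋃ j, markedBasins p ζ j
  · exact h2 hzA hex
  · exact h3 (not_exists.1 hex)

end MarkedBasins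

/-! ### The essential supremum and the area condition -/

section MarkedBasins

variable {p : Polynomial ℂ} {n : ℕ} {ζ c : Fin n → ℂ} {k : Fin n → ℕ} {b : Fin n → ℝ}
  {ψ φ : Fin n → OpenPartialHomeomorph ℂ ℂ} {S S₁ : Fin n → Set ℂ}

/-- At almost every point, either the form vanishes, or its modulus is the dilatation of the surgery
map at a point of the disc outside a given null set. -/
theorem ae_norm_surgeryForm (hp : 2 ≤ p.natDegree)
    (h : ∀ j, IsMarkedBasin p (ζ j) (c j) (k j) (b j) (ψ j)) (hinj : Function.Injective ζ)
    {E : Fin n → Set ℂ} (hE : ∀ j, volume (E j) = 0) :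
    ∀ᵐ z : ℂ, surgeryForm (newtonMap p) (markedBasins p ζ) ψ φ z = 0 ∨
      ∃ (m : ℕ) (j : Fin n) (w : ℂ), (newtonMap p)^[m] z = w ∧ w ∈ (ψ j).source ∧ ψ j w ∉ E j ∧
        ‖surgeryForm (newtonMap p) (markedBasins p ζ) ψ φ z‖ =
          ‖complexDilatation (φ j) (ψ j w)‖ := by
  classical
  have hnull : volume (⋃ j, {z ∈ (ψ j).source | ψ j z ∈ E j}) = 0 :=
    measure_iUnion_null fun j => (h j).volume_preimage_eq_zero (hE j)
  refine (ae_orbit_avoids hp hnull).mono fun z hz => ?_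
  by_cases hex : ∃ m : ℕ, (newtonMap p)^[m] z ∈ ⋃ j, markedBasins p ζ j
  · right
    obtain ⟨j, hj⟩ := Set.mem_iUnion.1 (Nat.find_spec hex)
    set m := Nat.find hex with hm
    obtain ⟨w, hw⟩ := OnePoint.ne_infty_iff_exists.1
      (ne_infty_of_mem_immediateBasin hp (h j).root hj)
    have hws : w ∈ (ψ j).source := (h j).mem_source.2 (hw ▸ hj)
    obtain ⟨h1, h2⟩ := hz m w hw.symm
    refine ⟨m, j, w, hw.symm, hws, fun hwE => h1 (Set.mem_iUnion.2 ⟨j, hws, hwE⟩), ?_⟩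
    exact norm_surgeryForm h hinj hw.symm hws (fun i hi => Nat.find_min hex hi) h2
  · exact Or.inl (surgeryForm_of_never (not_exists.1 hex))

theorem eLpNorm_surgeryForm (hp : 2 ≤ p.natDegree) (hn : 1 ≤ n)
    (h : ∀ j, IsMarkedBasin p (ζ j) (c j) (k j) (b j) (ψ j))
    (hinj : Function.Injective ζ) (hφ : ∀ j, IsDiskSurgery (k j) (b j) (φ j) (S j) (S₁ j)) :
    eLpNorm (surgeryForm (newtonMap p) (markedBasins p ζ) ψ φ) ⊤ volume = 1 := by
  set μ := surgeryForm (newtonMap p) (markedBasins p ζ) ψ φ with hμ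
  have hle : ∀ᵐ z : ℂ, ‖μ z‖ ≤ 1 := by
    refine (ae_norm_surgeryForm (φ := φ) hp h hinj
      fun j => ae_isRegularAt (hφ j).piecewise).mono fun z hz => ?_
    rcases hz with h0 | ⟨m, j, w, -, hw, hwE, heq⟩
    · rw [hμ, h0, norm_zero]; exact zero_le_one
    · rw [hμ, heq]
      refine le_of_lt (IsRegularAt.norm_complexDilatation_lt ?_)
      by_contra hr
      exact hwE ⟨(h j).mem_ball hw, hr⟩
  refine le_antisymm ?_ ?_
  · have := eLpNormEssSup_le_of_ae_bound hle
    rwa [ENNReal.ofReal_one] at this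
  · by_contra hlt
    push Not at hlt
    obtain ⟨q, hq1, hq2⟩ := ENNReal.lt_iff_exists_nnreal_btwn.1 hlt
    have hq : (q : ℝ) < 1 := by exact_mod_cast hq2
    have hae : ∀ᵐ z : ℂ, ‖μ z‖ ≤ q := by
      rw [eLpNorm_exponent_top] at hq1
      refine (ae_le_eLpNormEssSup (f := μ) (μ := volume)).mono fun z hz => ?_
      have := hz.trans hq1.le
      rw [enorm_le_coe] at this
      exact_mod_cast this
    set j : Fin n := ⟨0, hn⟩
    -- a bound `q` for the form would be a bound for the dilatation of the surgery map
    refine volume_large_dilatation_ne_zero (hφ j) (h j).one_lt_multiplier hq ?_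
    have h1 := volume_inter_preimage_eq_zero (f := (ψ j).symm) (Z := Metric.ball 0 1)
      (ae_iff.1 hae) fun u hu => ⟨(h j).differentiableOn_symm.analyticAt
        (Metric.isOpen_ball.mem_nhds hu), by
        rw [((h j).hasDerivAt_symm hu).deriv]
        exact inv_ne_zero ((h j).deriv_ne_zero ((h j).symm_mem hu))⟩
    refine measure_mono_null ?_ h1
    rintro u ⟨hu, hqu⟩
    refine ⟨hu, ?_⟩
    have hs := (h j).symm_mem hu
    have heq := norm_surgeryForm (φ := φ) h hinj (m := 0) (z := (ψ j).symm u) rfl hs (by simp) (by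
      have : inPlane (newtonMap p)^[0] = id := rfl
      rw [this]
      simp)
    rw [(h j).apply_symm hu] at heq
    simp only [Set.mem_preimage, Set.mem_ofPred_eq, not_le]
    rw [hμ, heq]
    exact hqu

/-- The parameters of the end of the sector of a disc surgery. -/
theorem IsMarkedBasin.exists_sector {p : Polynomial ℂ} {v c : ℂ} {k : ℕ} {b : ℝ}
    {ψ φ : OpenPartialHomeomorph ℂ ℂ} {S S₁ : Set ℂ} (h : IsMarkedBasin p v c k b ψ)
    (hφ : IsDiskSurgery k b φ S S₁) {R ρ : ℝ} (hR : 1 ≤ R) (hρ : 0 < ρ)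
    (hexp : ∀ z : ℂ, R < ‖z‖ → ∃ w : ℂ, newtonMap p z = w ∧ ‖w‖ ≤ ρ * ‖z‖) :
    ∃ (τ : ℂ → ℂ) (θ C ε₀ : ℝ) (M₀ : ℕ), 0 < C ∧ 0 < ε₀ ∧
      (∀ M ≥ M₀, ∀ m ≥ M, ∀ w ∈ modelQuad (multiplierAtOne k b) θ m,
        τ w ∈ ψ.source ∧ ρ ^ M * ρ⁻¹ ^ m ≤ ‖τ w‖ ∧
        newtonMap p (τ (w / multiplierAtOne k b)) = τ w) ∧
      ∀ᵐ u : ℂ, u ∈ Metric.ball (0 : ℂ) 1 → ∀ ε : ℝ, 0 < ε → ε < ε₀ →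
        1 - ε < ‖complexDilatation φ u‖ →
        ∃ i m : ℕ, ∃ w ∈ modelQuad (multiplierAtOne k b) θ m,
          (C * ε)⁻¹ < m ∧ (newtonMap p)^[i] (ψ.symm u) = τ w := by
  obtain ⟨κ, r, θ, m₀, hκ, hθ, hθπ, -, -, hS₁, C, hC, hK⟩ := hφ.quads
  obtain ⟨W, -, hSW⟩ := hφ.sector_end
  have hlam := h.one_lt_multiplier
  have hlam0 : 0 < multiplierAtOne k b := one_pos.trans hlam
  have hmem : ∀ m ≥ m₀, ∀ w ∈ modelQuad (multiplierAtOne k b) θ m,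
      κ w ∈ Metric.ball (0 : ℂ) 1 := fun m hm w hw =>
    hφ.sector_subset (hSW.subset (hS₁ ▸ Set.mem_biUnion (Set.mem_Ici.2 hm) ⟨w, hw, rfl⟩)).1
  obtain ⟨M₀, hM₀, hgrow⟩ := h.exists_le_norm_of_mem_modelQuad hκ hθ hθπ hmem hR hρ hexp
  obtain ⟨ε₀, hε₀, hae⟩ := h.ae_exists_iterate_mem_modelQuad hφ hC hS₁
    fun m hm => (hK m hm).mono fun z hz hzm => (hz hzm).2
  refine ⟨fun w => ψ.symm (κ w), θ, C, ε₀, M₀, hC, hε₀, fun M hM m hm w hw => ⟨?_, ?_, ?_⟩, ?_⟩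
  · exact h.symm_mem (hmem m (by omega) w hw)
  · exact (hgrow M hM m hm w hw).2
  · have hw' := div_mem_modelQuad hlam0 hw
    have h1 := (hgrow M hM (m + 1) (by omega) _ hw').1
    rw [lt_div_iff₀ hlam0, mul_comm] at h1
    rw [h.newtonMap_symm_linearizer hκ (hmem (m + 1) (by omega) _ hw') h1,
      mul_div_cancel₀ _ (by exact_mod_cast hlam0.ne')]
  · refine hae.mono fun u hu hub ε hε hεε hdil => ?_
    obtain ⟨i, m, w, hw, hm, hi⟩ := (hu hub).2 ε hε hεε hdil
    exact ⟨i, m, w, hw, hm, by rw [h.iterate_symm_conj hub, hi]⟩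

/-- A point where the modulus of the form exceeds `1 - ε` has an orbit that enters a quadrilateral
of index at least a multiple of `1 / ε`, and the area of the set of such points decays exponentially
in the index. -/
theorem exists_area_large_surgeryForm (hp : 2 ≤ p.natDegree) (hn : 1 ≤ n)
    (hcrit : ∀ c : ℂ, newtonMap p c ≠ OnePoint.infty → deriv (inPlane (newtonMap p)) c = 0 →
      (∃ v, p.eval v = 0 ∧ (c : OnePoint ℂ) ∈ basin (newtonMap p) v) ∨
      (Set.range fun m : ℕ => (newtonMap p)^[m] c).Finite)
    (h : ∀ j, IsMarkedBasin p (ζ j) (c j) (k j) (b j) (ψ j))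
    (hinj : Function.Injective ζ) (hφ : ∀ j, IsDiskSurgery (k j) (b j) (φ j) (S j) (S₁ j)) :
    ∃ M α ε₀ : ℝ, 0 < M ∧ 0 < α ∧ 0 < ε₀ ∧ ∀ ε : ℝ, 0 < ε → ε < ε₀ →
      sphericalArea {z | 1 - ε < ‖surgeryForm (newtonMap p) (markedBasins p ζ) ψ φ z‖} <
        ENNReal.ofReal (M * Real.exp (-α / ε)) := by
  classical
  obtain ⟨R, ρ, hR, hρ, hρ1, hexp, -, -⟩ := exists_expansion_at_infty hp
  choose τ θ C e₀ M₀ hC he₀ hτ hae using fun j => (h j).exists_sector (hφ j) hR hρ hexp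
  set j₀ : Fin n := ⟨0, hn⟩
  -- common constants for all marked basins
  set M := Finset.univ.sup M₀ with hM
  have hM₀ : ∀ j, M₀ j ≤ M := fun j => Finset.le_sup (Finset.mem_univ j)
  have hne : (Finset.univ : Finset (Fin n)).Nonempty := ⟨j₀, Finset.mem_univ _⟩
  set Cm := Finset.univ.sup' hne C
  have hCm : ∀ j, C j ≤ Cm := fun j => Finset.le_sup' C (Finset.mem_univ j)
  have hCm0 : 0 < Cm := (hC j₀).trans_le (hCm j₀)
  set em := Finset.univ.inf' hne e₀
  have hem : ∀ j, em ≤ e₀ j := fun j => Finset.inf'_le e₀ (Finset.mem_univ j)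
  have hem0 : 0 < em := (Finset.lt_inf'_iff hne).2 fun j _ => he₀ j
  -- `T m` is the union of the images in the plane of all quadrilaterals of index at least `m`
  set T : ℕ → Set ℂ := fun m => {t | ∃ j, ∃ m' : ℕ, m ≤ m' ∧ M ≤ m' ∧
    ∃ w ∈ modelQuad (multiplierAtOne (k j) (b j)) (θ j) m', t = τ j w} with hT
  obtain ⟨D, q, m₁, hD, hq0, hq1, harea⟩ := exists_area_entering_le hp hcrit (h j₀).root (T := T)
    (c := ρ ^ M) (Λ := ρ⁻¹) (fun m t ⟨j, m', h1, h2⟩ => ⟨j, m', by omega, h2⟩)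
    (by
      rintro m _ ⟨j, m', -, hm', w, hw, rfl⟩
      exact ⟨ζ j, (h j).root, immediateBasin_subset _ _
        ((h j).mem_source.1 (hτ j M (hM₀ j) m' hm' w hw).1)⟩)
    (by positivity) ((one_lt_inv₀ hρ).2 hρ1)
    (by
      rintro m _ ⟨j, m', hmm, hm', w, hw, rfl⟩
      refine le_trans ?_ (hτ j M (hM₀ j) m' hm' w hw).2.1
      have : 1 ≤ ρ⁻¹ := (one_le_inv₀ hρ).2 hρ1.le
      gcongr)
    (by
      rintro m _ ⟨j, m', hmm, hm', w, hw, rfl⟩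
      exact ⟨_, ⟨j, m' + 1, by omega, by omega, _,
        div_mem_modelQuad (one_pos.trans (h j).one_lt_multiplier) hw, rfl⟩,
        (hτ j M (hM₀ j) m' hm' w hw).2.2⟩)
  have hnorm := ae_norm_surgeryForm (φ := φ) hp h hinj fun j => ae_iff.1 (hae j)
  -- the index of the quadrilaterals that a point of dilatation above `1 - ε` can reach
  set L : ℝ := max m₁ M + 1 with hL
  have hL0 : 0 < L := by positivity
  have hlog : 0 < -Real.log q := neg_pos.2 (Real.log_neg hq0 hq1)
  refine ⟨D + 1, -Real.log q / Cm, min (min em (1 / (Cm * L))) 1, by positivity, by positivity,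
    lt_min (lt_min hem0 (by positivity)) one_pos, fun ε hε hεlt => ?_⟩
  have hε1 : ε < em := hεlt.trans_le ((min_le_left _ _).trans (min_le_left _ _))
  have hε2 : ε < 1 / (Cm * L) := hεlt.trans_le ((min_le_left _ _).trans (min_le_right _ _))
  have hε3 : ε < 1 := hεlt.trans_le (min_le_right _ _)
  have hLε : L < (Cm * ε)⁻¹ := by
    rw [lt_div_iff₀ (by positivity)] at hε2
    rw [lt_inv_comm₀ hL0 (by positivity), ← one_div, lt_div_iff₀ hL0]
    linarith
  set m := ⌈(Cm * ε)⁻¹⌉₊ with hm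
  have hmle : (Cm * ε)⁻¹ ≤ m := Nat.le_ceil _
  have hmm : max m₁ M ≤ m := by
    have : ((max m₁ M : ℕ) : ℝ) ≤ m := by linarith
    exact_mod_cast this
  have hsub : ∀ᵐ z : ℂ, z ∈ {z | 1 - ε < ‖surgeryForm (newtonMap p) (markedBasins p ζ) ψ φ z‖} →
      z ∈ {z : ℂ | ∃ l : ℕ, ∃ t ∈ T m, (newtonMap p)^[l] z = t} := by
    refine hnorm.mono fun z hz hzε => ?_
    rw [Set.mem_ofPred_eq] at hzε
    rcases hz with h0 | ⟨l, j, w, hzw, hw, hwE, heq⟩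
    · rw [h0, norm_zero] at hzε
      linarith
    · rw [heq] at hzε
      have hw1 := not_not.1 hwE ((h j).mem_ball hw) ε hε (hε1.trans_le (hem j)) hzε
      obtain ⟨i, m', u, hu, hm', hiu⟩ := hw1
      rw [(ψ j).left_inv hw] at hiu
      have hmm' : m ≤ m' := by
        refine Nat.ceil_le.2 (le_trans ?_ hm'.le)
        have := hC j
        gcongr
        exact hCm j
      refine ⟨i + l, τ j u,
        ⟨j, m', hmm', (le_max_right m₁ M).trans (hmm.trans hmm'), u, hu, rfl⟩, ?_⟩
      rw [Function.iterate_add_apply, hzw, hiu]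
  have hle : sphericalArea {z | 1 - ε < ‖surgeryForm (newtonMap p) (markedBasins p ζ) ψ φ z‖} ≤
      ENNReal.ofReal (D * q ^ m) := by
    refine le_trans (measure_mono_ae ?_) (harea m ((le_max_left _ _).trans hmm))
    exact (withDensity_absolutelyContinuous volume _).ae_le hsub
  refine hle.trans_lt ((ENNReal.ofReal_lt_ofReal_iff (by positivity)).2 ?_)
  have hqm : q ^ m ≤ Real.exp (-(-Real.log q / Cm) / ε) := by
    rw [← Real.exp_log (pow_pos hq0 m), Real.log_pow, Real.exp_le_exp]
    have e1 : -(-Real.log q / Cm) / ε = (Cm * ε)⁻¹ * Real.log q := by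
      field_simp
    rw [e1]
    nlinarith
  calc D * q ^ m ≤ D * Real.exp (-(-Real.log q / Cm) / ε) := by gcongr
    _ < (D + 1) * Real.exp (-(-Real.log q / Cm) / ε) := by
      have := Real.exp_pos (-(-Real.log q / Cm) / ε)
      nlinarith

end MarkedBasins

theorem _root_.IsMarkedNewtonMap.isMarkedBasin {p : Polynomial ℂ} {n : ℕ} {ζ c : Fin n → ℂ}
    {k : Fin n → ℕ} (hp : IsMarkedNewtonMap p ζ c k) {b : Fin n → ℝ}
    {ψ : Fin n → OpenPartialHomeomorph ℂ ℂ}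
    (hψ : ∀ j, IsNormalizedRiemannMap (newtonMap p) (immediateBasin (newtonMap p) (ζ j))
      (c j) (b j) (ψ j)) (j : Fin n) : IsMarkedBasin p (ζ j) (c j) (k j) (b j) (ψ j) where
  natDegree := by
    have h1 := hp.degree.trans (Multiset.toFinset_card_le _)
    have h2 := Polynomial.card_roots' p
    omega
  root := eval_eq_zero_of_newtonMap_eq_self (hp.fixed j)
  multiplier := hp.multiplier j
  center_mem := hp.center_mem j
  critical := (hp.center_unique j _ (hp.center_mem j)).2 rfl
  center_maximal := hp.center_maximal j
  center_degree := hp.center_degree j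
  riemann := hψ j

/-- A finite critical point in the sense of derivatives is a critical point of the sphere map. -/
theorem isCriticalPoint_of_deriv_eq_zero {p : Polynomial ℂ} (hp : 2 ≤ p.natDegree) {z : ℂ}
    (hz : newtonMap p z ≠ OnePoint.infty) (hd : deriv (inPlane (newtonMap p)) z = 0) :
    IsCriticalPoint (newtonMap p) z := by
  intro U hU hinj
  have hp0 : p ≠ 0 := by rintro rfl; simp at hp
  rw [OnePoint.nhds_coe_eq, Filter.mem_map] at hU
  have hfin := eventually_iterate_ne_infty hp (m := 1) hz
  refine deriv_ne_zero_of_injOn (analyticAt_inPlane_newtonMap hp0 hz)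
    (Filter.inter_mem hU hfin) (fun x hx y hy hxy => ?_) hd
  refine OnePoint.coe_injective (hinj hx.1 hy.1 ?_)
  have hx2 : newtonMap p x ≠ OnePoint.infty := hx.2
  have hy2 : newtonMap p y ≠ OnePoint.infty := hy.2
  rw [← coe_inPlane hx2, hxy, coe_inPlane hy2]

end NewtonSurgery

theorem mainTheorem3 (p : Polynomial ℂ) (n : ℕ) (hn : 1 ≤ n) (ζ c : Fin n → ℂ) (k : Fin n → ℕ)
    (hp : IsMarkedNewtonMap p ζ c k)
    (b : Fin n → ℝ) (ψ : Fin n → OpenPartialHomeomorph ℂ ℂ)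
    (hψ : ∀ j, IsNormalizedRiemannMap (newtonMap p) (immediateBasin (newtonMap p) (ζ j))
      (c j) (b j) (ψ j))
    (φ : Fin n → OpenPartialHomeomorph ℂ ℂ) (S S₁ : Fin n → Set ℂ)
    (hφ : ∀ j, IsDiskSurgery (k j) (b j) (φ j) (S j) (S₁ j)) :
    (∀ᵐ z : ℂ, beltramiPullback
        (inPlane (modelMap (newtonMap p) (fun j => immediateBasin (newtonMap p) (ζ j)) k ψ φ))
        (surgeryForm (newtonMap p) (fun j => immediateBasin (newtonMap p) (ζ j)) ψ φ) z =
      surgeryForm (newtonMap p) (fun j => immediateBasin (newtonMap p) (ζ j)) ψ φ z) ∧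
    IsDavidBeltrami
      (surgeryForm (newtonMap p) (fun j => immediateBasin (newtonMap p) (ζ j)) ψ φ) := by
  have h := hp.isMarkedBasin hψ
  have hdeg : 2 ≤ p.natDegree := (h ⟨0, hn⟩).natDegree
  refine ⟨NewtonSurgery.ae_invariant hdeg h hp.injective hφ,
    NewtonSurgery.measurable_surgeryForm hdeg h,
    NewtonSurgery.eLpNorm_surgeryForm hdeg hn h hp.injective hφ,
    NewtonSurgery.exists_area_large_surgeryForm hdeg hn (fun x hx hd => ?_) h hp.injective hφ⟩
  by_cases hb : ∃ j, (x : OnePoint ℂ) ∈ basin (newtonMap p) (ζ j)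
  · obtain ⟨j, hj⟩ := hb
    exact Or.inl ⟨ζ j, (h j).root, hj⟩
  · exact Or.inr (hp.finite_orbit x (NewtonSurgery.isCriticalPoint_of_deriv_eq_zero hdeg hx hd)
      (not_exists.1 hb))
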